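/- Let $G=(V,E)$ be a connected simple graph with $V=\{1,\dots,n\}$, $m=|E|$, and let $w:E\to\mathbb R_{\ge 0}$. For $S\subseteq V$ let $\delta(S)$ be the set of edges with exactly one end in $S$ and $w(\delta(S))=\sum_{e\in\delta(S)}w(e)$. The Weighted Connected Maximum Cut problem asks for a nonempty $S$ with $G[S]$ connected that maximizes $w(\delta(S))$. **Algorithm for $\{0,1\}$ weights.** The input is a connected graph $H$ with edge weights in $\{0,1\}$; let $W_H(v)$ be the number of weight-1 edges (1-edges) at $v$. (a) While some vertex $v$ has $W_H(v)=0$, delete $v$ and join its neighbours pairwise by edges of weight 0 where they are not adjacent. A solution $S'$ of the new graph is turned into $S'$ if $S'$ is nonempty and connected in the old graph, and into $S'\cup\{v\}$ otherwise. (b) Then, while there is a path $v_0v_1v_2v_3$ with four distinct vertices such that $v_1,v_2,v_3$ have degree two, replace it by a path $v_0vv_3$ with a new vertex $v$: both new edges get weight 1 if the old path has at least two 1-edges, only $vv_3$ gets weight 1 if it has exactly one, and neither if it has none. A solution $S'$ of the new graph is turned into the best connected set among $(S'\setminus\{v\})\cup X$, $X\subseteq\{v_1,v_2\}$. (c) In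 the reduced graph $H$, with $N$ vertices and $\eta$ 1-edges, construct subtrees $T_1,T_2,\dots$ with leaf sets $L_1,L_2,\dots$ (vertices of degree at most one in the tree): $T_i$ is a spanning tree of the current graph, obtained from an arbitrary spanning tree by exchanging one tree edge for one non-tree edge as long as this can decrease the number of degree-two vertices of the tree; then $L_i$ is deleted from the current graph, paths as in (b) are contracted, and this is repeated until no vertex is left; every tree is lifted to a subtree of $H$ with the same leaves by re-expanding the contracted paths. If $\eta\le 4N\lfloor\log_2N\rfloor$ put $T=T_1$; otherwise let $T$ be a tree $T_i$ maximizing $\sum_{v\in L_i}W_H(v)$. Split the leaf set of $T$ greedily into $L',L''$, placing each leaf in turn on the side to which it has fewer 1-edges, and take the better of the connected sets among $V(T)\setminus L'$ and $V(T)\setminus L''$. Undo the reductions (b) and (a). **Algorithm for weights $w$.** Let $\varepsilon>0$ be a parameter, $w_{\max}=\max_e w(e)$, $w_0=\varepsilon w_{\max}/m$ and $w_i=w_0(1+\varepsilon)^i$. For each integer $0\le i\le\log_{1+\varepsilon}(m/\varepsilon)$ let $w_i'(e)=1$ if $w_i\le w(e)<w_{i+1}$ and $w_i'(e)=0$ otherwise,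 and let $S_i$ be the result of the $\{0,1\}$ algorithm for $(G,w_i')$. Return a set $S_{best}$ among the $S_i$ with the largest $w(\delta(S_i))$. **Theorem.** For every $\varepsilon\in(0,1]$ there are a constant $c>0$ and a polynomial $p$, depending only on $\varepsilon$, such that for every $n$, every connected graph $G$ on $n$ vertices and every $w:E\to\mathbb R_{\ge0}$ the algorithm returns a nonempty set $S_{best}$ with $G[S_{best}]$ connected, it takes at most $p(n)$ elementary steps (with unit-cost operations on real numbers), and, if $n\ge2$, $$w(\delta(S_{best}))\ \ge\ \frac{c}{\log^2 n}\;w(\delta(T))$$ for every $T\subseteq V$ with $G[T]$ connected; that is, the algorithm is an $\Omega(1/\log^2 n)$-approximation algorithm for Weighted Connected Maximum Cut. -/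

import Mathlib

namespace CMC

/-! ### Step-counted computations

Unit-cost (real RAM) model.  A value of type `Timed α` is a result together with the number of
elementary steps spent on it.  One elementary step (`op`) evaluates an expression built from a
bounded number of array reads, comparisons, Boolean operations and arithmetic operations on
natural or real numbers.  Every traversal of `Fin n` or of a list costs, for each index, the cost
of the body plus one step.  Arrays are represented by functions on `Fin n`; a new array is only
ever produced by `table`, which pays for every entry. -/

structure Timed (α : Type) where
  val : α
  time : ℕ

namespace Timed

instance : Monad Timed where
  pure a := ⟨a, 0⟩
  bind x f := ⟨(f x.val).val, x.time + (f x.val).time⟩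

/-- One elementary step. -/
def op {α : Type} (a : α) : Timed α := ⟨a, 1⟩

/-- The steps of a full traversal of `Fin n`. -/
def loopTime {n : ℕ} {α : Type} (f : Fin n → Timed α) : ℕ := ∑ i, ((f i).time + 1)

/-- Fill an array of length `n`. -/
def table {n : ℕ} {α : Type} (f : Fin n → Timed α) : Timed (Fin n → α) :=
  ⟨fun i => (f i).val, loopTime f⟩

/-- Fill an `n × n` matrix. -/
def table₂ {n : ℕ} {α : Type} (f : Fin n → Fin n → Timed α) : Timed (Fin n → Fin n → α) :=
  table fun i => table fun j => f i j

def anyT {n : ℕ} (f : Fin n → Timed Bool) : Timed Bool :=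
  ⟨decide (∃ i, (f i).val = true), loopTime f⟩

def allT {n : ℕ} (f : Fin n → Timed Bool) : Timed Bool :=
  ⟨decide (∀ i, (f i).val = true), loopTime f⟩

def sumT {n : ℕ} {α : Type} [AddCommMonoid α] (f : Fin n → Timed α) : Timed α :=
  ⟨∑ i, (f i).val, loopTime f⟩

/-- The maximum of `0` and the computed values. -/
noncomputable def maxT {n : ℕ} (f : Fin n → Timed ℝ) : Timed ℝ :=
  ⟨(List.finRange n).foldr (fun i a => max (f i).val a) 0, loopTime f⟩

/-- The result at the first index where there is one. -/
def firstT {n : ℕ} {α : Type} (f : Fin n → Timed (Option α)) : Timed (Option α) :=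
  ⟨(List.finRange n).findSome? fun i => (f i).val, loopTime f⟩

def foldT {α β : Type} (f : β → α → Timed β) : β → List α → Timed β
  | b, [] => pure b
  | b, a :: l => do
    let b' ← f b a
    let r ← foldT f b' l
    op r

def mapT {α β : Type} (f : α → Timed β) : List α → Timed (List β)
  | [] => pure []
  | a :: l => do
    let b ← f a
    let bs ← mapT f l
    op (b :: bs)

/-- Apply `f` successively `k` times. -/
def repeatT {α : Type} (f : α → Timed α) : ℕ → α → Timed α
  | 0, a => pure a
  | k + 1, a => do
    let a' ← f a
    let r ← repeatT f k a'
    op r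

end Timed

open Timed

/-! ### Graphs, as the algorithms store them -/

/-- A set of vertices. -/
abbrev VSet (n : ℕ) := Fin n → Bool

/-- An adjacency matrix. -/
abbrev Mat (n : ℕ) := Fin n → Fin n → Bool

/-- A `{0,1}`-weighted graph: its vertices, its edges, and its edges of weight `1`. -/
structure BGraph (n : ℕ) where
  vert : VSet n
  adj : Mat n
  one : Mat n

/-- A subtree of a graph: its vertices and its edges. -/
structure Tree (n : ℕ) where
  vert : VSet n
  adj : Mat n

section Basic

variable {n : ℕ}

def emptySet : Timed (VSet n) := table fun _ => op false

/-- The vertices of `X` reachable from `r` inside `X`. -/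
def reach (adj : Mat n) (X : VSet n) (r : Fin n) : Timed (VSet n) := do
  let R₀ ← table fun v => op (decide (v = r))
  repeatT (fun R => table fun v => do
    let b ← anyT fun u => op (R u && adj u v)
    op (R v || (X v && b))) n R₀

/-- Is `X` nonempty and connected with respect to `adj`? -/
def isConn (adj : Mat n) (X : VSet n) : Timed Bool := do
  let o ← firstT fun v => op (if X v then some v else none)
  match o with
  | none => op false
  | some r => do
    let R ← reach adj X r
    allT fun v => op (!X v || R v)

/-- The number of entries of row `v`; for `adj` the degree, for `one` the number `W(v)` of
`1`-edges at `v`. -/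
def degree (M : Mat n) (v : Fin n) : Timed ℕ :=
  sumT fun u => op (if M v u then 1 else 0)

/-- The number of `1`-edges with exactly one end in `X`. -/
def cutOnes (g : BGraph n) (X : VSet n) : Timed ℕ :=
  sumT fun u => sumT fun v => op (if X u && !X v && g.one u v then 1 else 0)

/-- Among the members of a list that are connected in `g`, one with the most `1`-edges in its
cut. -/
def chooseBest (g : BGraph n) (Xs : List (VSet n)) : Timed (VSet n) := do
  let start ← emptySet
  foldT (fun B X => do
    let cX ← isConn g.adj X
    let cB ← isConn g.adj B
    let kX ← cutOnes g X
    let kB ← cutOnes g B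
    op (if cX && (!cB || decide (kB < kX)) then X else B)) start Xs

/-! ### Removing vertices without `1`-edges -/

def findZeroVertex (g : BGraph n) : Timed (Option (Fin n)) :=
  firstT fun v => do
    let d ← degree g.one v
    op (if g.vert v && decide (d = 0) then some v else none)

/-- Delete `z` and join its neighbours pairwise by `0`-edges. -/
def eliminate (g : BGraph n) (z : Fin n) : Timed (BGraph n) := do
  let vert ← table fun v => op (g.vert v && decide (v ≠ z))
  let adj ← table₂ fun u v =>
    op (decide (u ≠ z) && decide (v ≠ z) && decide (u ≠ v) &&
      (g.adj u v || (g.adj u z && g.adj z v)))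
  let one ← table₂ fun u v => op (g.one u v && decide (u ≠ z) && decide (v ≠ z))
  op ⟨vert, adj, one⟩

/-! ### Shrinking thin paths -/

/-- Four distinct vertices `v₀ v₁ v₂ v₃` of a path. -/
structure Quad (n : ℕ) where
  v₀ : Fin n
  v₁ : Fin n
  v₂ : Fin n
  v₃ : Fin n

/-- A path `v₀ v₁ v₂ v₃` whose vertices `v₁, v₂, v₃` have degree two. -/
def findThinPath (g : BGraph n) : Timed (Option (Quad n)) := do
  let d ← table fun v => degree g.adj v
  firstT fun a => firstT fun b => firstT fun c => firstT fun e =>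
    op (if g.adj a b && g.adj b c && g.adj c e &&
        decide (a ≠ c) && decide (b ≠ e) && decide (a ≠ e) &&
        decide (d b = 2) && decide (d c = 2) && decide (d e = 2)
      then some ⟨a, b, c, e⟩ else none)

/-- Is `{u, v} = {a, b}`? -/
def samePair (u v a b : Fin n) : Bool :=
  (decide (u = a) && decide (v = b)) || (decide (u = b) && decide (v = a))

/-- Replace the path `v₀ v₁ v₂ v₃` by a path `v₀ v v₃`, where `v₁` is reused as the new vertex
`v`.  If the old path has at least two `1`-edges, then both new edges are `1`-edges; if it has
one, then only `v v₃` is; if it has none, then neither is. -/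
def shrink (g : BGraph n) (p : Quad n) : Timed (BGraph n) := do
  let k ← op ((if g.one p.v₀ p.v₁ then 1 else 0) + (if g.one p.v₁ p.v₂ then 1 else 0) +
    (if g.one p.v₂ p.v₃ then 1 else 0) : ℕ)
  let vert ← table fun v => op (g.vert v && decide (v ≠ p.v₂))
  let adj ← table₂ fun u v =>
    op ((g.adj u v && decide (u ≠ p.v₂) && decide (v ≠ p.v₂)) || samePair u v p.v₁ p.v₃)
  let one ← table₂ fun u v =>
    op (if samePair u v p.v₀ p.v₁ then decide (2 ≤ k)
      else if samePair u v p.v₁ p.v₃ then decide (1 ≤ k)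
      else g.one u v && decide (u ≠ p.v₂) && decide (v ≠ p.v₂))
  op ⟨vert, adj, one⟩

/-- Turn a solution `S` of the shrunk graph into one of `g`: outside of the two inner vertices
`v₁, v₂` keep `S`, and take the best of the four possibilities for these two. -/
def recover (g : BGraph n) (p : Quad n) (S : VSet n) : Timed (VSet n) := do
  let X₀ ← table fun v => op (S v && decide (v ≠ p.v₁) && decide (v ≠ p.v₂))
  let X₁ ← table fun v => op (X₀ v || decide (v = p.v₁))
  let X₂ ← table fun v => op (X₀ v || decide (v = p.v₂))
  let X₃ ← table fun v => op (X₁ v || decide (v = p.v₂))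
  chooseBest g [X₀, X₁, X₂, X₃]

/-- Turn a subtree of the shrunk graph into one of `g`: the edge `v₁ v₃`, if used, becomes the
path `v₁ v₂ v₃`. -/
def liftTree (p : Quad n) (T : Tree n) : Timed (Tree n) := do
  let vert ← table fun v => op (T.vert v || (T.adj p.v₁ p.v₃ && decide (v = p.v₂)))
  let adj ← table₂ fun u v =>
    op (if T.adj p.v₁ p.v₃ then
        (T.adj u v && !samePair u v p.v₁ p.v₃) || samePair u v p.v₁ p.v₂ ||
          samePair u v p.v₂ p.v₃
      else T.adj u v)
  op ⟨vert, adj⟩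

/-! ### Spanning trees with many leaves -/

/-- A spanning tree: go through all pairs and delete each edge whose deletion keeps the graph
connected. -/
def spanningTree (g : BGraph n) : Timed (Tree n) := do
  let M₀ ← table₂ fun u v => op (g.adj u v)
  let M ← foldT (fun M a => foldT (fun M b =>
    if M a b then do
      let M' ← table₂ fun u v => op (M u v && !samePair u v a b)
      let c ← isConn M' g.vert
      op (if c then M' else M)
    else op M) M (List.finRange n)) M₀ (List.finRange n)
  op ⟨g.vert, M⟩

/-- The number of vertices of degree two. -/
def countDeg2 (M : Mat n) : Timed ℕ :=
  sumT fun v => do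
    let d ← degree M v
    op (if d = 2 then 1 else 0)

/-- Exchange a tree edge `ab` for an edge `xy` of `g` outside of the tree, so that the result is
again a spanning tree and has fewer vertices of degree two, if this is possible. -/
def improve (g : BGraph n) (T : Tree n) : Timed (Tree n) := do
  let k ← countDeg2 T.adj
  let o ← firstT fun a => firstT fun b => firstT fun x => firstT fun y =>
    if T.adj a b && g.adj x y && !T.adj x y then do
      let M ← table₂ fun u v => op ((T.adj u v && !samePair u v a b) || samePair u v x y)
      let c ← isConn M g.vert
      let k' ← countDeg2 M
      op (if c && decide (k' < k) then some M else none)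
    else op none
  match o with
  | none => op T
  | some M => op ⟨T.vert, M⟩

/-- A spanning tree with many leaves, by local search. -/
def leafyTree (g : BGraph n) : Timed (Tree n) := do
  let T ← spanningTree g
  repeatT (improve g) n T

/-- The leaves of a tree; the vertex of a one-vertex tree counts as a leaf. -/
def leaves (T : Tree n) : Timed (VSet n) :=
  table fun v => do
    let d ← degree T.adj v
    op (T.vert v && decide (d ≤ 1))

def deleteSet (g : BGraph n) (L : VSet n) : Timed (BGraph n) := do
  let vert ← table fun v => op (g.vert v && !L v)
  let adj ← table₂ fun u v => op (g.adj u v && !L u && !L v)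
  let one ← table₂ fun u v => op (g.one u v && !L u && !L v)
  op ⟨vert, adj, one⟩

/-- The trees `T₁, T₂, …`, as subtrees of `g`: shrink thin paths, take a spanning tree with many
leaves, delete its leaves, and repeat until no vertex is left.  The first argument bounds the
number of rounds; each round removes a vertex. -/
def peel : ℕ → BGraph n → Timed (List (Tree n))
  | 0, _ => pure []
  | k + 1, g => do
    let ne ← anyT fun v => op (g.vert v)
    if ne then do
      let o ← findThinPath g
      match o with
      | some p => do
        let g' ← shrink g p
        let Ts ← peel k g'
        mapT (liftTree p) Ts
      | none => do
        let T ← leafyTree g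
        let L ← leaves T
        let g' ← deleteSet g L
        let Ts ← peel k g'
        op (T :: Ts)
    else op []

/-! ### From a thick tree to a connected cut -/

/-- Split `L` into two parts: go through `L` and put each vertex on the side where it has fewer
`1`-edges. -/
def splitLeaves (g : BGraph n) (L : VSet n) : Timed (VSet n × VSet n) := do
  let A₀ ← emptySet
  let B₀ ← emptySet
  foldT (fun P v =>
    if L v then do
      let a ← sumT fun u => op (if P.1 u && g.one u v then 1 else 0 : ℕ)
      let b ← sumT fun u => op (if P.2 u && g.one u v then 1 else 0 : ℕ)
      if a ≤ b then do
        let A ← table fun u => op (P.1 u || decide (u = v))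
        op (A, P.2)
      else do
        let B ← table fun u => op (P.2 u || decide (u = v))
        op (P.1, B)
    else op P) (A₀, B₀) (List.finRange n)

/-- The better of `T ∖ L₁` and `T ∖ L₂`, where `L₁, L₂` split the leaves of `T`. -/
def treeCut (g : BGraph n) (T : Tree n) : Timed (VSet n) := do
  let L ← leaves T
  let P ← splitLeaves g L
  let X₁ ← table fun v => op (T.vert v && !P.1 v)
  let X₂ ← table fun v => op (T.vert v && !P.2 v)
  chooseBest g [X₁, X₂]

/-- The number of `1`-edges at the leaves of `T`, counted at each leaf: `∑ W(v)` over the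
leaves `v`. -/
def thickness (g : BGraph n) (T : Tree n) : Timed ℕ := do
  let L ← leaves T
  sumT fun v => do
    let d ← degree g.one v
    op (if L v then d else 0)

/-- `⌊log₂ k⌋`, by repeated doubling. -/
def logT (k : ℕ) : Timed ℕ := ⟨Nat.log 2 k, Nat.log 2 k + 1⟩

/-- The algorithm for reduced graphs, in which every vertex has a `1`-edge and no thin path is
left: with `η` the number of `1`-edges and `N` the number of vertices, use the first tree if
`η ≤ 4 N log N`, and otherwise the thickest of all the trees. -/
def thickSolve (g : BGraph n) : Timed (VSet n) := do
  let N ← sumT fun v => op (if g.vert v then 1 else 0 : ℕ)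
  let η ← sumT fun u => sumT fun v => op (if decide (u < v) && g.one u v then 1 else 0 : ℕ)
  let ℓ ← logT N
  let T₁ ← leafyTree g
  if η ≤ 4 * N * ℓ then treeCut g T₁
  else do
    let Ts ← peel n g
    let T ← foldT (fun B T => do
      let b ← thickness g B
      let t ← thickness g T
      op (if b < t then T else B)) T₁ Ts
    treeCut g T

/-! ### The algorithm for `{0,1}`-weights -/

/-- The `{0,1}`-connected maximum cut algorithm: remove the vertices without `1`-edges one by
one, then shrink the thin paths one by one, then use `thickSolve`, and undo the reductions.  The
first argument bounds the number of reductions; each of them removes a vertex. -/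
def bcmc : ℕ → BGraph n → Timed (VSet n)
  | 0, _ => emptySet
  | k + 1, g => do
    let z ← findZeroVertex g
    match z with
    | some v => do
      let g' ← eliminate g v
      let S ← bcmc k g'
      let c ← isConn g.adj S
      if c then op S else table fun u => op (S u || decide (u = v))
    | none => do
      let o ← findThinPath g
      match o with
      | some p => do
        let g' ← shrink g p
        let S ← bcmc k g'
        recover g p S
      | none => thickSolve g

end Basic

/-! ### The algorithm for real weights -/

section Weighted

variable {n : ℕ}

/-- `x ^ i`, by repeated multiplication. -/
noncomputable def powT (x : ℝ) (i : ℕ) : Timed ℝ := ⟨x ^ i, i + 1⟩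

/-- `⌊log_b x⌋` for `b > 1` and `x ≥ 1`, by repeated multiplication with `b`. -/
noncomputable def floorLogT (b x : ℝ) : Timed ℕ := ⟨⌊Real.logb b x⌋₊, ⌊Real.logb b x⌋₊ + 1⟩

/-- The total weight of the edges with exactly one end in `X`. -/
noncomputable def cutSum (adj : Mat n) (wt : Fin n → Fin n → ℝ) (X : VSet n) : Timed ℝ :=
  sumT fun u => sumT fun v => op (if X u && !X v && adj u v then wt u v else 0)

open Classical in
/-- The solution `S_i` for the weight class `w_i ≤ w < w_{i+1}`, where
`w_i = w_0 (1 + ε) ^ i`. -/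
noncomputable def classSolve (ε : ℝ) (adj : Mat n) (wt : Fin n → Fin n → ℝ) (w₀ : ℝ) (i : ℕ) :
    Timed (VSet n) := do
  let q ← powT (1 + ε) i
  let lo ← op (w₀ * q)
  let hi ← op (lo * (1 + ε))
  let vert ← table fun _ : Fin n => op true
  let one ← table₂ fun u v => op (adj u v && decide (lo ≤ wt u v) && decide (wt u v < hi))
  bcmc n ⟨vert, adj, one⟩

open Classical in
/-- The weighted connected maximum cut algorithm, on an adjacency matrix and a matrix of
weights. -/
noncomputable def wcmc (ε : ℝ) (adj : Mat n) (wt : Fin n → Fin n → ℝ) : Timed (VSet n) := do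
  let m ← sumT fun u => sumT fun v => op (if decide (u < v) && adj u v then 1 else 0 : ℕ)
  let wmax ← maxT fun u => maxT fun v => op (if adj u v then wt u v else 0)
  let w₀ ← op (ε * wmax / m)
  let K ← floorLogT (1 + ε) (m / ε)
  let S₀ ← classSolve ε adj wt w₀ 0
  let Ss ← mapT (fun j => classSolve ε adj wt w₀ (j + 1)) (List.range K)
  foldT (fun B S => do
    let b ← cutSum adj wt B
    let s ← cutSum adj wt S
    op (if b < s then S else B)) S₀ Ss

open Classical in
/-- The weighted connected maximum cut algorithm run on a graph `G` with edge weights `w`. -/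
noncomputable def runWCMC (ε : ℝ) (G : SimpleGraph (Fin n)) (w : Sym2 (Fin n) → ℝ) :
    Timed (VSet n) :=
  wcmc ε (fun u v => decide (G.Adj u v)) (fun u v => w s(u, v))

/-! ### The problem -/

/-- `δ(S)`: the edges of `G` with exactly one end in `S`. -/
def cut (G : SimpleGraph (Fin n)) (S : Set (Fin n)) : Set (Sym2 (Fin n)) :=
  {e | e ∈ G.edgeSet ∧ ∃ u ∈ S, ∃ v ∉ S, e = s(u, v)}

open Classical in
/-- The weight of the cut `δ(S)`. -/
noncomputable def cutWeight (G : SimpleGraph (Fin n)) (w : Sym2 (Fin n) → ℝ)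
    (S : Set (Fin n)) : ℝ :=
  ∑ e ∈ (cut G S).toFinset, w e

/-- The set that the algorithm returns. -/
def output (r : Timed (VSet n)) : Set (Fin n) := {v | r.val v = true}

end Weighted

end CMC

/-!
Both reductions preserve the optimum: a solution of the reduced graph pulls back to one of the
original graph that cuts at least as many `1`-edges, and conversely. So let the graph be reduced,
with `N` vertices and `η` `1`-edges. In a spanning tree that no exchange of edges improves, a
vertex all of whose tree vertices at distance at most three have degree two would lie on a
contractible path. Hence every degree-two vertex of the tree is close to a vertex of another
degree, and at least `N / 45` of the vertices are leaves. Splitting the leaves greedily and then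
cutting off one side cuts at least a quarter of the sum of their `1`-degrees. If `η = O(N log N)`,
the leaves of one tree suffice, because every vertex lies on a `1`-edge. Otherwise `O(log N)`
trees are peeled off, and every vertex is a leaf of one of them or is contracted in between; the
`1`-edges between contracted vertices number `O(N)`, so the leaves of some tree meet
`Ω(η / log N)` `1`-edges.

For real weights, every edge is in one of `O(log n)` weight classes, within which weights differ
by a factor of at most `1 + ε`, or it is so light that all such edges together weigh at most `ε`
times the maximum weight. An endpoint of a heaviest edge is a solution of the class of that edge,
so the returned set pays for the light edges as well.
-/

namespace CMC

open Timed

/-! ### Values of the step-counted combinators -/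

namespace Timed

variable {α β : Type} {n : ℕ}

@[simp] lemma bind_val (x : Timed α) (f : α → Timed β) : (x >>= f).val = (f x.val).val := rfl

@[simp] lemma op_val (a : α) : (op a).val = a := rfl

@[simp] lemma table_val (f : Fin n → Timed α) : (table f).val = fun i => (f i).val := rfl

@[simp] lemma table₂_val (f : Fin n → Fin n → Timed α) :
    (table₂ f).val = fun i j => (f i j).val := rfl

@[simp] lemma anyT_val (f : Fin n → Timed Bool) : (anyT f).val = decide (∃ i, (f i).val) := rfl

@[simp] lemma allT_val (f : Fin n → Timed Bool) : (allT f).val = decide (∀ i, (f i).val) := rfl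

@[simp] lemma sumT_val [AddCommMonoid α] (f : Fin n → Timed α) :
    (sumT f).val = ∑ i, (f i).val := rfl

@[simp] lemma foldT_val (f : β → α → Timed β) (b : β) (l : List α) :
    (foldT f b l).val = l.foldl (fun b a => (f b a).val) b := by
  induction l generalizing b with
  | nil => rfl
  | cons a l ih => simpa [foldT] using ih _

@[simp] lemma mapT_val (f : α → Timed β) (l : List α) :
    (mapT f l).val = l.map fun a => (f a).val := by
  induction l with
  | nil => rfl
  | cons a l ih => simpa [mapT] using ih

@[simp] lemma repeatT_val (f : α → Timed α) (k : ℕ) (a : α) :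
    (repeatT f k a).val = (fun x => (f x).val)^[k] a := by
  induction k generalizing a with
  | zero => rfl
  | succ k ih => simpa [repeatT] using ih _

lemma firstT_val_eq_none {f : Fin n → Timed (Option α)} :
    (firstT f).val = none ↔ ∀ i, (f i).val = none := by
  simp [firstT]

lemma exists_of_firstT_val_eq_some {f : Fin n → Timed (Option α)} {a : α}
    (h : (firstT f).val = some a) : ∃ i, (f i).val = some a := by
  obtain ⟨i, -, hi⟩ := List.exists_of_findSome?_eq_some h
  exact ⟨i, hi⟩

end Timed

section Iteration

variable {α β : Type*}

lemma isFixedPt_iterate_of_lt {F : α → α} {μ : α → ℕ} (h : ∀ a, F a ≠ a → μ (F a) < μ a)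
    {k : ℕ} {a : α} (hk : μ a ≤ k) : Function.IsFixedPt F (F^[k] a) := by
  induction k generalizing a with
  | zero =>
    by_contra hne
    exact (h a hne).not_ge (hk.trans (Nat.zero_le _))
  | succ k ih =>
    by_cases hfix : F a = a
    · rw [Function.iterate_fixed hfix]
      exact hfix
    · rw [Function.iterate_succ_apply]
      exact ih (Nat.le_of_lt_succ ((h a hfix).trans_le hk))

/-- A maximizer of the score `f` on `a :: l`: the one that is found by running through the list
and keeping the best element so far. -/
def argmaxFrom [LT β] [DecidableLT β] (f : α → β) (a : α) (l : List α) : α :=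
  l.foldl (fun b c => if f b < f c then c else b) a

lemma argmaxFrom_mem_and_le [LinearOrder β] (f : α → β) (a : α) (l : List α) :
    argmaxFrom f a l ∈ a :: l ∧ ∀ b ∈ a :: l, f b ≤ f (argmaxFrom f a l) := by
  induction l generalizing a with
  | nil => simp [argmaxFrom]
  | cons c l ih =>
    have hstep : argmaxFrom f a (c :: l) = argmaxFrom f (if f a < f c then c else a) l := rfl
    obtain ⟨hmem, hle⟩ := ih (if f a < f c then c else a)
    have := hle _ List.mem_cons_self
    rw [hstep]
    constructor <;> grind

lemma argmaxFrom_mem [LinearOrder β] (f : α → β) (a : α) (l : List α) :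
    argmaxFrom f a l ∈ a :: l :=
  (argmaxFrom_mem_and_le f a l).1

lemma le_argmaxFrom [LinearOrder β] (f : α → β) {a b : α} {l : List α} (hb : b ∈ a :: l) :
    f b ≤ f (argmaxFrom f a l) :=
  (argmaxFrom_mem_and_le f a l).2 b hb

end Iteration

/-! ### Connected vertex sets -/

section Connected

variable {V : Type*} {M M' : V → V → Bool} {X Y : V → Bool} {a b : V}

/-- `X` is nonempty and connected with respect to the adjacency matrix `M`, expressed by the
induction principle that a property which holds somewhere on `X` and spreads along the edges
inside `X` holds on all of `X`. -/
def ConnOn (M : V → V → Bool) (X : V → Bool) : Prop :=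
  (∃ v, X v) ∧ ∀ P : V → Prop, (∃ r, X r ∧ P r) →
    (∀ u v, X u → X v → P u → M u v → P v) → ∀ v, X v → P v

/-- The matrix `M` is symmetric. -/
def IsSymm (M : V → V → Bool) : Prop := ∀ u v, M u v = M v u

lemma ConnOn.mono (h : ConnOn M X) (hM : ∀ u v, X u → X v → M u v → M' u v) : ConnOn M' X :=
  ⟨h.1, fun P hr hP => h.2 P hr fun u v hu hv hPu huv => hP u v hu hv hPu (hM u v hu hv huv)⟩

lemma not_connOn_empty : ¬ ConnOn M fun _ => false := by
  simp [ConnOn]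

lemma connOn_singleton [DecidableEq V] : ConnOn M fun v => decide (v = a) := by
  refine ⟨⟨a, by simp⟩, fun P ⟨r, hr, hPr⟩ _ v hv => ?_⟩
  rwa [of_decide_eq_true hv, ← of_decide_eq_true hr]

lemma connOn_of_root (hM : IsSymm M) (ha : X a)
    (h : ∀ P : V → Prop, P a → (∀ u v, X u → X v → P u → M u v → P v) → ∀ v, X v → P v) :
    ConnOn M X := by
  refine ⟨⟨a, ha⟩, fun P ⟨s, hs, hPs⟩ hP => ?_⟩
  have hPa : P a := by
    by_contra hPa
    exact h (fun v => ¬ P v) hPa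
      (fun u v hu hv hPu huv hPv => hPu (hP v u hv hu hPv (hM u v ▸ huv))) s hs hPs
  exact h P hPa hP

lemma not_connOn_of_isolated (ha : X a) (hb : X b) (hab : a ≠ b)
    (h : ∀ u, X u → M b u = false) : ¬ ConnOn M X := fun hc =>
  hab (hc.2 (· = b) ⟨b, hb, rfl⟩ (by rintro _ v - hv rfl huv; simp [h v hv] at huv) a ha)

lemma ConnOn.update_true [DecidableEq V] (hM : IsSymm M) (h : ConnOn M X) (ha : X a)
    (hab : M a b) : ConnOn M (Function.update X b true) := by
  refine connOn_of_root hM (a := b) (by simp) fun P hPb hP => ?_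
  have hPa : P a := hP b a (by simp) (by grind) hPb (hM a b ▸ hab)
  intro v hv
  by_cases hvb : v = b
  · exact hvb ▸ hPb
  · exact h.2 P ⟨a, ha, hPa⟩ (fun u w hu hw => hP u w (by grind) (by grind)) v (by grind)

lemma ConnOn.of_update_true [DecidableEq V] (hM : IsSymm M)
    (h : ConnOn M (Function.update X b true)) (hb : X b = false) (ha : X a)
    (honly : ∀ u, X u → M b u → u = a) : ConnOn M X := by
  refine connOn_of_root hM ha fun P hPa hP v hv => ?_
  have key : v = b ∨ P v := by
    refine h.2 (fun v => v = b ∨ P v) ⟨a, by grind, Or.inr hPa⟩ (fun u w hu hw hPu huw => ?_) v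
      (by grind)
    by_cases hwb : w = b
    · exact Or.inl hwb
    · by_cases hub : u = b
      · exact Or.inr (honly w (by grind) (hub ▸ huw) ▸ hPa)
      · exact Or.inr (hP u w (by grind) (by grind) (hPu.resolve_left hub) huw)
  exact key.resolve_left (by grind)

lemma connOn_update_true_iff_of_pendant [DecidableEq V] (hM : IsSymm M) (hb : X b = false)
    (ha : X a) (hab : M a b) (honly : ∀ u, X u → M b u → u = a) :
    ConnOn M (Function.update X b true) ↔ ConnOn M X :=
  ⟨fun h => h.of_update_true hM hb ha honly, fun h => h.update_true hM ha hab⟩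

lemma connOn_iff_induce_connected {G : SimpleGraph V} {S : Set V}
    (hM : ∀ u v, M u v ↔ G.Adj u v) (hX : ∀ v, X v ↔ v ∈ S) :
    ConnOn M X ↔ (G.induce S).Connected := by
  obtain rfl : {v | X v} = S := Set.ext hX
  constructor
  · intro h
    obtain ⟨r, hr⟩ := h.1
    refine SimpleGraph.connected_iff_exists_forall_reachable _ |>.2 ⟨⟨r, hr⟩, fun ⟨v, hv⟩ => ?_⟩
    refine h.2 (fun v => ∀ hv : X v, (G.induce {v | X v}).Reachable ⟨r, hr⟩ ⟨v, hv⟩)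
      ⟨r, hr, fun _ => .refl _⟩ (fun u v hu _ hPu huv _ => (hPu hu).trans ?_) v hv hv
    exact SimpleGraph.Adj.reachable ((hM u v).1 huv)
  · intro h
    obtain ⟨r₀, hr₀⟩ := h.nonempty.some
    refine ⟨⟨r₀, hr₀⟩, fun P ⟨r, hr, hPr⟩ hP v hv => ?_⟩
    have hrv := (SimpleGraph.reachable_iff_reflTransGen _ _).1 (h.preconnected ⟨r, hr⟩ ⟨v, hv⟩)
    have hspread : ∀ c : {v | X v}, Relation.ReflTransGen (G.induce {v | X v}).Adj ⟨r, hr⟩ c →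
        P c := fun c hc => by
      induction hc with
      | refl => exact hPr
      | @tail b c _ hbc ih => exact hP b c b.2 c.2 ih ((hM b c).2 hbc)
    exact hspread ⟨v, hv⟩ hrv

end Connected

section Reach

variable {n : ℕ} {M : Mat n} {X R : VSet n} {r u v : Fin n}

/-- One round of breadth-first search inside `X`. -/
def grow (M : Mat n) (X R : VSet n) : VSet n :=
  fun v => R v || (X v && decide (∃ u, (R u && M u v) = true))

lemma reach_val : (reach M X r).val = (grow M X)^[n] fun v => decide (v = r) := by
  simp only [reach, bind_val, table_val, op_val, repeatT_val]
  rfl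

lemma isFixedPt_grow_reach : Function.IsFixedPt (grow M X) (reach M X r).val := by
  rw [reach_val]
  refine isFixedPt_iterate_of_lt (μ := fun R => (Finset.univ.filter fun v => R v = false).card)
    (fun R hR => ?_) ((Finset.card_le_univ _).trans (by simp))
  obtain ⟨v, hv⟩ := Function.ne_iff.1 hR
  refine Finset.card_lt_card (Finset.ssubset_iff_of_subset (fun u => ?_) |>.2 ⟨v, ?_, ?_⟩) <;>
    simp only [Finset.mem_filter, Finset.mem_univ, true_and, grow] at * <;> grind

lemma reach_root : (reach M X r).val r := by
  rw [reach_val]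
  exact Function.Iterate.rec (fun R : VSet n => R r) (by simp)
    (fun R hR => by simp [grow, hR]) n

lemma reach_step (hu : (reach M X r).val u) (hv : X v) (huv : M u v) : (reach M X r).val v := by
  rw [← isFixedPt_grow_reach.eq]
  simp only [grow, hv, Bool.true_and, Bool.or_eq_true, decide_eq_true_eq]
  exact Or.inr ⟨u, by simp [hu, huv]⟩

lemma reach_induction {P : Fin n → Prop} (hr : P r) (hP : ∀ u v, P u → X v → M u v → P v)
    (hv : (reach M X r).val v) : P v := by
  rw [reach_val] at hv
  refine Function.Iterate.rec (fun R : VSet n => ∀ v, R v → P v) (by simpa using hr)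
    (fun R hR v hv => ?_) n v hv
  simp only [grow, Bool.or_eq_true, Bool.and_eq_true, decide_eq_true_eq] at hv
  rcases hv with hv | ⟨hXv, u, hu, huv⟩
  · exact hR v hv
  · exact hP u v (hR u hu) hXv huv

lemma connOn_iff_forall_reach (hM : IsSymm M) (hr : X r) :
    ConnOn M X ↔ ∀ v, X v → (reach M X r).val v := by
  constructor
  · intro h
    exact h.2 (fun v => (reach M X r).val v) ⟨r, hr, reach_root⟩
      fun u v _ hv hu huv => reach_step hu hv huv
  · intro h
    refine connOn_of_root hM hr fun P hPr hP v hv => ?_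
    exact (reach_induction (P := fun v => X v ∧ P v) ⟨hr, hPr⟩
      (fun u v hu hv huv => ⟨hv, hP u v hu.1 hv hu.2 huv⟩) (h v hv)).2

lemma isConn_val (hM : IsSymm M) (X : VSet n) : (isConn M X).val ↔ ConnOn M X := by
  simp only [isConn, bind_val]
  rcases hfirst : (firstT fun v => op (if X v then some v else none)).val with _ | r
  · have hempty : X = fun _ => false := by
      funext v
      simpa using firstT_val_eq_none.1 hfirst v
    simp [hempty, not_connOn_empty]
  · obtain ⟨i, hi⟩ := exists_of_firstT_val_eq_some hfirst
    have hr : X r := by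
      simp only [op_val, Option.ite_none_right_eq_some, Option.some.injEq] at hi
      exact hi.2 ▸ hi.1
    simp only [connOn_iff_forall_reach hM hr, bind_val, allT_val, op_val, decide_eq_true_eq,
      Bool.or_eq_true, Bool.not_eq_true', ← Bool.not_eq_true, imp_iff_not_or]

end Reach

/-! ### Degrees and cuts -/

section Counting

variable {V : Type*} [Fintype V] {M O : V → V → Bool} {X Y : V → Bool}

/-- The degree of `v`: the number of entries of row `v`. -/
def deg (M : V → V → Bool) (v : V) : ℕ := (Finset.univ.filter fun u => M v u).card

/-- The number of elements of `X`. -/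
def vcard (X : V → Bool) : ℕ := (Finset.univ.filter fun v => X v).card

/-- The size of the cut of `X` in the graph `O`: the number of entries of `O` from `X` to its
complement. -/
def cutCard (O : V → V → Bool) (X : V → Bool) : ℕ :=
  ∑ u, ∑ v, if X u && !X v && O u v then 1 else 0

lemma cutCard_congr (h : ∀ u v, O u v → X u = Y u ∧ X v = Y v) : cutCard O X = cutCard O Y :=
  Finset.sum_congr rfl fun u _ => Finset.sum_congr rfl fun v _ => by
    have := h u v
    grind

lemma vcard_pos_iff : 0 < vcard X ↔ ∃ v, X v := by
  simp [vcard, Finset.card_pos, Finset.Nonempty]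

lemma deg_eq_zero_iff {v : V} : deg M v = 0 ↔ ∀ u, M v u = false := by
  simp [deg, Finset.filter_eq_empty_iff]

lemma vcard_erase_add_one [DecidableEq V] {z : V} (hz : X z) :
    vcard (fun v => X v && decide (v ≠ z)) + 1 = vcard X := by
  have herase : (Finset.univ.filter fun v => (X v && decide (v ≠ z)) = true) =
      (Finset.univ.filter fun v => X v).erase z := by
    ext v
    simp [and_comm]
  rw [vcard, herase, Finset.card_erase_add_one (by simpa using hz), vcard]

end Counting

section ChooseBest

variable {n : ℕ} {g : BGraph n} {X : VSet n} {Xs : List (VSet n)}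

@[simp] lemma degree_val (M : Mat n) (v : Fin n) : (degree M v).val = deg M v := by
  simp [degree, deg]

@[simp] lemma cutOnes_val (g : BGraph n) (X : VSet n) :
    (cutOnes g X).val = cutCard g.one X := by
  simp [cutOnes, cutCard]

@[simp] lemma emptySet_val : (emptySet : Timed (VSet n)).val = fun _ => false := rfl

/-- The score by which `chooseBest` compares: the size of the cut of a connected set, and `⊥` for
any other set. -/
def connCut (g : BGraph n) (X : VSet n) : WithBot ℕ :=
  if (isConn g.adj X).val then (cutCard g.one X : WithBot ℕ) else ⊥

lemma connCut_of_connOn (hg : IsSymm g.adj) (hX : ConnOn g.adj X) :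
    connCut g X = cutCard g.one X :=
  if_pos ((isConn_val hg X).2 hX)

lemma bot_lt_connCut_iff (hg : IsSymm g.adj) : ⊥ < connCut g X ↔ ConnOn g.adj X := by
  rw [← isConn_val hg, connCut]
  split_ifs with h <;> simp [h]

lemma chooseBest_val :
    (chooseBest g Xs).val = argmaxFrom (connCut g) (fun _ => false) Xs := by
  simp only [chooseBest, bind_val, foldT_val, op_val, cutOnes_val, emptySet_val, argmaxFrom]
  congr 1
  funext B X
  refine if_congr ?_ rfl rfl
  unfold connCut
  cases (isConn g.adj X).val <;> cases (isConn g.adj B).val <;> simp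

lemma chooseBest_spec (hg : IsSymm g.adj) (hXs : ∃ X ∈ Xs, ConnOn g.adj X) :
    (chooseBest g Xs).val ∈ Xs ∧ ConnOn g.adj (chooseBest g Xs).val ∧
      ∀ X ∈ Xs, ConnOn g.adj X → cutCard g.one X ≤ cutCard g.one (chooseBest g Xs).val := by
  rw [chooseBest_val]
  set B := argmaxFrom (connCut g) (fun _ => false) Xs
  have hmax : ∀ X ∈ Xs, connCut g X ≤ connCut g B := fun X hX =>
    le_argmaxFrom _ (List.mem_cons_of_mem _ hX)
  obtain ⟨X₀, hX₀, hconn⟩ := hXs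
  have hB : ConnOn g.adj B :=
    (bot_lt_connCut_iff hg).1 (((bot_lt_connCut_iff hg).2 hconn).trans_le (hmax X₀ hX₀))
  refine ⟨(List.mem_cons.1 (argmaxFrom_mem (connCut g) _ Xs)).resolve_left fun h => ?_, hB,
    fun X hX hXc => ?_⟩
  · have hB₀ : B = fun _ => false := h
    exact not_connOn_empty (hB₀ ▸ hB)
  · simpa [connCut_of_connOn hg, hXc, hB] using hmax X hX

end ChooseBest

/-! ### Removing vertices without `1`-edges -/

section Eliminate

variable {n : ℕ} {g : BGraph n} {z : Fin n} {S : VSet n}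

/-- The invariant of the `{0,1}`-algorithm: `g` represents a connected simple graph on the nonempty
vertex set `g.vert`, and its `1`-edges are edges. -/
structure WellFormed (g : BGraph n) : Prop where
  symm : IsSymm g.adj
  irrefl : ∀ v, g.adj v v = false
  mem : ∀ u v, g.adj u v → g.vert u
  one_adj : ∀ u v, g.one u v → g.adj u v
  one_symm : IsSymm g.one
  conn : ConnOn g.adj g.vert

lemma WellFormed.ne (hg : WellFormed g) {u v : Fin n} (h : g.adj u v) : u ≠ v := by
  rintro rfl
  simp [hg.irrefl] at h

lemma WellFormed.one_irrefl (hg : WellFormed g) (v : Fin n) : g.one v v = false :=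
  Bool.eq_false_of_not_eq_true fun h => hg.ne (hg.one_adj v v h) rfl

/-- The graph computed by `eliminate`. -/
def eliminated (g : BGraph n) (z : Fin n) : BGraph n where
  vert := fun v => g.vert v && decide (v ≠ z)
  adj := fun u v => decide (u ≠ z) && decide (v ≠ z) && decide (u ≠ v) &&
    (g.adj u v || (g.adj u z && g.adj z v))
  one := fun u v => g.one u v && decide (u ≠ z) && decide (v ≠ z)

lemma eliminated_adj_iff {u v : Fin n} : (eliminated g z).adj u v ↔
    ((u ≠ z ∧ v ≠ z) ∧ u ≠ v) ∧ (g.adj u v ∨ g.adj u z ∧ g.adj z v) := by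
  simp [eliminated]

/- A walk through `z` is shortcut by the new edge between the neighbours of `z` on it; accordingly a
property that spreads in the new graph is extended to `z` as "some neighbour of `z` has it". -/
lemma connOn_eliminated (hg : WellFormed g) (h : ConnOn g.adj S) (hne : ∃ v, S v ∧ v ≠ z) :
    ConnOn (eliminated g z).adj fun v => S v && decide (v ≠ z) := by
  refine ⟨by simpa using hne, fun P ⟨r, hr, hPr⟩ hP v hv => ?_⟩
  have key := h.2 (fun v => (v ≠ z → P v) ∧ (v = z → ∃ u, (S u ∧ u ≠ z) ∧ P u ∧ g.adj u z))
    ⟨r, by grind, by grind⟩ (fun u w hu hw hPu huw => ⟨fun hwz => ?_, ?_⟩) v (by grind)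
  · exact key.1 (by grind)
  · by_cases huz : u = z
    · obtain ⟨y, hy, hPy, hyz⟩ := hPu.2 huz
      by_cases hyw : y = w
      · exact hyw ▸ hPy
      · exact hP y w (by grind) (by grind) hPy (eliminated_adj_iff.2 (by grind))
    · have huw' : u ≠ w := hg.ne huw
      exact hP u w (by grind) (by grind) (hPu.1 huz) (eliminated_adj_iff.2 (by grind))
  · rintro rfl
    have huw' := hg.ne huw
    exact ⟨u, ⟨hu, huw'⟩, hPu.1 huw', huw⟩

lemma connOn_insert_of_eliminated (hg : WellFormed g) (h : ConnOn (eliminated g z).adj S)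
    (hS : ¬ ConnOn g.adj S) : ConnOn g.adj fun u => S u || decide (u = z) := by
  by_cases hex : ∃ u, S u ∧ g.adj u z
  · obtain ⟨a, ha, haz⟩ := hex
    refine connOn_of_root hg.symm (a := z) (by simp) fun P hPz hP => ?_
    have hPa : P a := hP z a (by simp) (by simp [ha]) hPz (hg.symm a z ▸ haz)
    have key := h.2 P ⟨a, ha, hPa⟩ fun u w hu hw hPu huw => by
      rcases (eliminated_adj_iff.1 huw).2 with huw | ⟨-, hzw⟩
      · exact hP u w (by simp [hu]) (by simp [hw]) hPu huw
      · exact hP z w (by simp) (by simp [hw]) hPz hzw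
    intro v hv
    by_cases hvz : v = z
    · exact hvz ▸ hPz
    · exact key v (by simpa [hvz] using hv)
  · refine absurd (h.mono fun u v hu _ huv => ?_) hS
    exact (eliminated_adj_iff.1 huv).2.resolve_right fun huz => hex ⟨u, hu, huz.1⟩

lemma wellFormed_eliminated (hg : WellFormed g) (hne : ∃ v, g.vert v ∧ v ≠ z) :
    WellFormed (eliminated g z) where
  symm u v := by
    rw [Bool.eq_iff_iff, eliminated_adj_iff, eliminated_adj_iff]
    grind [hg.symm u v, hg.symm u z, hg.symm v z]
  irrefl v := by simp [eliminated]
  mem u v h := by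
    have h := eliminated_adj_iff.1 h
    simp only [eliminated, Bool.and_eq_true, decide_eq_true_eq]
    exact ⟨h.2.elim (hg.mem u v) fun h' => hg.mem u z h'.1, h.1.1.1⟩
  one_adj u v h := by
    simp only [eliminated, Bool.and_eq_true, decide_eq_true_eq] at h
    have huv := hg.one_adj u v h.1.1
    exact eliminated_adj_iff.2 ⟨⟨⟨h.1.2, h.2⟩, hg.ne huv⟩, Or.inl huv⟩
  one_symm u v := by
    simp only [eliminated, hg.one_symm u v, Bool.and_right_comm]
  conn := connOn_eliminated hg hg.conn hne

lemma WellFormed.ne_of_one (hg : WellFormed g) (hz : deg g.one z = 0) {u v : Fin n}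
    (huv : g.one u v) : u ≠ z ∧ v ≠ z := by
  have hz := deg_eq_zero_iff.1 hz
  refine ⟨?_, ?_⟩
  · rintro rfl
    simp [hz] at huv
  · rintro rfl
    simp [hg.one_symm u v, hz] at huv

lemma eliminated_one (hg : WellFormed g) (hz : deg g.one z = 0) :
    (eliminated g z).one = g.one := by
  funext u v
  rw [Bool.eq_iff_iff]
  simp only [eliminated, Bool.and_eq_true, decide_eq_true_eq, and_assoc, and_iff_left_iff_imp]
  exact hg.ne_of_one hz

end Eliminate

/-! ### Connected sets near a path with inner vertices of degree two -/

section InnerPath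

variable {V : Type*} {M M' : V → V → Bool} {X Y : V → Bool} {a b c : V}
  {v₀ v₁ v₂ v₃ : V} {x₁ x₂ x₁' x₂' : Bool}

/-- A path `v₀ v₁ v₂ v₃` in the graph `M` whose inner vertices `v₁` and `v₂` have no further
neighbours. -/
structure IsInnerPath (M : V → V → Bool) (v₀ v₁ v₂ v₃ : V) : Prop where
  adj₁ : ∀ u, M v₁ u ↔ u = v₀ ∨ u = v₂
  adj₂ : ∀ u, M v₂ u ↔ u = v₁ ∨ u = v₃
  ne₀₁ : v₀ ≠ v₁
  ne₀₂ : v₀ ≠ v₂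
  ne₁₂ : v₁ ≠ v₂
  ne₁₃ : v₁ ≠ v₃
  ne₂₃ : v₂ ≠ v₃

lemma IsInnerPath.reverse (h : IsInnerPath M v₀ v₁ v₂ v₃) : IsInnerPath M v₃ v₂ v₁ v₀ :=
  ⟨fun u => (h.adj₂ u).trans or_comm, fun u => (h.adj₁ u).trans or_comm, h.ne₂₃.symm, h.ne₁₃.symm,
    h.ne₁₂.symm, h.ne₀₂.symm, h.ne₀₁.symm⟩

variable [DecidableEq V]

lemma connOn_subdivide_iff (hM : IsSymm M) (hc : ∀ u, M c u ↔ u = a ∨ u = b)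
    (hM' : ∀ u v, M' u v ↔ M u v ∧ u ≠ c ∧ v ≠ c ∨ u = a ∧ v = b ∨ u = b ∧ v = a)
    (hX : X c = false) :
    ConnOn M (Function.update X c (X a && X b)) ↔ ConnOn M' X := by
  have hc' : ∀ u, M u c ↔ u = a ∨ u = b := fun u => hM u c ▸ hc u
  constructor
  · intro h
    obtain ⟨r, hr⟩ : ∃ r, X r := by
      obtain ⟨r, hr⟩ := h.1
      by_cases hrc : r = c
      · exact ⟨a, by grind⟩
      · exact ⟨r, by grind⟩
    refine ⟨⟨r, hr⟩, fun P ⟨s, hs, hPs⟩ hP v hv => ?_⟩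
    -- the subdividing vertex inherits `P` from `a`
    have key := h.2 (fun v => (v ≠ c → P v) ∧ (v = c → P a)) ⟨s, by grind, by grind⟩
      (fun u w hu hw hPu huw => ⟨fun hwc => ?_, fun hwc => ?_⟩) v (by grind)
    · exact key.1 (by grind)
    · by_cases huc : u = c
      · rcases (hc w).1 (huc ▸ huw) with rfl | rfl
        · exact hPu.2 huc
        · exact hP a w (by grind) (by grind) (hPu.2 huc) ((hM' _ _).2 (by simp))
      · exact hP u w (by grind) (by grind) (hPu.1 huc) ((hM' _ _).2 (Or.inl ⟨huw, huc, hwc⟩))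
    · rcases (hc' u).1 (hwc ▸ huw) with rfl | rfl
      · exact hPu.1 (by grind)
      · exact hP u a (by grind) (by grind) (hPu.1 (by grind)) ((hM' _ _).2 (by simp))
  · intro h
    obtain ⟨r, hr⟩ := h.1
    refine connOn_of_root hM (a := r) (by grind) fun P hPr hP => ?_
    have key := h.2 P ⟨r, hr, hPr⟩ fun u w hu hw hPu huw => by
      rcases (hM' u w).1 huw with ⟨huw, -, -⟩ | ⟨rfl, rfl⟩ | ⟨rfl, rfl⟩
      · exact hP u w (by grind) (by grind) hPu huw
      all_goals
        have hPc := hP _ c (by grind) (by grind) hPu ((hc' _).2 (by simp))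
        exact hP c _ (by grind) (by grind) hPc ((hc _).2 (by simp))
    intro v hv
    by_cases hvc : v = c
    · exact hP a v (by grind) hv (key a (by grind)) (hvc ▸ (hc' a).2 (Or.inl rfl))
    · exact key v (by grind)

/-- The set that agrees with `Y` outside of `{v₁, v₂}`, and has the prescribed values there. -/
def pat (Y : V → Bool) (v₁ v₂ : V) (x₁ x₂ : Bool) : V → Bool :=
  Function.update (Function.update Y v₁ x₁) v₂ x₂

lemma pat_apply (v : V) :
    pat Y v₁ v₂ x₁ x₂ v = if v = v₂ then x₂ else if v = v₁ then x₁ else Y v := by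
  simp only [pat, Function.update_apply]

lemma pat_comm (h : v₁ ≠ v₂) : pat Y v₁ v₂ x₁ x₂ = pat Y v₂ v₁ x₂ x₁ :=
  (Function.update_comm h.symm _ _ _).symm

namespace IsInnerPath

lemma connOn_pat_left_pendant (h : IsInnerPath M v₀ v₁ v₂ v₃) (hM : IsSymm M) (hY : Y v₀) :
    ConnOn M (pat Y v₁ v₂ true false) ↔ ConnOn M (pat Y v₁ v₂ false false) := by
  have hne := h.ne₁₂
  have hpat : pat Y v₁ v₂ true false = Function.update (pat Y v₁ v₂ false false) v₁ true := by
    unfold pat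
    grind
  rw [hpat]
  refine connOn_update_true_iff_of_pendant hM (a := v₀) ?_ ?_ (hM v₀ v₁ ▸ (h.adj₁ v₀).2 (by simp))
    fun u hu huv => ((h.adj₁ u).1 huv).resolve_right ?_
  all_goals grind [pat_apply, h.ne₀₁, h.ne₀₂]

lemma connOn_pat_inner_pendant (h : IsInnerPath M v₀ v₁ v₂ v₃) (hM : IsSymm M)
    (hY : Y v₃ = false) :
    ConnOn M (pat Y v₁ v₂ true true) ↔ ConnOn M (pat Y v₁ v₂ true false) := by
  have hne := h.ne₁₂
  have hpat : pat Y v₁ v₂ true true = Function.update (pat Y v₁ v₂ true false) v₂ true := by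
    unfold pat
    grind
  rw [hpat]
  refine connOn_update_true_iff_of_pendant hM (a := v₁) ?_ ?_ ((h.adj₁ v₂).2 (by simp))
    fun u hu huv => ((h.adj₂ u).1 huv).resolve_right ?_
  all_goals grind [pat_apply, h.ne₁₃, h.ne₂₃]

lemma not_connOn_pat_of_gap (h : IsInnerPath M v₀ v₁ v₂ v₃) (hY₀ : Y v₀) (hY₃ : Y v₃ = false) :
    ¬ ConnOn M (pat Y v₁ v₂ false true) := by
  refine not_connOn_of_isolated (a := v₀) (b := v₂) ?_ ?_ h.ne₀₂ fun u hu => ?_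
  all_goals grind [pat_apply, h.ne₀₁, h.ne₀₂, h.ne₁₂, h.ne₁₃, h.ne₂₃, h.adj₂]

end IsInnerPath

/-- The ways in which a set `X` can meet the inner part of a path `v₀ v₁ v₂ v₃`: it contains the
whole path; it contains an inner vertex but neither end; it contains an end and an inner vertex
that is cut off from it; or its inner vertices are irrelevant to whether it is connected. -/
inductive InnerType
  | bridge
  | island
  | broken
  | neutral
  deriving DecidableEq

/-- The inner type of a set from its values at `v₀`, `v₁`, `v₂`, `v₃`. -/
def innerType : Bool → Bool → Bool → Bool → InnerType
  | true, true, true, true => .bridge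
  | true, _, _, true => .neutral
  | true, false, true, false => .broken
  | false, true, false, true => .broken
  | false, false, false, false => .neutral
  | false, _, _, false => .island
  | _, _, _, _ => .neutral

lemma IsInnerPath.connOn_pat_congr (h : IsInnerPath M v₀ v₁ v₂ v₃) (hM : IsSymm M)
    (hx : innerType (Y v₀) x₁ x₂ (Y v₃) = innerType (Y v₀) x₁' x₂' (Y v₃)) :
    ConnOn M (pat Y v₁ v₂ x₁ x₂) ↔ ConnOn M (pat Y v₁ v₂ x₁' x₂') := by
  have hleft := h.connOn_pat_left_pendant hM (Y := Y)
  have hright := h.reverse.connOn_pat_left_pendant hM (Y := Y)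
  have hinner₂ := h.connOn_pat_inner_pendant hM (Y := Y)
  have hinner₁ := h.reverse.connOn_pat_inner_pendant hM (Y := Y)
  simp only [← pat_comm h.ne₁₂] at hright hinner₁
  cases hY₀ : Y v₀ <;> cases hY₃ : Y v₃ <;> rw [hY₀, hY₃] at hx <;> cases x₁ <;> cases x₂ <;>
    cases x₁' <;> cases x₂' <;> first | (cases hx; done) | simp_all

lemma IsInnerPath.innerType_ne_broken (h : IsInnerPath M v₀ v₁ v₂ v₃)
    (hc : ConnOn M (pat Y v₁ v₂ x₁ x₂)) : innerType (Y v₀) x₁ x₂ (Y v₃) ≠ .broken := by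
  have hleft := h.not_connOn_pat_of_gap (Y := Y)
  have hright := h.reverse.not_connOn_pat_of_gap (Y := Y)
  simp only [← pat_comm h.ne₁₂] at hright
  cases hY₀ : Y v₀ <;> cases hY₃ : Y v₃ <;> cases x₁ <;> cases x₂ <;>
    first | (intro hx; cases hx; done) | simp_all
end InnerPath

/-! ### Shrinking thin paths -/

section Shrink

variable {n : ℕ} {g : BGraph n} {p : Quad n} {O M : Mat n} {a b u v : Fin n} {X Y : VSet n}

/-- The path `v₀ v₁ v₂ v₃` has four distinct vertices, and its last three vertices have degree
two. -/
structure Thin (g : BGraph n) (p : Quad n) : Prop where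
  adj₀₁ : g.adj p.v₀ p.v₁
  adj₁₂ : g.adj p.v₁ p.v₂
  adj₂₃ : g.adj p.v₂ p.v₃
  ne₀₂ : p.v₀ ≠ p.v₂
  ne₁₃ : p.v₁ ≠ p.v₃
  ne₀₃ : p.v₀ ≠ p.v₃
  deg₁ : deg g.adj p.v₁ = 2
  deg₂ : deg g.adj p.v₂ = 2
  deg₃ : deg g.adj p.v₃ = 2

lemma not_thin_of_findThinPath_eq_none (h : (findThinPath g).val = none) : ¬ Thin g p := by
  intro hp
  simp only [findThinPath, bind_val, table_val, degree_val, firstT_val_eq_none, op_val] at h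
  have := h p.v₀ p.v₁ p.v₂ p.v₃
  simp [hp.adj₀₁, hp.adj₁₂, hp.adj₂₃, hp.ne₀₂, hp.ne₁₃, hp.ne₀₃, hp.deg₁, hp.deg₂, hp.deg₃] at this

lemma thin_of_findThinPath_eq_some (h : (findThinPath g).val = some p) : Thin g p := by
  simp only [findThinPath, bind_val, table_val, degree_val] at h
  obtain ⟨a, h⟩ := exists_of_firstT_val_eq_some h
  obtain ⟨b, h⟩ := exists_of_firstT_val_eq_some h
  obtain ⟨c, h⟩ := exists_of_firstT_val_eq_some h
  obtain ⟨e, h⟩ := exists_of_firstT_val_eq_some h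
  simp only [op_val, Option.ite_none_right_eq_some, Bool.and_eq_true, decide_eq_true_eq,
    Option.some.injEq] at h
  obtain ⟨⟨⟨⟨⟨⟨⟨⟨⟨h₀₁, h₁₂⟩, h₂₃⟩, hac⟩, hbe⟩, hae⟩, hb⟩, hc⟩, he⟩, rfl⟩ := h
  exact ⟨h₀₁, h₁₂, h₂₃, hac, hbe, hae, hb, hc, he⟩

lemma adj_iff_of_deg_eq_two (hv : deg M v = 2) (ha : M v a) (hb : M v b) (hab : a ≠ b) :
    M v u ↔ u = a ∨ u = b := by
  have hpair : ({a, b} : Finset (Fin n)) = Finset.univ.filter fun u => M v u := by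
    refine Finset.eq_of_subset_of_card_le (by simp [Finset.insert_subset_iff, ha, hb]) ?_
    rw [Finset.card_pair hab]
    exact hv.le
  simpa using (Finset.ext_iff.1 hpair u).symm

lemma Thin.isInnerPath (hg : WellFormed g) (hp : Thin g p) :
    IsInnerPath g.adj p.v₀ p.v₁ p.v₂ p.v₃ :=
  ⟨fun _ => adj_iff_of_deg_eq_two hp.deg₁ (hg.symm _ _ ▸ hp.adj₀₁) hp.adj₁₂ hp.ne₀₂,
    fun _ => adj_iff_of_deg_eq_two hp.deg₂ (hg.symm _ _ ▸ hp.adj₁₂) hp.adj₂₃ hp.ne₁₃,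
    hg.ne hp.adj₀₁, hp.ne₀₂, hg.ne hp.adj₁₂, hp.ne₁₃, hg.ne hp.adj₂₃⟩

/-- The number of `1`-edges of the path `v₀ v₁ v₂ v₃`. -/
def pathOnes (g : BGraph n) (p : Quad n) : ℕ :=
  (if g.one p.v₀ p.v₁ then 1 else 0) + (if g.one p.v₁ p.v₂ then 1 else 0) +
    (if g.one p.v₂ p.v₃ then 1 else 0)

/-- The graph computed by `shrink`. -/
def shrunk (g : BGraph n) (p : Quad n) : BGraph n where
  vert := fun v => g.vert v && decide (v ≠ p.v₂)
  adj := fun u v => (g.adj u v && decide (u ≠ p.v₂) && decide (v ≠ p.v₂)) ||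
    samePair u v p.v₁ p.v₃
  one := fun u v => if samePair u v p.v₀ p.v₁ then decide (2 ≤ pathOnes g p)
    else if samePair u v p.v₁ p.v₃ then decide (1 ≤ pathOnes g p)
    else g.one u v && decide (u ≠ p.v₂) && decide (v ≠ p.v₂)

lemma samePair_iff : samePair u v a b ↔ u = a ∧ v = b ∨ u = b ∧ v = a := by
  simp [samePair]

lemma samePair_comm (u v a b : Fin n) : samePair u v a b = samePair v u a b := by
  rw [Bool.eq_iff_iff, samePair_iff, samePair_iff]
  tauto

lemma shrunk_adj_iff : (shrunk g p).adj u v ↔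
    g.adj u v ∧ u ≠ p.v₂ ∧ v ≠ p.v₂ ∨ u = p.v₁ ∧ v = p.v₃ ∨ u = p.v₃ ∧ v = p.v₁ := by
  simp [shrunk, samePair, and_assoc]

lemma isSymm_shrunk_adj (hg : WellFormed g) : IsSymm (shrunk g p).adj := by
  intro u v
  rw [Bool.eq_iff_iff, shrunk_adj_iff, shrunk_adj_iff, hg.symm u v]
  tauto

lemma isSymm_shrunk_one (hg : WellFormed g) : IsSymm (shrunk g p).one := by
  intro u v
  simp only [shrunk]
  rw [samePair_comm u v, samePair_comm u v, hg.one_symm u v, Bool.and_right_comm]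

lemma connOn_shrunk_pat_iff (hg : WellFormed g) (hp : Thin g p) {y : Bool} :
    ConnOn (shrunk g p).adj (pat Y p.v₁ p.v₂ y false) ↔
      ConnOn g.adj (pat Y p.v₁ p.v₂ y (y && Y p.v₃)) := by
  have h := hp.isInnerPath hg
  rw [← connOn_subdivide_iff hg.symm h.adj₂ (fun _ _ => shrunk_adj_iff)
    (by simp [pat_apply])]
  refine iff_of_eq (congrArg _ (funext fun v => ?_))
  grind [pat_apply, Function.update_apply, h.ne₁₂, h.ne₁₃, h.ne₂₃]

/-! ### Cuts and thin paths -/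

/-- The contribution of an edge of weight `o` to a cut that separates its ends if `x ≠ y`. -/
def edgeCut (o x y : Bool) : ℕ := (o && (x != y)).toNat

/-- Delete the edge `ab`. -/
def eraseEdge (O : Mat n) (a b : Fin n) : Mat n := fun u v => O u v && !samePair u v a b

lemma eraseEdge_iff : eraseEdge O a b u v ↔ O u v ∧ ¬ (u = a ∧ v = b ∨ u = b ∧ v = a) := by
  rw [← samePair_iff]
  simp [eraseEdge]

lemma IsSymm.eraseEdge (hO : IsSymm O) (a b : Fin n) : IsSymm (eraseEdge O a b) := by
  intro u v
  simp only [CMC.eraseEdge]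
  rw [hO, samePair_comm]

lemma cutCard_eraseEdge (hO : IsSymm O) (hab : a ≠ b) (X : VSet n) :
    cutCard O X = cutCard (eraseEdge O a b) X + edgeCut (O a b) (X a) (X b) := by
  have hterm : ∀ u v, (if X u && !X v && O u v then 1 else 0) =
      (if X u && !X v && eraseEdge O a b u v then 1 else 0) +
        ((if v = b then if u = a then (X a && !X b && O a b).toNat else 0 else 0) +
          if v = a then if u = b then (X b && !X a && O a b).toNat else 0 else 0) := by
    intro u v
    have hsymm := hO a b
    have herase := eraseEdge_iff (O := O) (a := a) (b := b) (u := u) (v := v)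
    grind [Bool.toNat]
  have hsum : edgeCut (O a b) (X a) (X b) =
      (X a && !X b && O a b).toNat + (X b && !X a && O a b).toNat := by
    cases X a <;> cases X b <;> cases O a b <;> rfl
  simp only [cutCard, hterm, Finset.sum_add_distrib, Finset.sum_ite_eq', Finset.mem_univ, if_true,
    hsum]

/-- The `1`-edges that avoid `v₁` and `v₂`. -/
def offPath (g : BGraph n) (p : Quad n) : Mat n := fun u v =>
  g.one u v && decide (u ≠ p.v₁) && decide (u ≠ p.v₂) && decide (v ≠ p.v₁) && decide (v ≠ p.v₂)

lemma cutCard_offPath_pat (x₁ x₂ : Bool) :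
    cutCard (offPath g p) (pat Y p.v₁ p.v₂ x₁ x₂) = cutCard (offPath g p) Y := by
  refine cutCard_congr fun u v h => ?_
  simp only [offPath, Bool.and_eq_true, decide_eq_true_eq] at h
  simp [pat_apply, h]

/-- The cut edges of a path with edge weights `o₁, o₂, o₃`, when the cut takes the values
`a, x₁, x₂, b` at its vertices. -/
def pathCut (o₁ o₂ o₃ a x₁ x₂ b : Bool) : ℕ :=
  edgeCut o₁ a x₁ + edgeCut o₂ x₁ x₂ + edgeCut o₃ x₂ b

/-- The cut edges of the path by which `shrink` replaces a path with edge weights `o₁, o₂, o₃`. -/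
def shrunkCut (o₁ o₂ o₃ a y b : Bool) : ℕ :=
  edgeCut (decide (2 ≤ o₁.toNat + o₂.toNat + o₃.toNat)) a y +
    edgeCut (decide (1 ≤ o₁.toNat + o₂.toNat + o₃.toNat)) y b

lemma eraseEdge_one_eq_offPath (hg : WellFormed g) (hp : Thin g p) :
    eraseEdge (eraseEdge (eraseEdge g.one p.v₀ p.v₁) p.v₁ p.v₂) p.v₂ p.v₃ = offPath g p := by
  have h := hp.isInnerPath hg
  have hadj₁ : ∀ u, g.one p.v₁ u → u = p.v₀ ∨ u = p.v₂ := fun u hu =>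
    (h.adj₁ u).1 (hg.one_adj _ _ hu)
  have hadj₂ : ∀ u, g.one p.v₂ u → u = p.v₁ ∨ u = p.v₃ := fun u hu =>
    (h.adj₂ u).1 (hg.one_adj _ _ hu)
  funext u v
  have hsymm := hg.one_symm u v
  rw [Bool.eq_iff_iff]
  simp only [eraseEdge_iff, offPath, Bool.and_eq_true, decide_eq_true_eq]
  grind [h.ne₀₁, h.ne₀₂, h.ne₁₂, h.ne₁₃, h.ne₂₃]

lemma eraseEdge_shrunk_one_eq_offPath (hg : WellFormed g) (hp : Thin g p) :
    eraseEdge (eraseEdge (shrunk g p).one p.v₀ p.v₁) p.v₁ p.v₃ = offPath g p := by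
  have h := hp.isInnerPath hg
  have hadj₁ : ∀ u, g.one p.v₁ u → u = p.v₀ ∨ u = p.v₂ := fun u hu =>
    (h.adj₁ u).1 (hg.one_adj _ _ hu)
  funext u v
  have hsymm := hg.one_symm u v
  rw [Bool.eq_iff_iff]
  simp only [eraseEdge_iff, offPath, shrunk, samePair_iff]
  grind [h.ne₀₁, h.ne₀₂, h.ne₁₂, h.ne₁₃, h.ne₂₃]

lemma cutCard_pat (hg : WellFormed g) (hp : Thin g p) (x₁ x₂ : Bool) :
    cutCard g.one (pat Y p.v₁ p.v₂ x₁ x₂) = cutCard (offPath g p) Y +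
      pathCut (g.one p.v₀ p.v₁) (g.one p.v₁ p.v₂) (g.one p.v₂ p.v₃) (Y p.v₀) x₁ x₂ (Y p.v₃) := by
  have h := hp.isInnerPath hg
  have hone₁₂ : eraseEdge g.one p.v₀ p.v₁ p.v₁ p.v₂ = g.one p.v₁ p.v₂ := by
    rw [Bool.eq_iff_iff, eraseEdge_iff]
    grind [h.ne₀₂, h.ne₁₂]
  have hone₂₃ : eraseEdge (eraseEdge g.one p.v₀ p.v₁) p.v₁ p.v₂ p.v₂ p.v₃ = g.one p.v₂ p.v₃ := by
    rw [Bool.eq_iff_iff, eraseEdge_iff, eraseEdge_iff]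
    grind [h.ne₀₂, h.ne₁₂, h.ne₁₃]
  rw [cutCard_eraseEdge hg.one_symm h.ne₀₁, cutCard_eraseEdge (hg.one_symm.eraseEdge _ _) h.ne₁₂,
    cutCard_eraseEdge ((hg.one_symm.eraseEdge _ _).eraseEdge _ _) h.ne₂₃,
    eraseEdge_one_eq_offPath hg hp, hone₁₂, hone₂₃, cutCard_offPath_pat]
  simp only [pathCut, pat_apply, h.ne₀₁, h.ne₀₂, h.ne₁₂, h.ne₁₃.symm, h.ne₂₃.symm, if_true,
    if_false]
  ring

lemma pathOnes_eq : pathOnes g p =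
    (g.one p.v₀ p.v₁).toNat + (g.one p.v₁ p.v₂).toNat + (g.one p.v₂ p.v₃).toNat := by
  simp [pathOnes, Bool.toNat, Bool.cond_eq_ite]

lemma cutCard_shrunk_pat (hg : WellFormed g) (hp : Thin g p) (y : Bool) :
    cutCard (shrunk g p).one (pat Y p.v₁ p.v₂ y false) = cutCard (offPath g p) Y +
      shrunkCut (g.one p.v₀ p.v₁) (g.one p.v₁ p.v₂) (g.one p.v₂ p.v₃) (Y p.v₀) y (Y p.v₃) := by
  have h := hp.isInnerPath hg
  have hsymm := isSymm_shrunk_one (p := p) hg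
  have hone₀₁ : (shrunk g p).one p.v₀ p.v₁ = decide (2 ≤ pathOnes g p) := by
    simp [shrunk, samePair]
  have hone₁₃ : eraseEdge (shrunk g p).one p.v₀ p.v₁ p.v₁ p.v₃ = decide (1 ≤ pathOnes g p) := by
    simp [eraseEdge, shrunk, samePair, h.ne₀₁.symm, hp.ne₀₃.symm]
  rw [cutCard_eraseEdge hsymm h.ne₀₁, cutCard_eraseEdge (hsymm.eraseEdge _ _) h.ne₁₃,
    eraseEdge_shrunk_one_eq_offPath hg hp, hone₀₁, hone₁₃, cutCard_offPath_pat]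
  simp only [shrunkCut, ← pathOnes_eq, pat_apply, h.ne₀₁, h.ne₀₂, h.ne₁₂, h.ne₁₃.symm,
    h.ne₂₃.symm, if_true, if_false]
  ring

/- With these two lemmas, shrinking preserves the value of an optimal connected cut: the values at
the inner vertices can be translated without changing the inner type, hence connectedness. -/
lemma exists_shrunkCut_le_pathCut : ∀ o₁ o₂ o₃ a b y : Bool, ∃ x₁ x₂ : Bool,
    innerType a x₁ x₂ b = innerType a y (y && b) b ∧
      shrunkCut o₁ o₂ o₃ a y b ≤ pathCut o₁ o₂ o₃ a x₁ x₂ b := by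
  decide

lemma exists_pathCut_le_shrunkCut : ∀ o₁ o₂ o₃ a b x₁ x₂ : Bool, innerType a x₁ x₂ b ≠ .broken →
    ∃ y : Bool, innerType a y (y && b) b = innerType a x₁ x₂ b ∧
      pathCut o₁ o₂ o₃ a x₁ x₂ b ≤ shrunkCut o₁ o₂ o₃ a y b := by
  decide

lemma exists_pat_of_shrunk (hg : WellFormed g) (hp : Thin g p) {y : Bool}
    (h : ConnOn (shrunk g p).adj (pat Y p.v₁ p.v₂ y false)) :
    ∃ x₁ x₂, ConnOn g.adj (pat Y p.v₁ p.v₂ x₁ x₂) ∧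
      cutCard (shrunk g p).one (pat Y p.v₁ p.v₂ y false) ≤
        cutCard g.one (pat Y p.v₁ p.v₂ x₁ x₂) := by
  obtain ⟨x₁, x₂, htype, hcut⟩ := exists_shrunkCut_le_pathCut (g.one p.v₀ p.v₁)
    (g.one p.v₁ p.v₂) (g.one p.v₂ p.v₃) (Y p.v₀) (Y p.v₃) y
  refine ⟨x₁, x₂, ((hp.isInnerPath hg).connOn_pat_congr hg.symm htype).2
    ((connOn_shrunk_pat_iff hg hp).1 h), ?_⟩
  rw [cutCard_pat hg hp, cutCard_shrunk_pat hg hp]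
  gcongr

lemma exists_shrunk_of_pat (hg : WellFormed g) (hp : Thin g p) {x₁ x₂ : Bool}
    (h : ConnOn g.adj (pat Y p.v₁ p.v₂ x₁ x₂)) :
    ∃ y, ConnOn (shrunk g p).adj (pat Y p.v₁ p.v₂ y false) ∧
      cutCard g.one (pat Y p.v₁ p.v₂ x₁ x₂) ≤
        cutCard (shrunk g p).one (pat Y p.v₁ p.v₂ y false) := by
  have hpath := hp.isInnerPath hg
  obtain ⟨y, htype, hcut⟩ := exists_pathCut_le_shrunkCut (g.one p.v₀ p.v₁)
    (g.one p.v₁ p.v₂) (g.one p.v₂ p.v₃) _ _ x₁ x₂ (hpath.innerType_ne_broken h)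
  refine ⟨y, (connOn_shrunk_pat_iff hg hp).2 ((hpath.connOn_pat_congr hg.symm htype).2 h), ?_⟩
  rw [cutCard_pat hg hp, cutCard_shrunk_pat hg hp]
  gcongr

end Shrink

/-! ### Spanning trees -/

section SpanningTree

variable {n : ℕ} {g : BGraph n} {T : Tree n} {M : Mat n} {X : VSet n} {a b u v x y : Fin n}

/-- `T` is a spanning tree of `g`: a connected spanning subgraph with fewer edges than vertices.
Each edge is counted twice in the sum of the degrees. -/
structure IsSpanningTree (g : BGraph n) (T : Tree n) : Prop where
  vert : T.vert = g.vert
  symm : IsSymm T.adj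
  sub : ∀ u v, T.adj u v → g.adj u v
  conn : ConnOn T.adj g.vert
  count : ∑ v, deg T.adj v + 2 ≤ 2 * vcard g.vert

lemma sum_deg_add_two_le_of_minimal (hM : IsSymm M) (hirrefl : ∀ v, M v v = false)
    (hconn : ConnOn M X) (hmin : ∀ u v, M u v → ¬ ConnOn (eraseEdge M u v) X) :
    ∑ v, deg M v + 2 ≤ 2 * vcard X := by
  classical
  let G : SimpleGraph (Fin n) :=
    { Adj u v := M u v
      symm := ⟨fun u v h => by rwa [hM]⟩
      loopless := ⟨fun v h => by simp [hirrefl] at h⟩ }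
  have hG : (G.induce {v | X v}).Connected :=
    (connOn_iff_induce_connected (fun _ _ => Iff.rfl) (fun _ => Iff.rfl)).1 hconn
  obtain ⟨F, hFG, hF⟩ := hG.exists_isTree_le
  -- a spanning tree `F'` of `M` contains every edge, since no edge of `M` can be removed
  let F' := F.map (Function.Embedding.subtype fun v => v ∈ {v | X v})
  have hF' : ConnOn (fun u v => decide (F'.Adj u v)) X := by
    refine (connOn_iff_induce_connected (G := F') (S := {v | X v}) (by simp)
      (fun _ => Iff.rfl)).2 ?_
    rw [SimpleGraph.induce, SimpleGraph.comap_map_eq]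
    exact hF.connected
  have hF'G : F' ≤ G := SimpleGraph.map_le_iff_le_comap _ _ _ |>.2 hFG
  have hMF : ∀ u v, M u v → F'.Adj u v := by
    intro u v huv
    by_contra hnot
    refine hmin u v huv (hF'.mono fun w z _ _ hwz => ?_)
    have hwz : F'.Adj w z := of_decide_eq_true hwz
    refine eraseEdge_iff.2 ⟨hF'G hwz, ?_⟩
    rintro (⟨rfl, rfl⟩ | ⟨rfl, rfl⟩)
    exacts [hnot hwz, hnot hwz.symm]
  have hdeg : ∀ v, deg M v ≤ F'.degree v := fun v => by
    rw [← SimpleGraph.card_neighborFinset_eq_degree]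
    exact Finset.card_le_card fun u hu => by simpa using hMF v u (by simpa using hu)
  have hedges : F'.edgeFinset.card + 1 = vcard X := by
    rw [SimpleGraph.card_edgeFinset_map, hF.card_edgeFinset, Fintype.card_subtype]
    rfl
  calc ∑ v, deg M v + 2 ≤ ∑ v, F'.degree v + 2 := by gcongr; exact hdeg _
    _ ≤ 2 * vcard X := by rw [F'.sum_degrees_eq_twice_card_edges]; omega

/-- Delete the edge `ab` if `X` stays connected. -/
def tryErase (X : VSet n) (M : Mat n) (a b : Fin n) : Mat n :=
  if M a b ∧ (isConn (eraseEdge M a b) X).val then eraseEdge M a b else M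

lemma spanningTree_val (g : BGraph n) : (spanningTree g).val =
    ⟨g.vert, (List.finRange n ×ˢ List.finRange n).foldl
      (fun M e => tryErase g.vert M e.1 e.2) g.adj⟩ := by
  simp only [spanningTree, bind_val, table₂_val, op_val, foldT_val, Tree.mk.injEq, true_and,
    SProd.sprod, List.product, List.foldl_flatMap, List.foldl_map]
  congr 1
  funext M a
  congr 1
  funext M b
  by_cases hab : M a b
  · simp only [hab, if_true, tryErase, true_and]
    rfl
  · simp only [hab, tryErase]
    rfl

lemma foldl_tryErase_spec (l : List (Fin n × Fin n)) (hM : IsSymm M) (hc : ConnOn M X) :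
    let M' := l.foldl (fun M e => tryErase X M e.1 e.2) M
    IsSymm M' ∧ (∀ u v, M' u v → M u v) ∧ ConnOn M' X ∧
      ∀ e ∈ l, M' e.1 e.2 → ¬ ConnOn (eraseEdge M' e.1 e.2) X := by
  induction l generalizing M with
  | nil => exact ⟨hM, fun _ _ => id, hc, by simp⟩
  | cons e l ih =>
    have hisConn := isConn_val (hM.eraseEdge e.1 e.2) X
    have hsymm : IsSymm (tryErase X M e.1 e.2) := by
      unfold tryErase
      split_ifs
      exacts [hM.eraseEdge _ _, hM]
    have hle : ∀ u v, tryErase X M e.1 e.2 u v → M u v := by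
      unfold tryErase
      split_ifs
      exacts [fun u v h => (eraseEdge_iff.1 h).1, fun u v h => h]
    have hconn : ConnOn (tryErase X M e.1 e.2) X := by
      unfold tryErase
      split_ifs with h
      exacts [hisConn.1 h.2, hc]
    obtain ⟨hsymm', hle', hconn', hmin⟩ := ih hsymm hconn
    refine ⟨hsymm', fun u v h => hle _ _ (hle' _ _ h), hconn', fun f hf hmem hcf => ?_⟩
    rcases List.mem_cons.1 hf with rfl | hf
    · have hfM := hle' _ _ hmem
      have hcM : ConnOn (eraseEdge M f.1 f.2) X := hcf.mono fun u v _ _ huv => by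
        rw [List.foldl_cons, eraseEdge_iff] at huv
        exact eraseEdge_iff.2 ⟨hle _ _ (hle' _ _ huv.1), huv.2⟩
      rw [tryErase, if_pos ⟨hle _ _ hfM, hisConn.2 hcM⟩] at hfM
      simp [eraseEdge, samePair] at hfM
    · exact hmin f hf hmem hcf

lemma isSpanningTree_spanningTree (hg : WellFormed g) :
    IsSpanningTree g (spanningTree g).val := by
  obtain ⟨hsymm, hsub, hconn, hmin⟩ :=
    foldl_tryErase_spec (List.finRange n ×ˢ List.finRange n) hg.symm hg.conn
  rw [spanningTree_val]
  refine ⟨rfl, hsymm, hsub, hconn, sum_deg_add_two_le_of_minimal hsymm (fun v => ?_) hconn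
    fun u v => hmin (u, v) (by simp)⟩
  by_contra hv
  simpa [hg.irrefl] using hsub v v (by simpa using hv)

/-! ### Exchanging edges -/

/-- Exchange the edge `ab` for the edge `xy`. -/
def swap (M : Mat n) (a b x y : Fin n) : Mat n :=
  fun u v => (M u v && !samePair u v a b) || samePair u v x y

/-- The number of vertices of degree two. -/
def degTwoCount (M : Mat n) : ℕ := (Finset.univ.filter fun v => deg M v = 2).card

@[simp] lemma countDeg2_val (M : Mat n) : (countDeg2 M).val = degTwoCount M := by
  simp [countDeg2, degTwoCount]

lemma eraseEdge_comm (M : Mat n) (a b : Fin n) : eraseEdge M a b = eraseEdge M b a := by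
  funext u v
  rw [Bool.eq_iff_iff, eraseEdge_iff, eraseEdge_iff, or_comm (a := u = a ∧ v = b)]

lemma deg_eraseEdge_left (hab : M a b) (hne : a ≠ b) :
    deg (eraseEdge M a b) a + 1 = deg M a := by
  have herase : (Finset.univ.filter fun u => eraseEdge M a b a u = true) =
      (Finset.univ.filter fun u => M a u).erase b := by
    ext u
    simp only [Finset.mem_filter, Finset.mem_univ, true_and, Finset.mem_erase, eraseEdge_iff]
    grind
  rw [deg, herase, Finset.card_erase_add_one (by simpa using hab), deg]

lemma deg_eraseEdge (hM : IsSymm M) (hab : M a b) (hne : a ≠ b) (v : Fin n) :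
    deg (eraseEdge M a b) v + (if v = a ∨ v = b then 1 else 0) = deg M v := by
  by_cases hva : v = a
  · subst hva
    simpa using deg_eraseEdge_left hab hne
  by_cases hvb : v = b
  · subst hvb
    rw [eraseEdge_comm]
    simpa using deg_eraseEdge_left (hM a v ▸ hab) hne.symm
  · simp [deg, eraseEdge, samePair, hva, hvb]

lemma IsSymm.swap (hM : IsSymm M) (a b x y : Fin n) : IsSymm (swap M a b x y) := by
  intro u v
  simp only [CMC.swap]
  rw [hM, samePair_comm u v, samePair_comm u v]

lemma eraseEdge_swap (hM : IsSymm M) (hxy : M x y = false) :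
    eraseEdge (swap M a b x y) x y = eraseEdge M a b := by
  funext u v
  have hyx : M y x = false := hM y x ▸ hxy
  rw [Bool.eq_iff_iff, eraseEdge_iff, eraseEdge_iff, ← samePair_iff, ← samePair_iff]
  have hpair := samePair_iff (u := u) (v := v) (a := x) (b := y)
  simp only [swap]
  grind

lemma deg_swap (hM : IsSymm M) (hab : M a b) (hne : a ≠ b) (hxy : M x y = false) (hne' : x ≠ y)
    (v : Fin n) : deg (swap M a b x y) v + (if v = a ∨ v = b then 1 else 0) =
      deg M v + (if v = x ∨ v = y then 1 else 0) := by
  have hold := deg_eraseEdge hM hab hne v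
  have hnew := deg_eraseEdge (hM.swap a b x y) (a := x) (b := y) (by simp [swap, samePair]) hne' v
  rw [eraseEdge_swap hM hxy] at hnew
  omega

lemma sum_deg_swap (hM : IsSymm M) (hab : M a b) (hne : a ≠ b) (hxy : M x y = false)
    (hne' : x ≠ y) : ∑ v, deg (swap M a b x y) v = ∑ v, deg M v := by
  have hpair : ∀ c d : Fin n, c ≠ d → (∑ v, if v = c ∨ v = d then 1 else 0) = 2 := by
    intro c d hcd
    rw [← Finset.card_filter, ← Finset.card_pair hcd]
    congr 1
    ext v
    simp
  have hsum := Finset.sum_congr rfl fun v (_ : v ∈ Finset.univ) =>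
    deg_swap hM hab hne hxy hne' v
  rw [Finset.sum_add_distrib, Finset.sum_add_distrib, hpair _ _ hne, hpair _ _ hne'] at hsum
  omega

/-- Exchanging the tree edge `ab` for the edge `xy` of `g` gives a spanning tree with fewer vertices
of degree two.  Connectedness is tested by `isConn`, so that `improve` can be described for trees
`T` that are not known to be symmetric. -/
structure IsImprovement (g : BGraph n) (T : Tree n) (a b x y : Fin n) : Prop where
  mem : T.adj a b
  adj : g.adj x y
  notMem : T.adj x y = false
  isConn : (isConn (swap T.adj a b x y) g.vert).val
  lt : degTwoCount (swap T.adj a b x y) < degTwoCount T.adj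

/-- No exchange of edges decreases the number of vertices of degree two. -/
def IsLocalOpt (g : BGraph n) (T : Tree n) : Prop := ∀ a b x y, ¬ IsImprovement g T a b x y

lemma IsLocalOpt.degTwoCount_le (h : IsLocalOpt g T) (hT : IsSymm T.adj) (hab : T.adj a b)
    (hxy : g.adj x y) (hxy' : T.adj x y = false) (hconn : ConnOn (swap T.adj a b x y) g.vert) :
    degTwoCount T.adj ≤ degTwoCount (swap T.adj a b x y) :=
  not_lt.1 fun hlt => h a b x y
    ⟨hab, hxy, hxy', (isConn_val (hT.swap a b x y) _).2 hconn, hlt⟩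

lemma IsSpanningTree.swap (hg : WellFormed g) (hT : IsSpanningTree g T)
    (h : IsImprovement g T a b x y) : IsSpanningTree g ⟨T.vert, swap T.adj a b x y⟩ := by
  refine ⟨hT.vert, hT.symm.swap a b x y, fun u v huv => ?_,
    (isConn_val (hT.symm.swap a b x y) _).1 h.isConn, ?_⟩
  · simp only [CMC.swap, Bool.or_eq_true, Bool.and_eq_true, samePair_iff] at huv
    rcases huv with huv | ⟨rfl, rfl⟩ | ⟨rfl, rfl⟩
    exacts [hT.sub _ _ huv.1, h.adj, hg.symm _ _ ▸ h.adj]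
  · have hsum := sum_deg_swap hT.symm h.mem (hg.ne (hT.sub _ _ h.mem)) h.notMem (hg.ne h.adj)
    exact hsum ▸ hT.count

lemma improve_val_cases (g : BGraph n) (T : Tree n) :
    ((improve g T).val = T ∧ IsLocalOpt g T) ∨ ∃ a b x y, IsImprovement g T a b x y ∧
      (improve g T).val = ⟨T.vert, swap T.adj a b x y⟩ := by
  classical
  simp only [improve, bind_val, countDeg2_val]
  set search : Fin n → Fin n → Fin n → Fin n → Timed (Option (Mat n)) := fun a b x y =>
    if T.adj a b && g.adj x y && !T.adj x y then do
      let M ← table₂ fun u v => op ((T.adj u v && !samePair u v a b) || samePair u v x y)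
      let c ← isConn M g.vert
      let k' ← countDeg2 M
      op (if c && decide (k' < degTwoCount T.adj) then some M else none)
    else op none with hsearch
  have hval : ∀ a b x y, (search a b x y).val =
      if IsImprovement g T a b x y then some (swap T.adj a b x y) else none := by
    intro a b x y
    have hiff : IsImprovement g T a b x y ↔ (T.adj a b && g.adj x y && !T.adj x y) ∧
        ((isConn (swap T.adj a b x y) g.vert).val &&
          decide (degTwoCount (swap T.adj a b x y) < degTwoCount T.adj)) := by
      simp only [Bool.and_eq_true, Bool.not_eq_true', decide_eq_true_eq]
      exact ⟨fun h => ⟨⟨⟨h.mem, h.adj⟩, h.notMem⟩, h.isConn, h.lt⟩,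
        fun ⟨⟨⟨hab, hxy⟩, hxy'⟩, hc, hlt⟩ => ⟨hab, hxy, hxy', hc, hlt⟩⟩
    simp only [hsearch, hiff, ite_and, apply_ite Timed.val, bind_val, table₂_val, op_val,
      countDeg2_val]
    rfl
  rcases ho : (firstT fun a => firstT fun b => firstT fun x => firstT fun y => search a b x y).val
    with _ | M
  · left
    simp only [firstT_val_eq_none, hval, ite_eq_right_iff, reduceCtorEq, imp_false] at ho
    exact ⟨rfl, ho⟩
  · right
    obtain ⟨a, ho⟩ := exists_of_firstT_val_eq_some ho
    obtain ⟨b, ho⟩ := exists_of_firstT_val_eq_some ho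
    obtain ⟨x, ho⟩ := exists_of_firstT_val_eq_some ho
    obtain ⟨y, ho⟩ := exists_of_firstT_val_eq_some ho
    rw [hval, Option.ite_none_right_eq_some, Option.some.injEq] at ho
    obtain ⟨himp, rfl⟩ := ho
    exact ⟨a, b, x, y, himp, rfl⟩

lemma leafyTree_val (g : BGraph n) :
    (leafyTree g).val = (fun T => (improve g T).val)^[n] (spanningTree g).val := by
  simp [leafyTree]

lemma isSpanningTree_leafyTree (hg : WellFormed g) : IsSpanningTree g (leafyTree g).val := by
  rw [leafyTree_val]
  refine Function.Iterate.rec (IsSpanningTree g) (isSpanningTree_spanningTree hg)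
    (fun T hT => ?_) n
  rcases improve_val_cases g T with ⟨hval, -⟩ | ⟨a, b, x, y, himp, hval⟩
  · exact hval.symm ▸ hT
  · exact hval.symm ▸ hT.swap hg himp

lemma isLocalOpt_leafyTree (g : BGraph n) : IsLocalOpt g (leafyTree g).val := by
  have hfix : (improve g (leafyTree g).val).val = (leafyTree g).val := by
    rw [leafyTree_val]
    refine isFixedPt_iterate_of_lt (F := fun T => (improve g T).val)
      (μ := fun T => degTwoCount T.adj) (fun T hT => ?_) ?_
    · rcases improve_val_cases g T with ⟨hval, -⟩ | ⟨a, b, x, y, himp, hval⟩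
      · exact absurd hval hT
      · exact hval.symm ▸ himp.lt
    · exact (Finset.card_le_univ _).trans (by simp)
  rcases improve_val_cases g (leafyTree g).val with ⟨-, hopt⟩ | ⟨a, b, x, y, himp, hval⟩
  · exact hopt
  · have hadj := congrArg Tree.adj (hfix.symm.trans hval)
    exact absurd (congrArg degTwoCount hadj) himp.lt.ne'

end SpanningTree

/-! ### Locally optimal trees have many leaves -/

section Leaves

variable {n : ℕ} {g : BGraph n} {T : Tree n} {M : Mat n} {X : VSet n} {A : Finset (Fin n)}
  {a b c w x : Fin n}

/-- The leaves of `T`: its vertices of degree at most one. -/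
def leafSet (T : Tree n) : VSet n := fun v => T.vert v && decide (deg T.adj v ≤ 1)

@[simp] lemma leaves_val (T : Tree n) : (leaves T).val = leafSet T := by
  simp only [leaves, table_val, bind_val, degree_val, op_val]
  rfl

lemma IsSpanningTree.mem (hg : WellFormed g) (hT : IsSpanningTree g T) {u v : Fin n}
    (h : T.adj u v) : g.vert u :=
  hg.mem u v (hT.sub u v h)

lemma IsSpanningTree.ne (hg : WellFormed g) (hT : IsSpanningTree g T) {u v : Fin n}
    (h : T.adj u v) : u ≠ v :=
  hg.ne (hT.sub u v h)

lemma exists_ne_of_deg_eq_two (h : deg M b = 2) (a : Fin n) : ∃ c, M b c ∧ c ≠ a := by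
  have hcard : 1 < deg M b := h ▸ one_lt_two
  obtain ⟨c, hc, hca⟩ := Finset.exists_mem_ne hcard a
  exact ⟨c, by simpa using hc, hca⟩

lemma exists_adj_reflTransGen_avoiding (hM : IsSymm M) (hconn : ConnOn M X) (hw : X w) (hx : X x)
    (hne : w ≠ x) :
    ∃ b, M w b ∧ Relation.ReflTransGen (fun u v => M u v ∧ v ≠ w) x b := by
  by_contra! hcon
  have hxw := hconn.2 (Relation.ReflTransGen (fun u v => M u v ∧ v ≠ w) x) ⟨x, hx, .refl⟩
    (fun u v _ _ hu huv => hu.tail ⟨huv, ?_⟩) w hw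
  · rcases hxw.cases_tail with h | ⟨_, _, h⟩
    exacts [hne h, h.2 rfl]
  · rintro rfl
    exact hcon u (hM v u ▸ huv) hu

/- In the new graph one gets from `w` to `x`, and from there to `c`, since `b` can be entered only
from `w` and `c`. -/
lemma connOn_swap (hM : IsSymm M) (hconn : ConnOn M X) (hX : ∀ u v, M u v → X u)
    (hw : X w) (hx : X x) (hwb : M w b) (hbc : M b c) (hcw : c ≠ w) (hdeg : deg M b = 2)
    (hbx : b ≠ x) (hwx : w ≠ x)
    (hpath : Relation.ReflTransGen (fun u v => M u v ∧ v ≠ w) x b) :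
    ConnOn (swap M b c w x) X := by
  have hbw : M b w := hM w b ▸ hwb
  have hwne : w ≠ b := by
    rintro rfl
    exact (hpath.cases_tail.resolve_left hbx).elim fun _ h => h.2.2 rfl
  refine connOn_of_root (hM.swap b c w x) hw fun P hPw hP => ?_
  have hstep : ∀ u v, M u v → P u → ¬((u = b ∧ v = c) ∨ (u = c ∧ v = b)) → P v := by
    intro u v huv hPu hne
    refine hP u v (hX u v huv) (hX v u (hM u v ▸ huv)) hPu ?_
    simp only [swap, huv, Bool.true_and, Bool.or_eq_true, Bool.not_eq_true', ← Bool.not_eq_true,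
      samePair_iff]
    exact Or.inl hne
  have hPb : P b := hstep w b hwb hPw (by grind)
  have hPx : P x := hP w x hw hx hPw (by simp [swap, samePair])
  have hPc : P c := by
    by_contra hPc
    have hreach : ∀ v, Relation.ReflTransGen (fun u v => M u v ∧ v ≠ w) x v →
        P v ∧ v ≠ w ∧ v ≠ b := by
      intro v hv
      induction hv with
      | refl => exact ⟨hPx, hwx.symm, hbx.symm⟩
      | @tail u v _ huv ih =>
        have hvb : v ≠ b := by
          rintro rfl
          rcases (adj_iff_of_deg_eq_two hdeg hbw hbc hcw.symm).1 (hM u v ▸ huv.1) with rfl | rfl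
          exacts [ih.2.1 rfl, hPc ih.1]
        exact ⟨hstep u v huv.1 ih.1 (by grind), huv.2, hvb⟩
    exact (hreach b hpath).2.2 rfl
  refine hconn.2 P ⟨w, hw, hPw⟩ fun u v _ _ hPu huv => ?_
  by_cases h : (u = b ∧ v = c) ∨ (u = c ∧ v = b)
  · rcases h with ⟨rfl, rfl⟩ | ⟨rfl, rfl⟩ <;> assumption
  · exact hstep u v huv hPu h

lemma degTwoCount_swap_lt (hM : IsSymm M) (hbc : M b c) (hbc' : b ≠ c) (hwx : M w x = false)
    (hwx' : w ≠ x) (hw : deg M w = 2) (hb : deg M b = 2) (hc : deg M c = 2) (hwb : w ≠ b)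
    (hcw : c ≠ w) (hbx : b ≠ x) : degTwoCount (swap M b c w x) < degTwoCount M := by
  have hdeg := deg_swap hM hbc hbc' hwx hwx'
  have hsub : (Finset.univ.filter fun v => deg (swap M b c w x) v = 2) ⊆
      insert x (((Finset.univ.filter fun v => deg M v = 2).erase w).erase b) := by
    intro v
    simp only [Finset.mem_filter, Finset.mem_univ, true_and, Finset.mem_insert, Finset.mem_erase]
    grind
  have hcard := (Finset.card_le_card hsub).trans (Finset.card_insert_le _ _)
  have hpair : ({w, b} : Finset (Fin n)) ⊆ Finset.univ.filter fun v => deg M v = 2 := by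
    simp [Finset.insert_subset_iff, hw, hb]
  have hpos := Finset.card_le_card hpair
  rw [Finset.card_pair hwb] at hpos
  rw [Finset.card_erase_of_mem (by simp [hb, hwb.symm]), Finset.card_erase_of_mem (by simp [hw])]
    at hcard
  unfold degTwoCount
  omega

lemma IsLocalOpt.deg_eq_two (hopt : IsLocalOpt g T) (hg : WellFormed g) (hT : IsSpanningTree g T)
    (hw : deg T.adj w = 2) (h₁ : ∀ b, T.adj w b → deg T.adj b = 2)
    (h₂ : ∀ b c, T.adj w b → T.adj b c → deg T.adj c = 2) : deg g.adj w = 2 := by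
  by_contra hdeg
  have hle : deg T.adj w ≤ deg g.adj w := Finset.card_le_card fun u => by
    simpa using hT.sub w u
  obtain ⟨x, hx, hx'⟩ := Finset.exists_mem_notMem_of_card_lt_card
    (lt_of_le_of_ne hle fun h => hdeg (h.symm.trans hw))
  simp only [Finset.mem_filter, Finset.mem_univ, true_and, Bool.not_eq_true] at hx hx'
  have hwX := hg.mem w x hx
  have hxX := hg.mem x w (hg.symm w x ▸ hx)
  obtain ⟨b, hwb, hpath⟩ :=
    exists_adj_reflTransGen_avoiding hT.symm hT.conn hwX hxX (hg.ne hx)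
  obtain ⟨c, hbc, hcw⟩ := exists_ne_of_deg_eq_two (h₁ b hwb) w
  have hbx : b ≠ x := by
    rintro rfl
    simp [hx'] at hwb
  have hconn := connOn_swap hT.symm hT.conn (fun _ _ => hT.mem hg) hwX hxX hwb hbc hcw (h₁ b hwb)
    hbx (hg.ne hx) hpath
  exact (hopt.degTwoCount_le hT.symm hbc hx hx' hconn).not_gt <|
    degTwoCount_swap_lt hT.symm hbc (hT.ne hg hbc) hx' (hg.ne hx) hw (h₁ b hwb)
      (h₂ b c hwb hbc) (hT.ne hg hwb) hcw hbx

lemma IsSpanningTree.not_triangle (hT : IsSpanningTree g T) (hg : WellFormed g)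
    (hab : T.adj a b) (hbc : T.adj b c) (hca : T.adj c a)
    (ha : deg T.adj a = 2) (hb : deg T.adj b = 2) (hc : deg T.adj c = 2) : False := by
  have hab' := hT.ne hg hab
  have hbc' := hT.ne hg hbc
  have hca' := hT.ne hg hca
  have hnbr : ∀ u v, T.adj u v → u = a ∨ u = b ∨ u = c → v = a ∨ v = b ∨ v = c := by
    rintro u v huv (rfl | rfl | rfl)
    · exact Or.inr ((adj_iff_of_deg_eq_two ha hab (hT.symm _ _ ▸ hca) hbc').1 huv)
    · have := (adj_iff_of_deg_eq_two hb hbc (hT.symm _ _ ▸ hab) hca').1 huv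
      tauto
    · have := (adj_iff_of_deg_eq_two hc hca (hT.symm _ _ ▸ hbc) hab').1 huv
      tauto
  have hall := hT.conn.2 (fun v => v = a ∨ v = b ∨ v = c) ⟨a, hT.mem hg hab, Or.inl rfl⟩
    fun u v _ _ hu huv => hnbr u v huv hu
  have hcard : vcard g.vert ≤ 3 :=
    (Finset.card_le_card (t := {a, b, c}) fun v hv => by
      simpa using hall v (by simpa using hv)).trans
      Finset.card_le_three
  have hsum : ∑ v ∈ ({a, b, c} : Finset (Fin n)), deg T.adj v ≤ ∑ v, deg T.adj v :=
    Finset.sum_le_sum_of_subset (Finset.subset_univ _)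
  rw [Finset.sum_insert (by simp [hab', hca'.symm]), Finset.sum_insert (by simp [hbc']),
    Finset.sum_singleton, ha, hb, hc] at hsum
  have := hT.count
  omega

lemma IsLocalOpt.exists_thin (hopt : IsLocalOpt g T) (hg : WellFormed g)
    (hT : IsSpanningTree g T) (hc : deg T.adj c = 2) (h₁ : ∀ b, T.adj c b → deg T.adj b = 2)
    (h₂ : ∀ b a, T.adj c b → T.adj b a → deg T.adj a = 2)
    (h₃ : ∀ b a z, T.adj c b → T.adj b a → T.adj a z → deg T.adj z = 2) : ∃ p, Thin g p := by
  have hflip : ∀ {u v}, T.adj u v → T.adj v u := fun {u v} h => hT.symm u v ▸ h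
  have hnbr : ∀ b, T.adj c b → deg g.adj b = 2 := fun b hcb =>
    hopt.deg_eq_two hg hT (h₁ b hcb) (fun a => h₂ b a hcb) fun a z => h₃ b a z hcb
  obtain ⟨b, hcb, -⟩ := exists_ne_of_deg_eq_two hc c
  obtain ⟨e, hce, heb⟩ := exists_ne_of_deg_eq_two hc b
  obtain ⟨a, hba, hac⟩ := exists_ne_of_deg_eq_two (h₁ b hcb) c
  have hae : a ≠ e := by
    rintro rfl
    exact hT.not_triangle hg hba (hflip hce) hcb (h₁ b hcb) (h₁ a hce) hc
  exact ⟨⟨a, b, c, e⟩, hT.sub _ _ (hflip hba), hT.sub _ _ (hflip hcb), hT.sub _ _ hce, hac,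
    heb.symm, hae, hnbr b hcb, hopt.deg_eq_two hg hT hc h₁ h₂, hnbr e hce⟩

/-- The vertices of degree two with a neighbour in `A`. -/
def degTwoNbrs (M : Mat n) (A : Finset (Fin n)) : Finset (Fin n) :=
  Finset.univ.filter fun v => deg M v = 2 ∧ ∃ u ∈ A, M u v

lemma mem_degTwoNbrs {v : Fin n} : v ∈ degTwoNbrs M A ↔ deg M v = 2 ∧ ∃ u ∈ A, M u v := by
  simp [degTwoNbrs]

lemma card_degTwoNbrs_le (M : Mat n) (A : Finset (Fin n)) :
    (degTwoNbrs M A).card ≤ ∑ u ∈ A, deg M u := by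
  refine (Finset.card_le_card fun v hv => ?_).trans
    (Finset.card_biUnion_le (s := A) (t := fun u => Finset.univ.filter fun v => M u v))
  simpa using (mem_degTwoNbrs.1 hv).2

lemma card_degTwoNbrs_degTwoNbrs_le (M : Mat n) (A : Finset (Fin n)) :
    (degTwoNbrs M (degTwoNbrs M A)).card ≤ (degTwoNbrs M A).card * 2 :=
  (card_degTwoNbrs_le M _).trans_eq
    (Finset.sum_const_nat fun _ hv => (mem_degTwoNbrs.1 hv).1)

/- The degrees sum to less than twice the number of vertices, so the excess of the degrees above two
is at most the defect at the leaves. -/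
lemma IsSpanningTree.card_deg_ne_two_le (hT : IsSpanningTree g T) :
    let R := Finset.univ.filter fun v => g.vert v ∧ deg T.adj v ≠ 2
    R.card ≤ 3 * vcard (leafSet T) ∧ ∑ v ∈ R, deg T.adj v ≤ 6 * vcard (leafSet T) := by
  intro R
  set D := Finset.univ.filter fun v => g.vert v ∧ deg T.adj v = 2
  have hsplit : ∀ f : Fin n → ℕ,
      ∑ v ∈ Finset.univ.filter (fun v => g.vert v), f v = ∑ v ∈ D, f v + ∑ v ∈ R, f v := by
    intro f
    rw [← Finset.sum_filter_add_sum_filter_not _ fun v => deg T.adj v = 2, Finset.filter_filter,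
      Finset.filter_filter]
  have hcard : vcard g.vert = D.card + R.card := by
    simpa [vcard] using hsplit fun _ => 1
  have hdeg : ∑ v ∈ D, deg T.adj v + ∑ v ∈ R, deg T.adj v ≤ ∑ v, deg T.adj v :=
    hsplit (deg T.adj) ▸ Finset.sum_le_sum_of_subset (Finset.subset_univ _)
  have hD : ∑ v ∈ D, deg T.adj v = D.card * 2 :=
    Finset.sum_const_nat fun v hv => (Finset.mem_filter.1 hv).2.2
  have hR : R.card * 3 ≤ ∑ v ∈ R, deg T.adj v + vcard (leafSet T) * 3 :=
    calc R.card * 3 ≤ ∑ v ∈ R, (deg T.adj v + if leafSet T v then 3 else 0) := by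
          refine Finset.card_nsmul_le_sum R _ 3 fun v hv => ?_
          simp only [R, Finset.mem_filter, Finset.mem_univ, true_and] at hv
          simp only [leafSet, hT.vert, hv.1, Bool.true_and, decide_eq_true_eq]
          split_ifs <;> omega
      _ ≤ ∑ v ∈ R, deg T.adj v + vcard (leafSet T) * 3 := by
          rw [Finset.sum_add_distrib, ← Finset.sum_filter, Finset.sum_const, smul_eq_mul, vcard]
          gcongr
          exact Finset.subset_univ R
  have := hT.count
  omega

lemma card_le_card_leafSet (hg : WellFormed g) (hthin : ∀ p, ¬Thin g p)
    (hT : IsSpanningTree g T) (hopt : IsLocalOpt g T) :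
    vcard g.vert ≤ 45 * vcard (leafSet T) := by
  obtain ⟨hR, hRdeg⟩ := hT.card_deg_ne_two_le
  set R := Finset.univ.filter fun v => g.vert v ∧ deg T.adj v ≠ 2
  set D₁ := degTwoNbrs T.adj R
  set D₂ := degTwoNbrs T.adj D₁
  set D₃ := degTwoNbrs T.adj D₂
  have hflip : ∀ {u v}, T.adj u v → T.adj v u := fun {u v} h => hT.symm u v ▸ h
  have hcover : (Finset.univ.filter fun v => g.vert v) ⊆ R ∪ (D₁ ∪ D₂ ∪ D₃) := by
    intro c hc
    by_contra hcon
    simp only [R, D₃, D₂, D₁, Finset.mem_union, Finset.mem_filter, Finset.mem_univ, true_and,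
      mem_degTwoNbrs] at hc hcon
    have hnbr : ∀ {u v}, T.adj u v → g.vert v := fun h => hT.mem hg (hflip h)
    have hc₂ : deg T.adj c = 2 := by grind
    have h₁ : ∀ b, T.adj c b → deg T.adj b = 2 := fun b hb => by
      grind [hnbr hb, hflip hb]
    have h₂ : ∀ b a, T.adj c b → T.adj b a → deg T.adj a = 2 := fun b a hb ha => by
      grind [hnbr ha, hflip ha, hflip hb]
    have h₃ : ∀ b a z, T.adj c b → T.adj b a → T.adj a z → deg T.adj z = 2 :=
      fun b a z hb ha hz => by
        grind [hnbr hz, hflip hz, hflip ha, hflip hb]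
    exact (hopt.exists_thin hg hT hc₂ h₁ h₂ h₃).elim hthin
  have hcard := (Finset.card_le_card hcover).trans <| (Finset.card_union_le _ _).trans <|
    Nat.add_le_add_left ((Finset.card_union_le _ _).trans <|
      Nat.add_le_add_right (Finset.card_union_le _ _) _) _
  have hD₁ : D₁.card ≤ _ := card_degTwoNbrs_le T.adj R
  have hD₂ : D₂.card ≤ D₁.card * 2 := card_degTwoNbrs_degTwoNbrs_le T.adj R
  have hD₃ : D₃.card ≤ D₂.card * 2 := card_degTwoNbrs_degTwoNbrs_le T.adj D₁
  unfold vcard at *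
  omega

end Leaves

/-! ### Splitting the leaves of a tree -/

section EntrySum

variable {V : Type*} [Fintype V] {O O' : V → V → Bool} {f f' : V → V → ℕ} {X : V → Bool}

/-- The sum of the weights `f u v` over the entries `(u, v)` of `O`. -/
def entrySum (O : V → V → Bool) (f : V → V → ℕ) : ℕ := ∑ u, ∑ v, if O u v then f u v else 0

lemma entrySum_add (O : V → V → Bool) (f f' : V → V → ℕ) :
    entrySum O (fun u v => f u v + f' u v) = entrySum O f + entrySum O f' := by
  simp only [entrySum, ← Finset.sum_add_distrib]
  refine Finset.sum_congr rfl fun u _ => Finset.sum_congr rfl fun v _ => ?_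
  split_ifs <;> rfl

lemma entrySum_le_entrySum (h : ∀ u v, O u v → f u v ≠ 0 → O' u v ∧ f u v ≤ f' u v) :
    entrySum O f ≤ entrySum O' f' := by
  refine Finset.sum_le_sum fun u _ => Finset.sum_le_sum fun v _ => ?_
  have := h u v
  grind

lemma entrySum_mono (h : ∀ u v, O u v → f u v ≤ f' u v) : entrySum O f ≤ entrySum O f' :=
  entrySum_le_entrySum fun u v huv _ => ⟨huv, h u v huv⟩

lemma entrySum_transpose (hO : IsSymm O) (f : V → V → ℕ) :
    entrySum O (fun u v => f v u) = entrySum O f := by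
  unfold entrySum
  rw [Finset.sum_comm]
  exact Finset.sum_congr rfl fun u _ => Finset.sum_congr rfl fun v _ => by rw [hO]

lemma entrySum_row (O : V → V → Bool) (f : V → ℕ) :
    entrySum O (fun u _ => f u) = ∑ u, f u * deg O u := by
  refine Finset.sum_congr rfl fun u _ => ?_
  rw [← Finset.sum_filter, Finset.sum_const, smul_eq_mul, mul_comm, deg]

lemma cutCard_eq_entrySum (O : V → V → Bool) (X : V → Bool) :
    cutCard O X = entrySum O fun u v => (X u && !X v).toNat :=
  Finset.sum_congr rfl fun u _ => Finset.sum_congr rfl fun v _ => by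
    beta_reduce
    cases X u <;> cases X v <;> cases O u v <;> rfl

lemma cutCard_empty (O : V → V → Bool) (hX : ¬∃ v, X v) : cutCard O X = 0 := by
  simp only [not_exists, Bool.not_eq_true] at hX
  simp [cutCard, hX]

lemma two_mul_cutCard (hO : IsSymm O) (X : V → Bool) :
    2 * cutCard O X = entrySum O fun u v => (X u != X v).toNat := by
  rw [cutCard_eq_entrySum, two_mul]
  nth_rewrite 2 [← entrySum_transpose hO]
  rw [← entrySum_add]
  congr 1
  funext u v
  cases X u <;> cases X v <;> rfl

/-- The number of entries of `O` from `A` to `B`. -/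
def between (O : V → V → Bool) (A B : V → Bool) : ℕ := entrySum O fun u v => (A u && B v).toNat

lemma between_comm (hO : IsSymm O) (A B : V → Bool) : between O A B = between O B A := by
  unfold between
  rw [← entrySum_transpose hO]
  simp only [Bool.and_comm]

/-- The number of entries of `O` from `A` to the vertex `v`. -/
def degFrom (O : V → V → Bool) (A : V → Bool) (v : V) : ℕ := ∑ u, if A u && O u v then 1 else 0

variable [DecidableEq V] {A : V → Bool} {v : V}

lemma between_insert_left (hO : IsSymm O) (hv : A v = false) (B : V → Bool) :
    between O (fun u => A u || decide (u = v)) B = between O A B + degFrom O B v := by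
  have hdeg : degFrom O B v = entrySum O fun u w => (decide (u = v) && B w).toNat := by
    rw [entrySum, Finset.sum_eq_single v (fun u _ hu => by simp [hu]) (by simp)]
    refine Finset.sum_congr rfl fun u _ => ?_
    rw [hO]
    cases B u <;> cases O v u <;> simp
  rw [hdeg, between, between, ← entrySum_add]
  congr 1
  funext u w
  by_cases hu : u = v
  · simp [hu, hv]
  · simp [hu]

lemma between_insert_self (hO : IsSymm O) (hirr : ∀ v, O v v = false) (hv : A v = false) :
    between O (fun u => A u || decide (u = v)) (fun u => A u || decide (u = v)) =
      between O A A + 2 * degFrom O A v := by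
  rw [between_insert_left hO hv, between_comm hO, between_insert_left hO hv, two_mul, add_assoc]
  congr 2
  refine Finset.sum_congr rfl fun u _ => ?_
  by_cases hu : u = v
  · simp [hu, hirr]
  · simp [hu]

end EntrySum

section Split

variable {n : ℕ} {g : BGraph n} {T : Tree n} {O : Mat n} {L : VSet n} {P : VSet n × VSet n}
  {l : List (Fin n)} {v : Fin n}

/-- One step of the greedy partition of `L`: place `v` on the side to which it has fewer `1`-edges.
-/
def splitStep (O : Mat n) (L : VSet n) (P : VSet n × VSet n) (v : Fin n) : VSet n × VSet n :=
  if L v then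
    if degFrom O P.1 v ≤ degFrom O P.2 v then (fun u => P.1 u || decide (u = v), P.2)
    else (P.1, fun u => P.2 u || decide (u = v))
  else P

lemma splitLeaves_val (g : BGraph n) (L : VSet n) : (splitLeaves g L).val =
    (List.finRange n).foldl (splitStep g.one L) (fun _ => false, fun _ => false) := by
  simp only [splitLeaves, bind_val, foldT_val, emptySet_val]
  congr 1
  funext P v
  by_cases h : L v
  · rw [splitStep, if_pos h, if_pos h]
    simp only [bind_val, apply_ite Timed.val]
    rfl
  · rw [splitStep, if_neg h, if_neg h]
    rfl

/-- `P` is a partition of `L` such that at most half of the entries of `O` within `L` stay within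
one side. -/
structure IsBalancedSplit (O : Mat n) (L : VSet n) (P : VSet n × VSet n) : Prop where
  disjoint : ∀ v, ¬(P.1 v ∧ P.2 v)
  cover : ∀ v, (P.1 v || P.2 v) = L v
  between_le : between O P.1 P.1 + between O P.2 P.2 ≤ 2 * between O P.1 P.2

lemma IsBalancedSplit.swap (hO : IsSymm O) (h : IsBalancedSplit O L P) :
    IsBalancedSplit O L P.swap where
  disjoint v hv := h.disjoint v hv.symm
  cover v := (Bool.or_comm _ _).trans (h.cover v)
  between_le := by
    rw [P.fst_swap, P.snd_swap, between_comm hO P.2 P.1, add_comm]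
    exact h.between_le

lemma IsBalancedSplit.eq_false (h : IsBalancedSplit O L P) (hv : L v = false) :
    P.1 v = false ∧ P.2 v = false :=
  Bool.or_eq_false_iff.1 ((h.cover v).trans hv)

lemma IsBalancedSplit.insert_fst (h : IsBalancedSplit O L P) (hO : IsSymm O)
    (hirr : ∀ v, O v v = false) (hv : L v = false) (hle : degFrom O P.1 v ≤ degFrom O P.2 v) :
    IsBalancedSplit O (fun u => L u || decide (u = v)) (fun u => P.1 u || decide (u = v), P.2) where
  disjoint u := by
    have := h.disjoint u
    have := h.eq_false hv
    grind
  cover u := by rw [Bool.or_right_comm, h.cover]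
  between_le := by
    have := h.between_le
    dsimp only
    rw [between_insert_self hO hirr (h.eq_false hv).1, between_insert_left hO (h.eq_false hv).1]
    omega

lemma IsBalancedSplit.splitStep (h : IsBalancedSplit O (fun u => decide (u ∈ l) && L u) P)
    (hO : IsSymm O) (hirr : ∀ v, O v v = false) (hv : v ∉ l) :
    IsBalancedSplit O (fun u => decide (u ∈ l ++ [v]) && L u) (splitStep O L P v) := by
  have hv' : (decide (v ∈ l) && L v) = false := by simp [hv]
  by_cases hL : L v
  · have hins : (fun u => decide (u ∈ l ++ [v]) && L u) =
        fun u => (decide (u ∈ l) && L u) || decide (u = v) := by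
      funext u
      by_cases hu : u = v <;> simp [hu, hL]
    rw [hins, CMC.splitStep, if_pos hL]
    split_ifs with hle
    · exact h.insert_fst hO hirr hv' hle
    · exact ((h.swap hO).insert_fst hO hirr hv' (not_le.1 hle).le).swap hO
  · have hskip : (fun u => decide (u ∈ l ++ [v]) && L u) = fun u => decide (u ∈ l) && L u := by
      funext u
      by_cases hu : u = v <;> simp [hu, hL]
    rwa [hskip, CMC.splitStep, if_neg hL]

lemma isBalancedSplit_splitLeaves (hg : WellFormed g) (L : VSet n) :
    IsBalancedSplit g.one L (splitLeaves g L).val := by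
  have hfold : ∀ l : List (Fin n), l.Nodup → IsBalancedSplit g.one (fun u => decide (u ∈ l) && L u)
      (l.foldl (splitStep g.one L) (fun _ => false, fun _ => false)) := by
    intro l
    induction l using List.reverseRecOn with
    | nil => exact fun _ => ⟨by simp, by simp, by simp [between, entrySum]⟩
    | append_singleton l v ih =>
      intro hl
      rw [List.nodup_append_comm, List.singleton_append, List.nodup_cons] at hl
      rw [List.foldl_append]
      exact (ih hl.2).splitStep hg.one_symm hg.one_irrefl hl.1
  simpa [splitLeaves_val] using hfold _ (List.nodup_finRange n)

/- An entry between the two sides is cut by both sets, an entry leaving `L` by one of them, and the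
entries within a side are no more than those between the sides. -/
lemma IsBalancedSplit.sum_deg_le (h : IsBalancedSplit O L P) (hO : IsSymm O) {Y : VSet n}
    (hY : ∀ v, L v → Y v) : (∑ v, if L v then deg O v else 0) ≤
      2 * (cutCard O (fun v => Y v && !P.1 v) + cutCard O fun v => Y v && !P.2 v) := by
  set A := P.1
  set B := P.2
  have hcov : ∀ v, (A v || B v) = L v := h.cover
  set out := entrySum O fun u v => (L u && !L v).toNat with hout
  have hin : (∑ v, if L v then deg O v else 0) ≤
      between O A A + between O B B + between O A B + between O B A + out := by
    have hrow : (∑ v, if L v then deg O v else 0) = entrySum O fun u _ => (L u).toNat := by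
      rw [entrySum_row]
      exact Finset.sum_congr rfl fun v _ => by cases L v <;> simp
    rw [hrow]
    simp only [between, out, ← entrySum_add, ← hcov]
    refine entrySum_mono fun u v _ => ?_
    cases A u <;> cases B u <;> cases A v <;> cases B v <;> decide
  have hcut : 2 * between O A B + 2 * between O B A + 2 * out ≤
      2 * cutCard O (fun v => Y v && !A v) + 2 * cutCard O fun v => Y v && !B v := by
    have htr : entrySum O (fun u v => (L v && !L u).toNat) = out := entrySum_transpose hO _
    rw [two_mul_cutCard hO, two_mul_cutCard hO, two_mul out]
    nth_rewrite 2 [← htr]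
    simp only [two_mul, between, hout, ← entrySum_add, ← hcov]
    refine entrySum_mono fun u v _ => ?_
    have hYu := hY u
    have hYv := hY v
    have hu : ¬(A u ∧ B u) := h.disjoint u
    have hv : ¬(A v ∧ B v) := h.disjoint v
    rw [← hcov] at hYu hYv
    revert hYu hYv hu hv
    cases A u <;> cases B u <;> cases A v <;> cases B v <;> cases Y u <;> cases Y v <;> decide
  have hbal : between O A A + between O B B ≤ 2 * between O A B := h.between_le
  have hcomm := between_comm hO A B
  omega

/-- `T` is a connected subgraph of `g`. -/
structure IsConnSubgraph (g : BGraph n) (T : Tree n) : Prop where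
  vert : ∀ v, T.vert v → g.vert v
  symm : IsSymm T.adj
  sub : ∀ u v, T.adj u v → g.adj u v
  mem : ∀ u v, T.adj u v → T.vert u
  conn : ConnOn T.adj T.vert

lemma IsSpanningTree.isConnSubgraph (hT : IsSpanningTree g T) (hg : WellFormed g) :
    IsConnSubgraph g T where
  vert _ hv := hT.vert ▸ hv
  symm := hT.symm
  sub := hT.sub
  mem _ _ h := hT.vert ▸ hT.mem hg h
  conn := hT.vert ▸ hT.conn

/- A property that spreads among the remaining vertices is extended to `L` as "some remaining
neighbour has it"; a vertex of `L` has only one neighbour. -/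
lemma connOn_diff_of_deg_le_one {M : Mat n} {X : VSet n} (hM : IsSymm M) (h : ConnOn M X)
    (hL : ∀ v, L v → deg M v ≤ 1) (hne : ∃ v, X v && !L v) : ConnOn M fun v => X v && !L v := by
  refine ⟨hne, fun P ⟨r, hr, hPr⟩ hP v hv => ?_⟩
  have key := h.2 (fun v => (L v = false → P v) ∧ (L v → ∃ y, (X y && !L y) ∧ P y ∧ M y v))
    ⟨r, by grind, by grind⟩ (fun u w hu hw ⟨hPu, hPu'⟩ huw => ?_) v (by grind)
  · exact key.1 (by grind)
  · by_cases hLu : L u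
    · obtain ⟨y, hy, hPy, hyu⟩ := hPu' hLu
      obtain rfl : w = y := Finset.card_le_one.1 (hL u hLu) w (by simpa using huw) y
        (by simpa using hM y u ▸ hyu)
      exact ⟨fun _ => hPy, by grind⟩
    · exact ⟨fun hLw => hP u w (by grind) (by grind) (hPu (by grind)) huw,
        fun _ => ⟨u, by grind, hPu (by grind), huw⟩⟩

/-- The number of `1`-edges at the leaves of `T`, counted at each leaf. -/
def thick (g : BGraph n) (T : Tree n) : ℕ := ∑ v, if leafSet T v then deg g.one v else 0

@[simp] lemma thickness_val (g : BGraph n) (T : Tree n) : (thickness g T).val = thick g T := by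
  simp [thickness, thick]

lemma treeCut_spec (hg : WellFormed g) (hT : IsConnSubgraph g T) :
    (∀ v, (treeCut g T).val v → g.vert v) ∧ ConnOn g.adj (treeCut g T).val ∧
      thick g T ≤ 4 * cutCard g.one (treeCut g T).val := by
  have hsplit := isBalancedSplit_splitLeaves hg (leafSet T)
  have hval : (treeCut g T).val = (chooseBest g
      [fun v => T.vert v && !(splitLeaves g (leafSet T)).val.1 v,
        fun v => T.vert v && !(splitLeaves g (leafSet T)).val.2 v]).val := by
    simp only [treeCut, bind_val, leaves_val, table_val, op_val]
  generalize (splitLeaves g (leafSet T)).val = P at hsplit hval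
  have hleaf : ∀ v, leafSet T v → T.vert v ∧ deg T.adj v ≤ 1 := fun v hv => by
    simpa [leafSet] using hv
  have hconn : ∀ A : VSet n, (∀ v, A v → leafSet T v) → (∃ v, T.vert v && !A v) →
      ConnOn g.adj fun v => T.vert v && !A v := fun A hA hne =>
    (connOn_diff_of_deg_le_one hT.symm hT.conn (fun v hv => (hleaf v (hA v hv)).2) hne).mono
      fun u v _ _ => hT.sub u v
  have hconn₁ := hconn P.1 fun v hv => by rw [← hsplit.cover, hv, Bool.true_or]
  have hconn₂ := hconn P.2 fun v hv => by rw [← hsplit.cover, hv, Bool.or_true]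
  have hex : ∃ X ∈ [fun v => T.vert v && !P.1 v, fun v => T.vert v && !P.2 v],
      ConnOn g.adj X := by
    obtain ⟨v, hv⟩ := hT.conn.1
    have hdisj := hsplit.disjoint v
    by_cases hPv : P.1 v
    · exact ⟨_, by simp, hconn₂ ⟨v, by grind⟩⟩
    · exact ⟨_, by simp, hconn₁ ⟨v, by grind⟩⟩
  obtain ⟨hmem, hbest, hmax⟩ := chooseBest_spec hg.symm hex
  rw [← hval] at hmem hbest hmax
  have hcut : ∀ X ∈ [fun v => T.vert v && !P.1 v, fun v => T.vert v && !P.2 v],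
      ((∃ v, X v) → ConnOn g.adj X) → cutCard g.one X ≤ cutCard g.one (treeCut g T).val := by
    intro X hX hXc
    by_cases hne : ∃ v, X v
    · exact hmax X hX (hXc hne)
    · exact (cutCard_empty _ hne).trans_le (Nat.zero_le _)
  refine ⟨fun v hv => hT.vert v ?_, hbest, ?_⟩
  · rcases List.mem_pair.1 hmem with h | h <;>
      exact (Bool.and_eq_true_iff.1 ((congrFun h v).symm.trans hv)).1
  · have hsum := hsplit.sum_deg_le hg.one_symm fun v hv => (hleaf v hv).1
    have hcut₁ := hcut _ (by simp) hconn₁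
    have hcut₂ := hcut _ (by simp) hconn₂
    unfold thick
    omega

end Split

/-! ### Lifting trees along a shrunk path -/

section Lift

variable {n : ℕ} {g : BGraph n} {p : Quad n} {T : Tree n} {u v : Fin n}

lemma WellFormed.mem_right (hg : WellFormed g) (h : g.adj u v) : g.vert v :=
  hg.mem v u (hg.symm u v ▸ h)

lemma IsConnSubgraph.mem_right (hT : IsConnSubgraph g T) (h : T.adj u v) : T.vert v :=
  hT.mem v u (hT.symm u v ▸ h)

lemma wellFormed_shrunk (hg : WellFormed g) (hp : Thin g p) : WellFormed (shrunk g p) where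
  symm := isSymm_shrunk_adj hg
  irrefl v := by
    rw [← Bool.not_eq_true, shrunk_adj_iff, hg.irrefl]
    grind [hp.ne₁₃]
  mem u v h := by
    have hne₁₂ := hg.ne hp.adj₁₂
    have hne₂₃ := hg.ne hp.adj₂₃
    simp only [shrunk, Bool.and_eq_true, decide_eq_true_eq]
    rcases shrunk_adj_iff.1 h with ⟨h, hu, -⟩ | ⟨rfl, rfl⟩ | ⟨rfl, rfl⟩
    · exact ⟨hg.mem u v h, hu⟩
    · exact ⟨hg.mem _ _ hp.adj₁₂, hne₁₂⟩
    · exact ⟨hg.mem_right hp.adj₂₃, hne₂₃.symm⟩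
  one_adj u v h := by
    have hne₁₂ := hg.ne hp.adj₁₂
    rw [shrunk_adj_iff]
    simp only [shrunk] at h
    split_ifs at h with h₀₁ h₁₃
    · left
      rcases samePair_iff.1 h₀₁ with ⟨rfl, rfl⟩ | ⟨rfl, rfl⟩
      · exact ⟨hp.adj₀₁, hp.ne₀₂, hne₁₂⟩
      · exact ⟨hg.symm _ _ ▸ hp.adj₀₁, hne₁₂, hp.ne₀₂⟩
    · exact Or.inr (samePair_iff.1 h₁₃)
    · simp only [Bool.and_eq_true, decide_eq_true_eq] at h
      exact Or.inl ⟨hg.one_adj _ _ h.1.1, h.1.2, h.2⟩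
  one_symm := isSymm_shrunk_one hg
  conn := by
    have hv₁ := hg.mem _ _ hp.adj₁₂
    have hv₂ := hg.mem _ _ hp.adj₂₃
    have hv₃ := hg.mem_right hp.adj₂₃
    have := hg.ne hp.adj₁₂
    have hshrunk : (shrunk g p).vert = pat g.vert p.v₁ p.v₂ true false := by
      funext v
      grind [pat_apply, shrunk]
    have hfull : g.vert = pat g.vert p.v₁ p.v₂ true (true && g.vert p.v₃) := by
      funext v
      grind [pat_apply]
    rw [hshrunk, connOn_shrunk_pat_iff hg hp, ← hfull]
    exact hg.conn

/-- The tree computed by `liftTree`. -/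
def lifted (p : Quad n) (T : Tree n) : Tree n where
  vert := fun v => T.vert v || (T.adj p.v₁ p.v₃ && decide (v = p.v₂))
  adj := fun u v => if T.adj p.v₁ p.v₃ then
      (T.adj u v && !samePair u v p.v₁ p.v₃) || samePair u v p.v₁ p.v₂ || samePair u v p.v₂ p.v₃
    else T.adj u v

lemma lifted_of_not_adj (h : ¬T.adj p.v₁ p.v₃) : lifted p T = T := by
  simp [lifted, h]

lemma lifted_vert_iff (h : T.adj p.v₁ p.v₃) : (lifted p T).vert v ↔ T.vert v ∨ v = p.v₂ := by
  simp [lifted, h]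

lemma lifted_adj_iff (h : T.adj p.v₁ p.v₃) : (lifted p T).adj u v ↔
    T.adj u v ∧ ¬(u = p.v₁ ∧ v = p.v₃ ∨ u = p.v₃ ∧ v = p.v₁) ∨
      (u = p.v₁ ∧ v = p.v₂ ∨ u = p.v₂ ∧ v = p.v₁) ∨
        (u = p.v₂ ∧ v = p.v₃ ∨ u = p.v₃ ∧ v = p.v₂) := by
  simp only [← samePair_iff]
  simp [lifted, h, or_assoc]

lemma isSymm_lifted_adj (hT : IsSymm T.adj) : IsSymm (lifted p T).adj := by
  intro u v
  simp only [lifted]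
  rw [hT u v, samePair_comm u v, samePair_comm u v, samePair_comm u v]

lemma IsConnSubgraph.not_vert_of_shrunk (hT : IsConnSubgraph (shrunk g p) T) : ¬T.vert p.v₂ :=
  fun h => by simpa [shrunk] using hT.vert _ h

lemma IsConnSubgraph.ne_of_shrunk (hT : IsConnSubgraph (shrunk g p) T) (h : T.adj u v) :
    u ≠ p.v₂ ∧ v ≠ p.v₂ :=
  ⟨fun hu => hT.not_vert_of_shrunk (hu ▸ hT.mem u v h),
    fun hv => hT.not_vert_of_shrunk (hv ▸ hT.mem_right h)⟩

lemma connOn_lifted (hg : WellFormed g) (hp : Thin g p) (hT : IsConnSubgraph (shrunk g p) T)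
    (h : T.adj p.v₁ p.v₃) : ConnOn (lifted p T).adj (lifted p T).vert := by
  have hpath := hp.isInnerPath hg
  have hv₁ := hT.mem _ _ h
  have hv₃ := hT.mem_right h
  have hv₂ := Bool.eq_false_of_not_eq_true hT.not_vert_of_shrunk
  have hvert : (lifted p T).vert = Function.update T.vert p.v₂ (T.vert p.v₁ && T.vert p.v₃) := by
    funext v
    rw [Bool.eq_iff_iff, lifted_vert_iff h]
    grind [Function.update_apply]
  rw [hvert, connOn_subdivide_iff (M' := T.adj) (isSymm_lifted_adj hT.symm) (fun u => ?_)
    (fun u v => ?_) hv₂]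
  · exact hT.conn
  · rw [lifted_adj_iff h]
    grind [hT.ne_of_shrunk (u := p.v₂) (v := u), hpath.ne₁₂, hpath.ne₂₃]
  · rw [lifted_adj_iff h]
    grind [hT.ne_of_shrunk (u := u) (v := v), hT.symm p.v₁ p.v₃]

lemma IsConnSubgraph.lifted (hg : WellFormed g) (hp : Thin g p)
    (hT : IsConnSubgraph (shrunk g p) T) : IsConnSubgraph g (lifted p T) := by
  have hvert : ∀ v, T.vert v → g.vert v := fun v hv => by
    have := hT.vert v hv
    simp only [shrunk, Bool.and_eq_true] at this
    exact this.1
  have hsub : ∀ u v, T.adj u v → ¬(u = p.v₁ ∧ v = p.v₃ ∨ u = p.v₃ ∧ v = p.v₁) → g.adj u v :=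
    fun u v huv hne => ((shrunk_adj_iff.1 (hT.sub u v huv)).resolve_right hne).1
  by_cases h : T.adj p.v₁ p.v₃
  · refine ⟨fun v hv => ?_, isSymm_lifted_adj hT.symm, fun u v huv => ?_, fun u v huv => ?_,
      connOn_lifted hg hp hT h⟩
    · rcases (lifted_vert_iff h).1 hv with hv | rfl
      exacts [hvert v hv, hg.mem _ _ hp.adj₂₃]
    · grind [(lifted_adj_iff h).1 huv, hsub u v, hp.adj₁₂, hp.adj₂₃, hg.symm u v]
    · grind [(lifted_adj_iff h).1 huv, hT.mem u v, hT.mem _ _ h, hT.mem_right h,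
        lifted_vert_iff h (v := u)]
  · rw [lifted_of_not_adj h]
    refine ⟨hvert, hT.symm, fun u v huv => hsub u v huv ?_, hT.mem, hT.conn⟩
    grind [hT.symm p.v₁ p.v₃]

lemma deg_lifted (hg : WellFormed g) (hp : Thin g p) (hT : IsConnSubgraph (shrunk g p) T)
    (h : T.adj p.v₁ p.v₃) (v : Fin n) :
    deg (CMC.lifted p T).adj v = if v = p.v₂ then 2 else deg T.adj v := by
  have hpath := hp.isInnerPath hg
  have hsymm := isSymm_lifted_adj (p := p) hT.symm
  have h₁₂ : (CMC.lifted p T).adj p.v₁ p.v₂ := (lifted_adj_iff h).2 (by simp)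
  have h₂₃ : eraseEdge (CMC.lifted p T).adj p.v₁ p.v₂ p.v₂ p.v₃ := by
    rw [eraseEdge_iff, lifted_adj_iff h]
    grind [hpath.ne₁₂, hpath.ne₁₃]
  have herase : eraseEdge (eraseEdge (CMC.lifted p T).adj p.v₁ p.v₂) p.v₂ p.v₃ =
      eraseEdge T.adj p.v₁ p.v₃ := by
    funext u v
    rw [Bool.eq_iff_iff, eraseEdge_iff, eraseEdge_iff, eraseEdge_iff, lifted_adj_iff h]
    grind [hT.ne_of_shrunk (u := u) (v := v)]
  have hdeg₁₂ := deg_eraseEdge hsymm h₁₂ hpath.ne₁₂ v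
  have hdeg₂₃ := deg_eraseEdge (hsymm.eraseEdge _ _) h₂₃ hpath.ne₂₃ v
  have hdeg₁₃ := deg_eraseEdge hT.symm h hp.ne₁₃ v
  rw [herase] at hdeg₂₃
  have hdeg₂ : deg T.adj p.v₂ = 0 :=
    deg_eq_zero_iff.2 fun u => Bool.eq_false_of_not_eq_true fun hu => (hT.ne_of_shrunk hu).1 rfl
  grind [hpath.ne₁₂, hpath.ne₂₃, hp.ne₁₃]

lemma leafSet_lifted (hg : WellFormed g) (hp : Thin g p) (hT : IsConnSubgraph (shrunk g p) T) :
    leafSet (lifted p T) = leafSet T := by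
  by_cases h : T.adj p.v₁ p.v₃
  · funext v
    rw [Bool.eq_iff_iff]
    simp only [leafSet, Bool.and_eq_true, decide_eq_true_eq, lifted_vert_iff h,
      deg_lifted hg hp hT h]
    grind [hT.not_vert_of_shrunk]
  · rw [lifted_of_not_adj h]

end Lift

/-! ### The trees of the peeling -/

section Peel

variable {n : ℕ} {g : BGraph n} {p : Quad n} {T : Tree n} {Ts : List (Tree n)} {L : VSet n}

/-- The graph computed by `deleteSet`. -/
def deleted (g : BGraph n) (L : VSet n) : BGraph n where
  vert := fun v => g.vert v && !L v
  adj := fun u v => g.adj u v && !L u && !L v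
  one := fun u v => g.one u v && !L u && !L v

lemma wellFormed_deleted (hg : WellFormed g) (h : ConnOn (deleted g L).adj (deleted g L).vert) :
    WellFormed (deleted g L) where
  symm u v := by simp only [deleted, hg.symm u v, Bool.and_right_comm]
  irrefl v := by simp [deleted, hg.irrefl]
  mem u v h := by
    simp only [deleted, Bool.and_eq_true] at h ⊢
    exact ⟨hg.mem u v h.1.1, h.1.2⟩
  one_adj u v h := by
    simp only [deleted, Bool.and_eq_true] at h ⊢
    exact ⟨⟨hg.one_adj u v h.1.1, h.1.2⟩, h.2⟩
  one_symm u v := by simp only [deleted, hg.one_symm u v, Bool.and_right_comm]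
  conn := h

lemma IsSpanningTree.connOn_deleted_leafSet (hT : IsSpanningTree g T)
    (hne : ∃ v, (deleted g (leafSet T)).vert v) :
    ConnOn (deleted g (leafSet T)).adj (deleted g (leafSet T)).vert := by
  refine (connOn_diff_of_deg_le_one (L := leafSet T) hT.symm hT.conn (fun v hv => ?_) hne).mono
    fun u v hu hv huv => ?_
  · simp only [leafSet, Bool.and_eq_true, decide_eq_true_eq] at hv
    exact hv.2
  · simp only [Bool.and_eq_true] at hu hv
    simp [deleted, hT.sub u v huv, hu.2, hv.2]

lemma IsSpanningTree.vcard_deleted_leafSet (hT : IsSpanningTree g T) :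
    vcard (deleted g (leafSet T)).vert + vcard (leafSet T) = vcard g.vert := by
  unfold vcard
  rw [← Finset.card_union_of_disjoint]
  · congr 1
    ext v
    have : leafSet T v → g.vert v := fun h => by
      rw [← hT.vert]
      exact (Bool.and_eq_true_iff.1 h).1
    grind [deleted]
  · rw [Finset.disjoint_filter]
    intro v _ hv hv'
    simp [deleted, hv'] at hv

/-- The vertices that are a leaf of none of the trees. -/
def uncovered (Ts : List (Tree n)) : VSet n := fun v => Ts.all fun T => !leafSet T v

/-- The number of pairs of adjacent vertices that are leaves of none of the trees. -/
def uncoveredPairs (g : BGraph n) (Ts : List (Tree n)) : ℕ :=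
  entrySum g.adj fun u v => (uncovered Ts u && uncovered Ts v).toNat

/-- The properties of the list of trees produced by `peel` on which the analysis rests: there are
at most logarithmically many trees, and few edges without an end among their leaves. -/
structure IsPeeling (g : BGraph n) (Ts : List (Tree n)) : Prop where
  isConnSubgraph : ∀ T ∈ Ts, IsConnSubgraph g T
  pow_length_le : (45 / 44 : ℝ) ^ Ts.length ≤ 45 / 44 * vcard g.vert
  uncoveredPairs_le : uncoveredPairs g Ts ≤ 4 * vcard fun v => g.vert v && uncovered Ts v

lemma uncovered_cons (T : Tree n) (Ts : List (Tree n)) (v : Fin n) :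
    uncovered (T :: Ts) v = (!leafSet T v && uncovered Ts v) :=
  rfl

lemma uncoveredPairs_cons_le :
    uncoveredPairs g (T :: Ts) ≤ uncoveredPairs (deleted g (leafSet T)) Ts := by
  refine entrySum_le_entrySum fun u v huv hne => ?_
  simp only [uncovered_cons, deleted, huv] at hne ⊢
  revert hne
  cases leafSet T u <;> cases leafSet T v <;> simp

lemma IsSpanningTree.isPeeling_singleton (hT : IsSpanningTree g T) (hg : WellFormed g)
    (h : ¬∃ v, (deleted g (leafSet T)).vert v) : IsPeeling g [T] where
  isConnSubgraph := by simpa using hT.isConnSubgraph hg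
  pow_length_le := by
    have hpos : 1 ≤ vcard g.vert := vcard_pos_iff.2 hg.conn.1
    have : (1 : ℝ) ≤ vcard g.vert := by exact_mod_cast hpos
    rw [List.length_singleton, pow_one]
    linarith
  uncoveredPairs_le := by
    have hzero : uncoveredPairs (deleted g (leafSet T)) [] = 0 := by
      unfold uncoveredPairs entrySum
      refine Finset.sum_eq_zero fun u _ => Finset.sum_eq_zero fun v _ =>
        if_neg fun huv => h ⟨u, ?_⟩
      simp only [deleted, Bool.and_eq_true] at huv ⊢
      exact ⟨hg.mem u v huv.1.1, huv.1.2⟩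
    exact uncoveredPairs_cons_le.trans (hzero.trans_le (Nat.zero_le _))

lemma IsPeeling.cons (h : IsPeeling (deleted g (leafSet T)) Ts) (hg : WellFormed g)
    (hT : IsSpanningTree g T) (hleaf : vcard g.vert ≤ 45 * vcard (leafSet T)) :
    IsPeeling g (T :: Ts) where
  isConnSubgraph T' hT' := by
    rcases List.mem_cons.1 hT' with rfl | hT'
    · exact hT.isConnSubgraph hg
    · have hT' := h.isConnSubgraph T' hT'
      refine ⟨fun v hv => ?_, hT'.symm, fun u v huv => ?_, hT'.mem, hT'.conn⟩
      · have := hT'.vert v hv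
        simp only [deleted, Bool.and_eq_true] at this
        exact this.1
      · have := hT'.sub u v huv
        simp only [deleted, Bool.and_eq_true] at this
        exact this.1.1
  pow_length_le := by
    have hcard := hT.vcard_deleted_leafSet
    have hshrink : (45 * vcard (deleted g (leafSet T)).vert : ℝ) ≤ 44 * vcard g.vert := by
      exact_mod_cast (by omega : 45 * vcard (deleted g (leafSet T)).vert ≤ 44 * vcard g.vert)
    calc (45 / 44 : ℝ) ^ (T :: Ts).length = 45 / 44 * (45 / 44) ^ Ts.length := pow_succ' _ _
      _ ≤ 45 / 44 * (45 / 44 * vcard (deleted g (leafSet T)).vert) :=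
        mul_le_mul_of_nonneg_left h.pow_length_le (by norm_num)
      _ ≤ 45 / 44 * vcard g.vert := mul_le_mul_of_nonneg_left (by linarith) (by norm_num)
  uncoveredPairs_le := by
    refine uncoveredPairs_cons_le.trans (h.uncoveredPairs_le.trans (Nat.mul_le_mul_left 4 ?_))
    refine Finset.card_le_card fun v => ?_
    simp [deleted, uncovered_cons, and_assoc]

lemma uncovered_map_lifted (hg : WellFormed g) (hp : Thin g p)
    (h : ∀ T ∈ Ts, IsConnSubgraph (shrunk g p) T) :
    uncovered (Ts.map (lifted p)) = uncovered Ts := by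
  funext v
  rw [Bool.eq_iff_iff]
  simp only [uncovered, List.all_map, List.all_eq_true, Function.comp]
  exact forall₂_congr fun T hT => by rw [leafSet_lifted hg hp (h T hT)]

lemma vcard_shrunk (hg : WellFormed g) (hp : Thin g p) :
    vcard (shrunk g p).vert + 1 = vcard g.vert :=
  vcard_erase_add_one (hg.mem _ _ hp.adj₂₃)

/- Only the two edges at the removed vertex are lost by shrinking, each of them counted twice. -/
lemma uncoveredPairs_le_shrunk_add_four (hg : WellFormed g) (hp : Thin g p) :
    uncoveredPairs g Ts ≤ uncoveredPairs (shrunk g p) Ts + 4 := by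
  set f : Fin n → Fin n → ℕ := fun u v => (uncovered Ts u && uncovered Ts v).toNat
  have hsplit : entrySum g.adj f ≤ entrySum g.adj fun u v =>
      (f u v * (decide (u ≠ p.v₂) && decide (v ≠ p.v₂)).toNat) +
        (decide (u = p.v₂)).toNat + (decide (v = p.v₂)).toNat := by
    refine entrySum_mono fun u v _ => ?_
    have hle : f u v ≤ 1 := Bool.toNat_le _
    by_cases hu : u = p.v₂ <;> by_cases hv : v = p.v₂ <;> simp [hu, hv] <;> grind
  have hrow : entrySum g.adj (fun u _ => (decide (u = p.v₂)).toNat) = 2 := by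
    rw [entrySum_row, Finset.sum_eq_single p.v₂ (fun u _ hu => by simp [hu]) (by simp)]
    simp [hp.deg₂]
  have hcol : entrySum g.adj (fun _ v => (decide (v = p.v₂)).toNat) = 2 :=
    (entrySum_transpose hg.symm fun u _ => (decide (u = p.v₂)).toNat).trans hrow
  have hrest : entrySum g.adj
      (fun u v => f u v * (decide (u ≠ p.v₂) && decide (v ≠ p.v₂)).toNat) ≤
        entrySum (shrunk g p).adj f := by
    refine entrySum_le_entrySum fun u v huv hne => ?_
    by_cases hu : u = p.v₂
    · simp [hu] at hne
    by_cases hv : v = p.v₂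
    · simp [hv] at hne
    exact ⟨shrunk_adj_iff.2 (Or.inl ⟨huv, hu, hv⟩), by simp [hu, hv]⟩
  rw [entrySum_add, entrySum_add, hrow, hcol] at hsplit
  change entrySum g.adj f ≤ entrySum (shrunk g p).adj f + 4
  omega

lemma IsPeeling.map_lifted (h : IsPeeling (shrunk g p) Ts) (hg : WellFormed g) (hp : Thin g p) :
    IsPeeling g (Ts.map (lifted p)) where
  isConnSubgraph T hT := by
    obtain ⟨T', hT', rfl⟩ := List.mem_map.1 hT
    exact (h.isConnSubgraph T' hT').lifted hg hp
  pow_length_le := by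
    rw [List.length_map, ← vcard_shrunk hg hp]
    refine h.pow_length_le.trans ?_
    push_cast
    linarith
  uncoveredPairs_le := by
    have hunc := uncovered_map_lifted hg hp h.isConnSubgraph
    have hv₂ : uncovered Ts p.v₂ := by
      simp only [uncovered, List.all_eq_true, Bool.not_eq_true']
      refine fun T hT => Bool.eq_false_of_not_eq_true fun hleaf => ?_
      exact (h.isConnSubgraph T hT).not_vert_of_shrunk (Bool.and_eq_true_iff.1 hleaf).1
    have hcard : (vcard fun v => (shrunk g p).vert v && uncovered Ts v) + 1 =
        vcard fun v => g.vert v && uncovered Ts v := by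
      rw [← vcard_erase_add_one (X := fun v => g.vert v && uncovered Ts v) (z := p.v₂)
        (by simp [hg.mem _ _ hp.adj₂₃, hv₂])]
      simp only [shrunk, Bool.and_right_comm]
    have hle := uncoveredPairs_le_shrunk_add_four (Ts := Ts) hg hp
    have hih := h.uncoveredPairs_le
    rw [uncoveredPairs, hunc]
    change uncoveredPairs g Ts ≤ _
    omega

lemma peel_val_of_empty (h : ¬∃ v, g.vert v) (k : ℕ) : (peel k g).val = [] := by
  cases k with
  | zero => rfl
  | succ k => simp only [peel, bind_val, anyT_val, op_val, decide_eq_true_eq, h, if_false]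

lemma peel_val_of_eq_some (hne : ∃ v, g.vert v) (h : (findThinPath g).val = some p) (k : ℕ) :
    (peel (k + 1) g).val = (peel k (shrunk g p)).val.map (lifted p) := by
  simp only [peel, bind_val, anyT_val, op_val, decide_eq_true_eq, hne, if_true, h, mapT_val]
  rfl

lemma peel_val_of_eq_none (hne : ∃ v, g.vert v) (h : (findThinPath g).val = none) (k : ℕ) :
    (peel (k + 1) g).val =
      (leafyTree g).val :: (peel k (deleted g (leafSet (leafyTree g).val))).val := by
  simp only [peel, bind_val, anyT_val, op_val, decide_eq_true_eq, hne, if_true, h, leaves_val]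
  rfl

lemma isPeeling_peel (k : ℕ) (hg : WellFormed g) (hk : vcard g.vert ≤ k) :
    IsPeeling g (peel k g).val := by
  induction k generalizing g with
  | zero => exact absurd (vcard_pos_iff.2 hg.conn.1) (by omega)
  | succ k ih =>
    have hne := hg.conn.1
    rcases hpath : (findThinPath g).val with _ | p
    · rw [peel_val_of_eq_none hne hpath]
      have hT := isSpanningTree_leafyTree hg
      have hleaf := card_le_card_leafSet hg (fun _ => not_thin_of_findThinPath_eq_none hpath) hT
        (isLocalOpt_leafyTree g)
      by_cases hne' : ∃ v, (deleted g (leafSet (leafyTree g).val)).vert v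
      · have hcard := hT.vcard_deleted_leafSet
        have hpos := vcard_pos_iff.2 hne
        exact (ih (wellFormed_deleted hg (hT.connOn_deleted_leafSet hne')) (by omega)).cons hg hT
          hleaf
      · rw [peel_val_of_empty hne']
        exact hT.isPeeling_singleton hg hne'
    · rw [peel_val_of_eq_some hne hpath]
      have hp := thin_of_findThinPath_eq_some hpath
      have hcard := vcard_shrunk hg hp
      exact (ih (wellFormed_shrunk hg hp) (by omega)).map_lifted hg hp

end Peel

/-! ### Cuts of reduced graphs -/

section NumOnes

variable {n : ℕ} {O : Mat n}

/-- The number of edges of the graph `O`. -/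
def numOnes (O : Mat n) : ℕ := ∑ u, ∑ v, if decide (u < v) && O u v then 1 else 0

lemma two_mul_numOnes (hO : IsSymm O) (hirr : ∀ v, O v v = false) :
    2 * numOnes O = entrySum O fun _ _ => 1 := by
  have hnum : numOnes O = entrySum O fun u v => (decide (u < v)).toNat := by
    refine Finset.sum_congr rfl fun u _ => Finset.sum_congr rfl fun v _ => ?_
    beta_reduce
    cases O u v <;> simp [Bool.toNat]
  rw [two_mul, hnum]
  nth_rewrite 2 [← entrySum_transpose hO]
  rw [← entrySum_add]
  refine le_antisymm (entrySum_mono fun u v huv => ?_) (entrySum_mono fun u v huv => ?_) <;>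
  · have hne : u ≠ v := by
      rintro rfl
      simp [hirr] at huv
    rcases lt_or_gt_of_ne hne with h | h <;> simp [h, not_lt.2 h.le]

lemma cutCard_le_numOnes (hO : IsSymm O) (hirr : ∀ v, O v v = false) (X : VSet n) :
    cutCard O X ≤ numOnes O := by
  refine Nat.le_of_mul_le_mul_left ?_ two_pos
  rw [two_mul_numOnes hO hirr, two_mul_cutCard hO]
  exact entrySum_mono fun u v _ => Bool.toNat_le _

end NumOnes

section Reduced

variable {n : ℕ} {g : BGraph n} {T : Tree n} {Ts : List (Tree n)}

lemma sum_deg_covered_le_sum_thick (g : BGraph n) (Ts : List (Tree n)) :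
    (∑ v, (!uncovered Ts v).toNat * deg g.one v) ≤ (Ts.map (thick g)).sum := by
  induction Ts with
  | nil => simp [uncovered]
  | cons T Ts ih =>
    rw [List.map_cons, List.sum_cons]
    refine le_trans ?_ (Nat.add_le_add_left ih _)
    rw [thick, ← Finset.sum_add_distrib]
    refine Finset.sum_le_sum fun v _ => ?_
    rw [uncovered_cons]
    cases leafSet T v <;> cases uncovered Ts v <;> simp

/- A `1`-edge with no end among the leaves is one of the few uncovered edges, and any other one is
counted at a leaf of some tree. -/
lemma IsPeeling.numOnes_le (h : IsPeeling g Ts) (hg : WellFormed g) :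
    numOnes g.one ≤ 2 * vcard g.vert + (Ts.map (thick g)).sum := by
  have huncovered : entrySum g.one (fun u v => (uncovered Ts u && uncovered Ts v).toNat) ≤
      4 * vcard g.vert := by
    refine (entrySum_le_entrySum fun u v huv _ => ⟨hg.one_adj u v huv, le_rfl⟩).trans
      (h.uncoveredPairs_le.trans (Nat.mul_le_mul_left 4 (Finset.card_le_card fun v => ?_)))
    simp only [Finset.mem_filter_univ, Bool.and_eq_true]
    exact fun hv => hv.1
  have hsplit : entrySum g.one (fun _ _ => 1) ≤ entrySum g.one fun u v =>
      (uncovered Ts u && uncovered Ts v).toNat + (!uncovered Ts u).toNat +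
        (!uncovered Ts v).toNat :=
    entrySum_mono fun u v _ => by cases uncovered Ts u <;> cases uncovered Ts v <;> decide
  rw [entrySum_add, entrySum_add,
    entrySum_transpose hg.one_symm fun u _ => (!uncovered Ts u).toNat,
    entrySum_row _ fun u => (!uncovered Ts u).toNat] at hsplit
  have hcovered := sum_deg_covered_le_sum_thick g Ts
  have hnum := two_mul_numOnes hg.one_symm hg.one_irrefl
  omega

lemma IsPeeling.length_le (h : IsPeeling g Ts) (hne : ∃ v, g.vert v) :
    (Ts.length : ℝ) ≤ 1 + 45 * Real.log (vcard g.vert) := by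
  have hN : (1 : ℝ) ≤ vcard g.vert := by exact_mod_cast vcard_pos_iff.2 hne
  have hbase : (1 / 45 : ℝ) ≤ Real.log (45 / 44) :=
    le_of_eq_of_le (by norm_num) (Real.one_sub_inv_le_log_of_pos (x := 45 / 44) (by norm_num))
  have hlog := Real.log_le_log (by positivity) h.pow_length_le
  rw [Real.log_pow, Real.log_mul (by norm_num) (by positivity)] at hlog
  by_contra! hlt
  have hlen : (0 : ℝ) ≤ Ts.length - 1 := by linarith [Real.log_nonneg hN]
  linarith [mul_le_mul_of_nonneg_left hbase hlen]

lemma two_le_vcard (hg : WellFormed g) (hone : ∀ v, g.vert v → deg g.one v ≠ 0) :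
    2 ≤ vcard g.vert := by
  obtain ⟨v, hv⟩ := hg.conn.1
  obtain ⟨u, hu⟩ := Finset.card_pos.1 (Nat.pos_of_ne_zero (hone v hv))
  have hvu := hg.one_adj v u (Finset.mem_filter_univ u |>.1 hu)
  rw [← Finset.card_pair (hg.ne hvu)]
  refine Finset.card_le_card fun w => ?_
  simp only [Finset.mem_insert, Finset.mem_singleton, Finset.mem_filter_univ]
  rintro (rfl | rfl)
  exacts [hv, hg.mem_right hvu]

lemma vcard_leafSet_le_thick (hone : ∀ v, g.vert v → deg g.one v ≠ 0)
    (hT : IsConnSubgraph g T) : vcard (leafSet T) ≤ thick g T := by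
  rw [vcard, thick, Finset.card_filter]
  refine Finset.sum_le_sum fun v _ => ?_
  split_ifs with hv
  · exact Nat.pos_of_ne_zero (hone v (hT.vert v (Bool.and_eq_true_iff.1 hv).1))
  · exact le_rfl

lemma natLog_two_le (N : ℕ) : (Nat.log 2 N : ℝ) ≤ 2 * Real.log N := by
  have hlog := Real.log_natCast_nonneg N
  refine (Real.natLog_le_logb N 2).trans ?_
  rw [Real.logb, div_le_iff₀ (by positivity)]
  push_cast
  nlinarith [Real.log_two_gt_d9]

lemma numOnes_le_of_le_mul_log (hg : WellFormed g) (hthin : ∀ p, ¬ Thin g p)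
    (hone : ∀ v, g.vert v → deg g.one v ≠ 0)
    (hfew : numOnes g.one ≤ 4 * vcard g.vert * Nat.log 2 (vcard g.vert)) :
    (numOnes g.one : ℝ) ≤ 1440 * Real.log (vcard g.vert) *
      cutCard g.one (treeCut g (leafyTree g).val).val := by
  have hT := isSpanningTree_leafyTree hg
  have hsub := hT.isConnSubgraph hg
  set N := vcard g.vert
  set κ := cutCard g.one (treeCut g (leafyTree g).val).val
  have hNκ : N ≤ 180 * κ := by
    have hleaf := card_le_card_leafSet hg hthin hT (isLocalOpt_leafyTree g)
    have hthick := vcard_leafSet_le_thick hone hsub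
    have hcut := (treeCut_spec hg hsub).2.2
    omega
  calc (numOnes g.one : ℝ) ≤ 4 * N * Nat.log 2 N := by exact_mod_cast hfew
    _ ≤ 4 * (180 * κ) * (2 * Real.log N) := by
      gcongr
      · exact_mod_cast hNκ
      · exact natLog_two_le N
    _ = 1440 * Real.log N * κ := by ring

lemma IsPeeling.numOnes_le_of_thick_le (h : IsPeeling g Ts) (hg : WellFormed g)
    (hmany : 4 * vcard g.vert ≤ numOnes g.one) {κ : ℕ} (hκ : ∀ T ∈ Ts, thick g T ≤ 4 * κ) :
    (numOnes g.one : ℝ) ≤ 8 * (1 + 45 * Real.log (vcard g.vert)) * κ := by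
  have hsum : (Ts.map (thick g)).sum ≤ Ts.length * (4 * κ) := by
    simpa using List.sum_le_card_nsmul (Ts.map (thick g)) (4 * κ) (by simpa using hκ)
  have hnum : numOnes g.one ≤ 8 * Ts.length * κ := by
    linarith [h.numOnes_le hg]
  calc (numOnes g.one : ℝ) ≤ 8 * Ts.length * κ := by exact_mod_cast hnum
    _ ≤ 8 * (1 + 45 * Real.log (vcard g.vert)) * κ := by
      gcongr
      exact h.length_le hg.conn.1

/-- `S` is a nonempty connected set of vertices of `g`, and its cut is a `C`-approximation of the
maximum one. -/
structure IsApproxCut (C : ℝ) (g : BGraph n) (S : VSet n) : Prop where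
  vert : ∀ v, S v → g.vert v
  conn : ConnOn g.adj S
  cut_le : ∀ X : VSet n, (∀ v, X v → g.vert v) → ConnOn g.adj X →
    (cutCard g.one X : ℝ) ≤ C * cutCard g.one S

lemma thickSolve_val (g : BGraph n) : (thickSolve g).val =
    if numOnes g.one ≤ 4 * vcard g.vert * Nat.log 2 (vcard g.vert) then
      (treeCut g (leafyTree g).val).val
    else (treeCut g (argmaxFrom (thick g) (leafyTree g).val (peel n g).val)).val := by
  have hN : (∑ v, if g.vert v then 1 else 0 : ℕ) = vcard g.vert := by simp [vcard]
  simp only [thickSolve, bind_val]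
  rw [apply_ite Timed.val]
  simp only [bind_val, foldT_val, thickness_val, op_val, sumT_val, logT, hN]
  rfl

lemma vcard_le (X : VSet n) : vcard X ≤ n :=
  (Finset.card_le_univ _).trans_eq (Fintype.card_fin n)

lemma isApproxCut_treeCut {C : ℝ} (hg : WellFormed g) (hT : IsConnSubgraph g T)
    (h : numOnes g.one ≤ C * cutCard g.one (treeCut g T).val) :
    IsApproxCut C g (treeCut g T).val where
  vert := (treeCut_spec hg hT).1
  conn := (treeCut_spec hg hT).2.1
  cut_le X _ _ := le_trans
    (Nat.cast_le.2 (cutCard_le_numOnes hg.one_symm hg.one_irrefl X)) h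

lemma isApproxCut_thickSolve (hg : WellFormed g) (hthin : ∀ p, ¬ Thin g p)
    (hone : ∀ v, g.vert v → deg g.one v ≠ 0) :
    IsApproxCut (1440 * (1 + Real.log n)) g (thickSolve g).val := by
  have hN := two_le_vcard hg hone
  have hlog : Real.log (vcard g.vert) ≤ Real.log n :=
    Real.log_le_log (by positivity) (Nat.cast_le.2 (vcard_le _))
  have hT₁ := (isSpanningTree_leafyTree hg).isConnSubgraph hg
  rw [thickSolve_val]
  split_ifs with hfew
  · refine isApproxCut_treeCut hg hT₁ ((numOnes_le_of_le_mul_log hg hthin hone hfew).trans ?_)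
    gcongr
    linarith
  · have hpeel := isPeeling_peel n hg (vcard_le _)
    have hT : ∀ T ∈ (leafyTree g).val :: (peel n g).val, IsConnSubgraph g T :=
      List.forall_mem_cons.2 ⟨hT₁, hpeel.isConnSubgraph⟩
    have hmax := hT _ (argmaxFrom_mem (thick g) _ _)
    have hmany : 4 * vcard g.vert ≤ numOnes g.one :=
      (Nat.le_mul_of_pos_right _ (Nat.log_pos one_lt_two hN)).trans (not_le.1 hfew).le
    refine isApproxCut_treeCut hg hmax ((hpeel.numOnes_le_of_thick_le hg hmany fun T hT =>
      (le_argmaxFrom (thick g) (List.mem_cons_of_mem _ hT)).trans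
        (treeCut_spec hg hmax).2.2).trans ?_)
    have hlog₀ := Real.log_natCast_nonneg n
    exact mul_le_mul_of_nonneg_right (by linarith) (Nat.cast_nonneg _)

end Reduced

/-! ### The algorithm for `{0,1}`-weights -/

section Bcmc

variable {n : ℕ} {g : BGraph n} {z : Fin n} {p : Quad n} {S X Y : VSet n} {C : ℝ}

lemma vert_and_deg_eq_zero_of_findZeroVertex_eq_some (h : (findZeroVertex g).val = some z) :
    g.vert z ∧ deg g.one z = 0 := by
  obtain ⟨v, hv⟩ := exists_of_firstT_val_eq_some h
  simp only [bind_val, degree_val, op_val, Option.ite_none_right_eq_some, Bool.and_eq_true,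
    decide_eq_true_eq, Option.some.injEq] at hv
  obtain ⟨hv, rfl⟩ := hv
  exact hv

lemma deg_ne_zero_of_findZeroVertex_eq_none (h : (findZeroVertex g).val = none) {v : Fin n}
    (hv : g.vert v) : deg g.one v ≠ 0 := by
  simpa [hv] using firstT_val_eq_none.1 h v

lemma cutCard_one_congr (hg : WellFormed g) (hz : deg g.one z = 0) (h : ∀ v, v ≠ z → X v = Y v) :
    cutCard g.one X = cutCard g.one Y :=
  cutCard_congr fun u v huv => ⟨h u (hg.ne_of_one hz huv).1, h v (hg.ne_of_one hz huv).2⟩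

/-- The set into which the `{0,1}`-algorithm turns a solution `S` of the graph from which `z` has
been eliminated. -/
def uneliminated (g : BGraph n) (z : Fin n) (S : VSet n) : VSet n :=
  if (isConn g.adj S).val then S else fun u => S u || decide (u = z)

lemma uneliminated_apply_of_ne {v : Fin n} (hv : v ≠ z) : uneliminated g z S v = S v := by
  rw [uneliminated]
  split_ifs <;> simp [hv]

lemma connOn_uneliminated (hg : WellFormed g) (h : ConnOn (eliminated g z).adj S) :
    ConnOn g.adj (uneliminated g z S) := by
  rw [uneliminated]
  split_ifs with hS
  · exact (isConn_val hg.symm S).1 hS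
  · exact connOn_insert_of_eliminated hg h (mt (isConn_val hg.symm S).2 hS)

lemma cutCard_eq_zero_of_forall_eq_false (h : ∀ v, X v = false) (O : Mat n) : cutCard O X = 0 := by
  simp [cutCard, h]

lemma IsApproxCut.uneliminated (h : IsApproxCut C (eliminated g z) S) (hg : WellFormed g)
    (hC : 0 ≤ C) (hzv : g.vert z) (hz : deg g.one z = 0) :
    IsApproxCut C g (uneliminated g z S) where
  vert v hv := by
    by_cases hvz : v = z
    · exact hvz ▸ hzv
    · rw [uneliminated_apply_of_ne hvz] at hv
      exact (Bool.and_eq_true_iff.1 (h.vert v hv)).1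
  conn := connOn_uneliminated hg h.conn
  cut_le X hX hXc := by
    rw [cutCard_one_congr hg hz fun v => uneliminated_apply_of_ne,
      cutCard_one_congr hg hz fun v hv => (by simp [hv] : X v = (X v && decide (v ≠ z)))]
    by_cases hne : ∃ v, X v ∧ v ≠ z
    · have hcut := h.cut_le _ (fun v hv => ?_) (connOn_eliminated hg hXc hne)
      · rwa [eliminated_one hg hz] at hcut
      · simp only [eliminated, Bool.and_eq_true] at hv ⊢
        exact ⟨hX v hv.1, hv.2⟩
    · have hfalse : ∀ v, (X v && decide (v ≠ z)) = false := fun v =>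
        Bool.eq_false_of_not_eq_true fun hv => hne ⟨v, by simpa using hv⟩
      rw [cutCard_eq_zero_of_forall_eq_false hfalse, Nat.cast_zero]
      positivity

lemma isApproxCut_singleton (hg : WellFormed g) (hC : 0 ≤ C) (hzv : g.vert z)
    (hz : deg g.one z = 0) (honly : ∀ v, g.vert v → v = z) :
    IsApproxCut C g fun v => decide (v = z) where
  vert v hv := by rwa [of_decide_eq_true hv]
  conn := connOn_singleton
  cut_le X hX _ := by
    rw [cutCard_one_congr hg hz (Y := fun _ => false) fun v hv =>
        Bool.eq_false_of_not_eq_true fun hXv => hv (honly v (hX v hXv)),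
      cutCard_eq_zero_of_forall_eq_false (fun _ => rfl), Nat.cast_zero]
    positivity

lemma recover_val (h : p.v₁ ≠ p.v₂) : (recover g p S).val = (chooseBest g
    [pat S p.v₁ p.v₂ false false, pat S p.v₁ p.v₂ true false, pat S p.v₁ p.v₂ false true,
      pat S p.v₁ p.v₂ true true]).val := by
  simp only [recover, bind_val, table_val, op_val]
  congr 2
  simp only [List.cons.injEq, and_true]
  refine ⟨?_, ?_, ?_, ?_⟩ <;> funext v <;> rw [pat_apply] <;> grind

lemma pat_self (Y : VSet n) (v₁ v₂ : Fin n) : pat Y v₁ v₂ (Y v₁) (Y v₂) = Y := by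
  funext v
  grind [pat_apply]

lemma recover_spec (hg : WellFormed g) (hp : Thin g p) (hS : ConnOn (shrunk g p).adj S)
    (hS₂ : S p.v₂ = false) :
    (∃ x₁ x₂, (recover g p S).val = pat S p.v₁ p.v₂ x₁ x₂) ∧ ConnOn g.adj (recover g p S).val ∧
      cutCard (shrunk g p).one S ≤ cutCard g.one (recover g p S).val := by
  have hpat := pat_self S p.v₁ p.v₂
  rw [hS₂] at hpat
  obtain ⟨x₁, x₂, hconn, hcut⟩ := exists_pat_of_shrunk hg hp (hpat.symm ▸ hS)
  rw [hpat] at hcut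
  rw [recover_val (hg.ne hp.adj₁₂)]
  set Xs := [pat S p.v₁ p.v₂ false false, pat S p.v₁ p.v₂ true false, pat S p.v₁ p.v₂ false true,
    pat S p.v₁ p.v₂ true true] with hXs
  have hmem : pat S p.v₁ p.v₂ x₁ x₂ ∈ Xs := by cases x₁ <;> cases x₂ <;> simp [hXs]
  obtain ⟨hbest, hbestConn, hmax⟩ := chooseBest_spec hg.symm ⟨_, hmem, hconn⟩
  refine ⟨?_, hbestConn, hcut.trans (hmax _ hmem hconn)⟩
  simp only [hXs, List.mem_cons, List.not_mem_nil, or_false] at hbest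
  rcases hbest with h | h | h | h <;> exact ⟨_, _, h⟩

lemma IsApproxCut.recover (h : IsApproxCut C (shrunk g p) S) (hg : WellFormed g) (hC : 0 ≤ C)
    (hp : Thin g p) : IsApproxCut C g (recover g p S).val := by
  have hvert : ∀ {Y : VSet n} {x₁ x₂}, (∀ v, Y v → g.vert v) →
      ∀ v, pat Y p.v₁ p.v₂ x₁ x₂ v → g.vert v := by
    intro Y x₁ x₂ hY v
    grind [pat_apply, hg.mem _ _ hp.adj₁₂, hg.mem _ _ hp.adj₂₃]
  have hSvert : ∀ v, S v → g.vert v ∧ v ≠ p.v₂ := fun v hv => by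
    simpa [shrunk] using h.vert v hv
  have hS₂ : S p.v₂ = false := Bool.eq_false_of_not_eq_true fun hv => (hSvert _ hv).2 rfl
  obtain ⟨⟨x₁, x₂, hpat⟩, hconn, hcut⟩ := recover_spec hg hp h.conn hS₂
  refine ⟨?_, hconn, fun X hX hXc => ?_⟩
  · rw [hpat]
    exact hvert fun v hv => (hSvert v hv).1
  · rw [← pat_self X p.v₁ p.v₂] at hXc ⊢
    obtain ⟨y, hy, hXcut⟩ := exists_shrunk_of_pat hg hp hXc
    have hyvert : ∀ v, pat X p.v₁ p.v₂ y false v → (shrunk g p).vert v := fun v hv => by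
      simp only [shrunk, Bool.and_eq_true, decide_eq_true_eq]
      exact ⟨hvert hX v hv, by rintro rfl; simp [pat_apply] at hv⟩
    calc (cutCard g.one (pat X p.v₁ p.v₂ (X p.v₁) (X p.v₂)) : ℝ)
        ≤ cutCard (shrunk g p).one (pat X p.v₁ p.v₂ y false) := by exact_mod_cast hXcut
      _ ≤ C * cutCard (shrunk g p).one S := h.cut_le _ hyvert hy
      _ ≤ C * cutCard g.one (CMC.recover g p S).val := by gcongr

lemma bcmc_val_of_findZeroVertex (h : (findZeroVertex g).val = some z) (k : ℕ) :
    (bcmc (k + 1) g).val = uneliminated g z (bcmc k (eliminated g z)).val := by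
  simp only [bcmc, bind_val, h]
  rw [apply_ite Timed.val]
  rfl

lemma bcmc_val_of_findThinPath (h : (findZeroVertex g).val = none)
    (hp : (findThinPath g).val = some p) (k : ℕ) :
    (bcmc (k + 1) g).val = (recover g p (bcmc k (shrunk g p)).val).val := by
  simp only [bcmc, bind_val, h, hp]
  rfl

lemma bcmc_val_of_reduced (h : (findZeroVertex g).val = none)
    (hp : (findThinPath g).val = none) (k : ℕ) :
    (bcmc (k + 1) g).val = (thickSolve g).val := by
  simp only [bcmc, bind_val, h, hp]

theorem isApproxCut_bcmc {k : ℕ} (hg : WellFormed g) (hk : vcard g.vert = k) :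
    IsApproxCut (1440 * (1 + Real.log n)) g (bcmc k g).val := by
  have hC : 0 ≤ 1440 * (1 + Real.log n) := by
    have := Real.log_natCast_nonneg n
    positivity
  induction k generalizing g with
  | zero => exact absurd (vcard_pos_iff.2 hg.conn.1) (by omega)
  | succ k ih =>
    rcases hzero : (findZeroVertex g).val with _ | z
    · rcases hpath : (findThinPath g).val with _ | p
      · rw [bcmc_val_of_reduced hzero hpath]
        exact isApproxCut_thickSolve hg (fun _ => not_thin_of_findThinPath_eq_none hpath)
          fun _ => deg_ne_zero_of_findZeroVertex_eq_none hzero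
      · have hp := thin_of_findThinPath_eq_some hpath
        have hcard := vcard_shrunk hg hp
        rw [bcmc_val_of_findThinPath hzero hpath]
        exact (ih (wellFormed_shrunk hg hp) (by omega)).recover hg hC hp
    · obtain ⟨hzv, hz⟩ := vert_and_deg_eq_zero_of_findZeroVertex_eq_some hzero
      have hcard : vcard (eliminated g z).vert + 1 = vcard g.vert := vcard_erase_add_one hzv
      rw [bcmc_val_of_findZeroVertex hzero]
      by_cases hne : ∃ v, g.vert v ∧ v ≠ z
      · exact (ih (wellFormed_eliminated hg hne) (by omega)).uneliminated hg hC hzv hz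
      · have honly : ∀ v, g.vert v → v = z := fun v hv => by_contra fun hvz => hne ⟨v, hv, hvz⟩
        obtain rfl : k = 0 := by
          by_contra hk₀
          obtain ⟨v, hv⟩ := vcard_pos_iff.1 (by omega : 0 < vcard (eliminated g z).vert)
          simp only [eliminated, Bool.and_eq_true, decide_eq_true_eq] at hv
          exact hne ⟨v, hv⟩
        have hval : uneliminated g z (bcmc 0 (eliminated g z)).val = fun v => decide (v = z) := by
          have hempty : (bcmc 0 (eliminated g z)).val = fun _ => false := rfl
          rw [uneliminated, hempty, if_neg (mt (isConn_val hg.symm _).1 not_connOn_empty)]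
          simp
        exact hval ▸ isApproxCut_singleton hg hC hzv hz honly

end Bcmc

/-! ### The algorithm for real weights -/

section CutW

variable {n : ℕ} {adj : Mat n} {wt : Fin n → Fin n → ℝ}

/-- The weight of the cut of `X` in the graph `adj` with weights `wt`: the form in which the
algorithm computes `cutWeight`. -/
noncomputable def cutW (adj : Mat n) (wt : Fin n → Fin n → ℝ) (X : VSet n) : ℝ :=
  ∑ u, ∑ v, if X u && !X v && adj u v then wt u v else 0

lemma cutSum_val (adj : Mat n) (wt : Fin n → Fin n → ℝ) (X : VSet n) :
    (cutSum adj wt X).val = cutW adj wt X := rfl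

lemma cutW_nonneg (hwt : ∀ u v, adj u v → 0 ≤ wt u v) (X : VSet n) : 0 ≤ cutW adj wt X := by
  refine Finset.sum_nonneg fun u _ => Finset.sum_nonneg fun v _ => ?_
  split_ifs with huv
  · exact hwt u v (Bool.and_eq_true_iff.1 huv).2
  · exact le_rfl

lemma cutW_nonpos (hwt : ∀ u v, adj u v → wt u v ≤ 0) (X : VSet n) : cutW adj wt X ≤ 0 := by
  refine Finset.sum_nonpos fun u _ => Finset.sum_nonpos fun v _ => ?_
  split_ifs with huv
  · exact hwt u v (Bool.and_eq_true_iff.1 huv).2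
  · exact le_rfl

lemma cutWeight_eq_cutW {G : SimpleGraph (Fin n)} (w : Sym2 (Fin n) → ℝ) {S : Set (Fin n)}
    {X : VSet n} (hadj : ∀ u v, adj u v ↔ G.Adj u v) (hX : ∀ v, X v ↔ v ∈ S) :
    cutWeight G w S = cutW adj (fun u v => w s(u, v)) X := by
  classical
  have hcond (u v : Fin n) :
      (X u && !X v && adj u v) = true ↔ (u ∈ S ∧ v ∉ S) ∧ G.Adj u v := by
    simp only [Bool.and_eq_true, Bool.not_eq_true', ← Bool.not_eq_true, hX, hadj]
  simp only [cutW, cutWeight, hcond]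
  rw [← Finset.sum_product', ← Finset.sum_filter]
  symm
  refine Finset.sum_nbij (fun q => s(q.1, q.2)) ?_ ?_ ?_ fun _ _ => rfl
  · rintro ⟨u, v⟩ huv
    obtain ⟨-, ⟨hu, hv⟩, huv⟩ := Finset.mem_filter.1 huv
    exact Set.mem_toFinset.2 ⟨huv, u, hu, v, hv, rfl⟩
  · rintro ⟨u, v⟩ huv ⟨u', v'⟩ huv' heq
    obtain ⟨-, ⟨hu, -⟩, -⟩ := Finset.mem_filter.1 huv
    obtain ⟨-, ⟨-, hv'⟩, -⟩ := Finset.mem_filter.1 huv'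
    rcases Sym2.eq_iff.1 heq with ⟨h₁, h₂⟩ | ⟨h₁, -⟩
    · exact Prod.ext h₁ h₂
    · exact absurd (h₁ ▸ hu) hv'
  · intro e he
    obtain ⟨he, u, hu, v, hv, rfl⟩ := Set.mem_toFinset.1 he
    exact ⟨(u, v), Finset.mem_filter.2 ⟨by simp, ⟨hu, hv⟩, he⟩, rfl⟩

lemma one_le_cutCard_singleton {O : Mat n} {u v : Fin n} (huv : O u v) (hne : u ≠ v) :
    1 ≤ cutCard O fun x => decide (x = u) :=
  calc 1 = if decide (u = u) && !decide (v = u) && O u v then 1 else 0 := by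
        simp [huv, hne.symm]
    _ ≤ ∑ v, if decide (u = u) && !decide (v = u) && O u v then 1 else 0 :=
        Finset.single_le_sum (f := fun v => if decide (u = u) && !decide (v = u) && O u v then 1
          else 0) (fun _ _ => Nat.zero_le _) (Finset.mem_univ v)
    _ ≤ cutCard O fun x => decide (x = u) :=
        Finset.single_le_sum (f := fun a => ∑ v, if decide (a = u) && !decide (v = u) && O a v
          then 1 else 0) (fun _ _ => Nat.zero_le _) (Finset.mem_univ u)

lemma numOnes_le_sq (O : Mat n) : numOnes O ≤ n ^ 2 :=
  calc numOnes O ≤ ∑ _u : Fin n, ∑ _v : Fin n, 1 := by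
        refine Finset.sum_le_sum fun u _ => Finset.sum_le_sum fun v _ => ?_
        split_ifs <;> simp
    _ = n ^ 2 := by simp [sq]

end CutW

section MaxWeight

variable {n : ℕ} {adj : Mat n} {wt : Fin n → Fin n → ℝ}

lemma maxT_val_nonneg (f : Fin n → Timed ℝ) : 0 ≤ (maxT f).val := by
  change 0 ≤ (List.finRange n).foldr (fun i a => max (f i).val a) 0
  induction List.finRange n with
  | nil => simp
  | cons i l ih => exact le_max_of_le_right ih

lemma le_maxT_val (f : Fin n → Timed ℝ) (i : Fin n) : (f i).val ≤ (maxT f).val := by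
  suffices h : ∀ l : List (Fin n), i ∈ l →
      (f i).val ≤ l.foldr (fun j a => max (f j).val a) 0 from h _ (List.mem_finRange i)
  intro l hi
  induction l with
  | nil => simp at hi
  | cons j l ih =>
    rcases List.mem_cons.1 hi with rfl | hi
    · exact le_max_left _ _
    · exact (ih hi).trans (le_max_right _ _)

lemma exists_eq_maxT_val {f : Fin n → Timed ℝ} (h : 0 < (maxT f).val) :
    ∃ i, (f i).val = (maxT f).val := by
  suffices hl : ∀ l : List (Fin n), 0 < l.foldr (fun i a => max (f i).val a) 0 →
      ∃ i, (f i).val = l.foldr (fun i a => max (f i).val a) 0 from hl _ h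
  intro l h
  induction l with
  | nil => simp at h
  | cons i l ih =>
    rw [List.foldr_cons] at h ⊢
    rcases max_choice (f i).val (l.foldr (fun i a => max (f i).val a) 0) with hmax | hmax
    · exact ⟨i, hmax.symm⟩
    · rw [hmax] at h ⊢
      exact ih h

/-- The weight `w_max` of the heaviest edge, as computed by the algorithm. -/
noncomputable def maxWeight (adj : Mat n) (wt : Fin n → Fin n → ℝ) : ℝ :=
  (maxT fun u => maxT fun v => op (if adj u v then wt u v else 0)).val

lemma maxWeight_nonneg (adj : Mat n) (wt : Fin n → Fin n → ℝ) : 0 ≤ maxWeight adj wt :=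
  maxT_val_nonneg _

lemma le_maxWeight {u v : Fin n} (huv : adj u v) : wt u v ≤ maxWeight adj wt :=
  calc wt u v = (op (if adj u v then wt u v else 0)).val := by rw [if_pos huv, op_val]
    _ ≤ (maxT fun v => op (if adj u v then wt u v else 0)).val :=
        le_maxT_val (fun v => op (if adj u v then wt u v else 0)) v
    _ ≤ maxWeight adj wt := 
        le_maxT_val (fun u => maxT fun v => op (if adj u v then wt u v else 0)) u

lemma exists_eq_maxWeight (h : 0 < maxWeight adj wt) :
    ∃ u v, adj u v ∧ wt u v = maxWeight adj wt := by
  obtain ⟨u, hu⟩ := exists_eq_maxT_val h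
  obtain ⟨v, hv⟩ := exists_eq_maxT_val (h.trans_eq hu.symm)
  rw [hu, op_val] at hv
  split_ifs at hv with huv
  · exact ⟨u, v, huv, hv⟩
  · exact absurd hv h.ne

end MaxWeight

section WeightClasses

variable {n : ℕ} {ε : ℝ} {adj : Mat n} {wt : Fin n → Fin n → ℝ} {X : VSet n} {u v : Fin n} {i : ℕ}

/-- The lower end `w_i` of the `i`-th weight class. It is `0` if the graph has no edges. -/
noncomputable def classWeight (ε : ℝ) (adj : Mat n) (wt : Fin n → Fin n → ℝ) (i : ℕ) : ℝ :=
  ε * maxWeight adj wt / numOnes adj * (1 + ε) ^ i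

open Classical in
/-- The graph with the weights `w_i'`: its `1`-edges are the edges of the `i`-th weight class. -/
noncomputable def classGraph (ε : ℝ) (adj : Mat n) (wt : Fin n → Fin n → ℝ) (i : ℕ) :
    BGraph n where
  vert := fun _ => true
  adj := adj
  one := fun u v => adj u v && decide (classWeight ε adj wt i ≤ wt u v) &&
    decide (wt u v < classWeight ε adj wt i * (1 + ε))

/-- The set `S_i` that the algorithm computes for the `i`-th weight class. -/
noncomputable def classSolution (ε : ℝ) (adj : Mat n) (wt : Fin n → Fin n → ℝ) (i : ℕ) : VSet n :=
  (classSolve ε adj wt (ε * maxWeight adj wt / numOnes adj) i).val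

/-- The index of the last weight class. -/
noncomputable def numClasses (ε : ℝ) (adj : Mat n) : ℕ := ⌊Real.logb (1 + ε) (numOnes adj / ε)⌋₊

/-- Nonnegative weights on the edges of a connected simple graph. -/
structure WellWeighted (adj : Mat n) (wt : Fin n → Fin n → ℝ) : Prop where
  symm : IsSymm adj
  irrefl : ∀ v, adj v v = false
  conn : ConnOn adj fun _ => true
  wt_symm : ∀ u v, wt u v = wt v u
  wt_nonneg : ∀ u v, adj u v → 0 ≤ wt u v

lemma classGraph_one_iff : (classGraph ε adj wt i).one u v ↔
    adj u v ∧ classWeight ε adj wt i ≤ wt u v ∧ wt u v < classWeight ε adj wt i * (1 + ε) := by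
  simp only [classGraph, Bool.and_eq_true, decide_eq_true_eq, and_assoc]

lemma wellFormed_classGraph (h : WellWeighted adj wt) (ε : ℝ) (i : ℕ) :
    WellFormed (classGraph ε adj wt i) where
  symm := h.symm
  irrefl := h.irrefl
  mem _ _ _ := rfl
  one_adj _ _ huv := (classGraph_one_iff.1 huv).1
  one_symm u v := by simp only [classGraph, h.symm u v, h.wt_symm u v]
  conn := h.conn

lemma isApproxCut_classSolution (h : WellWeighted adj wt) (ε : ℝ) (i : ℕ) :
    IsApproxCut (1440 * (1 + Real.log n)) (classGraph ε adj wt i) (classSolution ε adj wt i) :=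
  isApproxCut_bcmc (wellFormed_classGraph h ε i) (by simp [vcard, classGraph])

lemma wcmc_val : (wcmc ε adj wt).val = argmaxFrom (cutW adj wt) (classSolution ε adj wt 0)
    ((List.range (numClasses ε adj)).map fun i => classSolution ε adj wt (i + 1)) := by
  simp only [wcmc, bind_val, foldT_val, mapT_val, op_val, cutSum_val]
  rfl

lemma exists_wcmc_val_eq_classSolution (ε : ℝ) (adj : Mat n) (wt : Fin n → Fin n → ℝ) :
    ∃ i, (wcmc ε adj wt).val = classSolution ε adj wt i := by
  rw [wcmc_val]
  rcases List.mem_cons.1 (argmaxFrom_mem (cutW adj wt) _ _) with hzero | hmem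
  · exact ⟨0, hzero⟩
  · obtain ⟨i, -, hi⟩ := List.mem_map.1 hmem
    exact ⟨i + 1, hi.symm⟩

lemma cutW_classSolution_le (hi : i ≤ numClasses ε adj) :
    cutW adj wt (classSolution ε adj wt i) ≤ cutW adj wt (wcmc ε adj wt).val := by
  rw [wcmc_val]
  refine le_argmaxFrom _ ?_
  cases i with
  | zero => exact List.mem_cons_self
  | succ j => exact List.mem_cons_of_mem _ (List.mem_map.2 ⟨j, List.mem_range.2 hi, rfl⟩)

lemma WellWeighted.connOn_wcmc (h : WellWeighted adj wt) (ε : ℝ) :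
    ConnOn adj (wcmc ε adj wt).val := by
  obtain ⟨i, hi⟩ := exists_wcmc_val_eq_classSolution ε adj wt
  exact hi ▸ (isApproxCut_classSolution h ε i).conn

lemma classWeight_nonneg (hε : 0 ≤ ε) : 0 ≤ classWeight ε adj wt i := by
  have := maxWeight_nonneg adj wt
  unfold classWeight
  positivity

lemma classWeight_mul_cutCard_le_cutW (hwt : ∀ u v, adj u v → 0 ≤ wt u v) (X : VSet n) :
    classWeight ε adj wt i * cutCard (classGraph ε adj wt i).one X ≤ cutW adj wt X := by
  simp only [cutCard, cutW, Nat.cast_sum, Nat.cast_ite, Nat.cast_one, Nat.cast_zero,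
    Finset.mul_sum]
  refine Finset.sum_le_sum fun u _ => Finset.sum_le_sum fun v _ => ?_
  by_cases hX : X u && !X v
  · by_cases hone : (classGraph ε adj wt i).one u v
    · obtain ⟨huv, hle, -⟩ := classGraph_one_iff.1 hone
      simpa [hX, hone, huv] using hle
    · simp only [hX, hone, Bool.and_false, Bool.false_eq_true, if_false, mul_zero, Bool.true_and]
      split_ifs with huv
      · exact hwt u v huv
      · exact le_rfl
  · simp [hX]

lemma classWeight_mul_cutCard_le (h : WellWeighted adj wt) (hε : 0 ≤ ε)
    (hi : i ≤ numClasses ε adj) (hX : ConnOn adj X) :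
    classWeight ε adj wt i * cutCard (classGraph ε adj wt i).one X ≤
      1440 * (1 + Real.log n) * cutW adj wt (wcmc ε adj wt).val := by
  have hw : 0 ≤ classWeight ε adj wt i := classWeight_nonneg hε
  have : 0 ≤ Real.log n := Real.log_natCast_nonneg n
  calc classWeight ε adj wt i * cutCard (classGraph ε adj wt i).one X
      ≤ classWeight ε adj wt i * (1440 * (1 + Real.log n) *
          cutCard (classGraph ε adj wt i).one (classSolution ε adj wt i)) := by
        gcongr
        exact (isApproxCut_classSolution h ε i).cut_le X (fun _ _ => rfl) hX
    _ = 1440 * (1 + Real.log n) * (classWeight ε adj wt i *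
          cutCard (classGraph ε adj wt i).one (classSolution ε adj wt i)) := by ring
    _ ≤ 1440 * (1 + Real.log n) * cutW adj wt (wcmc ε adj wt).val := by
        gcongr
        exact (classWeight_mul_cutCard_le_cutW h.wt_nonneg _).trans (cutW_classSolution_le hi)

end WeightClasses

section Approximation

variable {n : ℕ} {ε : ℝ} {adj : Mat n} {wt : Fin n → Fin n → ℝ} {X : VSet n} {u v : Fin n}

lemma numOnes_pos (h : WellWeighted adj wt) (huv : adj u v) : 0 < numOnes adj := by
  have hne : u ≠ v := by
    rintro rfl
    simp [h.irrefl] at huv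
  exact (one_le_cutCard_singleton huv hne).trans (cutCard_le_numOnes h.symm h.irrefl _)

lemma classWeight_zero_mul_numOnes (hm : 0 < numOnes adj) :
    classWeight ε adj wt 0 * numOnes adj = ε * maxWeight adj wt := by
  have : (numOnes adj : ℝ) ≠ 0 := by exact_mod_cast hm.ne'
  rw [classWeight, pow_zero, mul_one, div_mul_cancel₀ _ this]

lemma exists_classGraph_one (h : WellWeighted adj wt) (hε : 0 < ε) (hmax : 0 < maxWeight adj wt)
    (huv : adj u v) (hw : classWeight ε adj wt 0 ≤ wt u v) :
    ∃ i ≤ numClasses ε adj, (classGraph ε adj wt i).one u v := by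
  have hm : (0 : ℝ) < numOnes adj := by exact_mod_cast numOnes_pos h huv
  have hbase := classWeight_zero_mul_numOnes (ε := ε) (wt := wt) (numOnes_pos h huv)
  have hpos : 0 < classWeight ε adj wt 0 := by
    unfold classWeight
    positivity
  have hsucc (i : ℕ) : classWeight ε adj wt i = classWeight ε adj wt 0 * (1 + ε) ^ i := by
    simp [classWeight]
  obtain ⟨i, hle, hlt⟩ := exists_nat_pow_near ((one_le_div hpos).2 hw) (by linarith : 1 < 1 + ε)
  rw [le_div_iff₀' hpos] at hle
  rw [div_lt_iff₀' hpos, pow_succ, ← mul_assoc] at hlt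
  refine ⟨i, Nat.le_floor ?_, classGraph_one_iff.2 ⟨huv, hsucc i ▸ hle, hsucc i ▸ hlt⟩⟩
  rw [Real.le_logb_iff_rpow_le (by linarith) (by positivity), Real.rpow_natCast, le_div_iff₀ hε]
  refine le_of_mul_le_mul_left ?_ hmax
  calc maxWeight adj wt * ((1 + ε) ^ i * ε)
      = classWeight ε adj wt 0 * (1 + ε) ^ i * numOnes adj := by
        linear_combination -(1 + ε) ^ i * hbase
    _ ≤ maxWeight adj wt * numOnes adj := by gcongr; exact hle.trans (le_maxWeight huv)

lemma maxWeight_le (h : WellWeighted adj wt) (hε : 0 < ε) (hε₁ : ε ≤ 1) :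
    maxWeight adj wt ≤
      (1 + ε) * (1440 * (1 + Real.log n) * cutW adj wt (wcmc ε adj wt).val) := by
  have : 0 ≤ Real.log n := Real.log_natCast_nonneg n
  rcases (maxWeight_nonneg adj wt).eq_or_lt with hmax | hmax
  · have := cutW_nonneg h.wt_nonneg (wcmc ε adj wt).val
    rw [← hmax]
    positivity
  obtain ⟨u, v, huv, hw⟩ := exists_eq_maxWeight hmax
  have hne : u ≠ v := by
    rintro rfl
    simp [h.irrefl] at huv
  have hm : (1 : ℝ) ≤ numOnes adj := by exact_mod_cast numOnes_pos h huv
  have hbase : classWeight ε adj wt 0 ≤ wt u v := by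
    rw [hw, classWeight, pow_zero, mul_one, div_le_iff₀ (by linarith)]
    nlinarith
  obtain ⟨i, hi, hone⟩ := exists_classGraph_one h hε hmax huv hbase
  have hcut : (1 : ℝ) ≤ cutCard (classGraph ε adj wt i).one fun x => decide (x = u) := by
    exact_mod_cast one_le_cutCard_singleton hone hne
  have hnonneg : 0 ≤ classWeight ε adj wt i := classWeight_nonneg hε.le
  calc maxWeight adj wt = wt u v := hw.symm
    _ ≤ (1 + ε) * classWeight ε adj wt i := by
        linarith [(classGraph_one_iff.1 hone).2.2]
    _ ≤ (1 + ε) * (classWeight ε adj wt i *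
          cutCard (classGraph ε adj wt i).one fun x => decide (x = u)) := by
        gcongr
        exact le_mul_of_one_le_right hnonneg hcut
    _ ≤ (1 + ε) * (1440 * (1 + Real.log n) * cutW adj wt (wcmc ε adj wt).val) := by
        refine mul_le_mul_of_nonneg_left ?_ (by linarith)
        exact classWeight_mul_cutCard_le h hε.le hi connOn_singleton

lemma weight_le_sum_classWeight (h : WellWeighted adj wt) (hε : 0 < ε)
    (hmax : 0 < maxWeight adj wt) (huv : adj u v) :
    wt u v ≤ (∑ i ∈ Finset.range (numClasses ε adj + 1), (1 + ε) * (classWeight ε adj wt i *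
      if (classGraph ε adj wt i).one u v then 1 else 0)) + classWeight ε adj wt 0 := by
  have hzero : 0 ≤ classWeight ε adj wt 0 := classWeight_nonneg hε.le
  have hterm (i : ℕ) : 0 ≤ (1 + ε) * (classWeight ε adj wt i *
      if (classGraph ε adj wt i).one u v then 1 else 0) := by
    have : 0 ≤ classWeight ε adj wt i := classWeight_nonneg hε.le
    split_ifs <;> positivity
  rcases le_or_gt (classWeight ε adj wt 0) (wt u v) with hw | hw
  · obtain ⟨i, hi, hone⟩ := exists_classGraph_one h hε hmax huv hw
    have hle := Finset.single_le_sum (fun i _ => hterm i)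
      (Finset.mem_range.2 (Nat.lt_succ_of_le hi))
    rw [if_pos hone, mul_one] at hle
    linarith [(classGraph_one_iff.1 hone).2.2]
  · linarith [Finset.sum_nonneg fun i (_ : i ∈ Finset.range (numClasses ε adj + 1)) => hterm i]

lemma cutW_le_sum_classes (h : WellWeighted adj wt) (hε : 0 < ε) (hmax : 0 < maxWeight adj wt)
    (X : VSet n) :
    cutW adj wt X ≤ (∑ i ∈ Finset.range (numClasses ε adj + 1), (1 + ε) * (classWeight ε adj wt i *
      cutCard (classGraph ε adj wt i).one X)) + ε * maxWeight adj wt := by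
  obtain ⟨u₀, v₀, huv₀, -⟩ := exists_eq_maxWeight hmax
  have hlight : classWeight ε adj wt 0 * cutCard adj X ≤ ε * maxWeight adj wt := by
    rw [← classWeight_zero_mul_numOnes (numOnes_pos h huv₀)]
    have : 0 ≤ classWeight ε adj wt 0 := classWeight_nonneg hε.le
    gcongr
    exact cutCard_le_numOnes h.symm h.irrefl X
  refine le_trans ?_ (add_le_add_right hlight _)
  simp only [cutCard, cutW, Nat.cast_sum, Nat.cast_ite, Nat.cast_one, Nat.cast_zero,
    Finset.mul_sum]
  rw [Finset.sum_comm (s := Finset.range (numClasses ε adj + 1)), ← Finset.sum_add_distrib]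
  refine Finset.sum_le_sum fun u _ => ?_
  rw [Finset.sum_comm (s := Finset.range (numClasses ε adj + 1)), ← Finset.sum_add_distrib]
  refine Finset.sum_le_sum fun v _ => ?_
  by_cases hX : X u && !X v
  · by_cases huv : adj u v
    · simpa [hX, huv] using weight_le_sum_classWeight h hε hmax huv
    · simp [hX, huv, classGraph]
  · simp [hX]

lemma numClasses_le (hε : 0 < ε) (hε₁ : ε ≤ 1) (hm : 0 < numOnes adj) :
    (numClasses ε adj : ℝ) ≤ (2 + Real.log (1 / ε)) / Real.log (1 + ε) * (1 + Real.log n) := by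
  have hm₁ : (1 : ℝ) ≤ numOnes adj := by exact_mod_cast hm
  have hlog : 0 < Real.log (1 + ε) := Real.log_pos (by linarith)
  have hinv : 0 ≤ Real.log (1 / ε) := Real.log_nonneg (by rwa [le_div_iff₀ hε, one_mul])
  have hn : 0 ≤ Real.log n := Real.log_natCast_nonneg n
  have hnonneg : 0 ≤ Real.logb (1 + ε) (numOnes adj / ε) :=
    Real.logb_nonneg (by linarith) (by rw [le_div_iff₀ hε]; linarith)
  have hlog_m : Real.log (numOnes adj) ≤ 2 * Real.log n := by
    have hle : (numOnes adj : ℝ) ≤ (n : ℝ) ^ 2 := by exact_mod_cast numOnes_le_sq adj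
    simpa using Real.log_le_log (by linarith) hle
  calc (numClasses ε adj : ℝ) ≤ Real.logb (1 + ε) (numOnes adj / ε) := Nat.floor_le hnonneg
    _ = (Real.log (numOnes adj) + Real.log (1 / ε)) / Real.log (1 + ε) := by
        rw [Real.logb, div_eq_mul_one_div (numOnes adj : ℝ),
          Real.log_mul (by linarith) (by positivity)]
    _ ≤ (2 + Real.log (1 / ε)) * (1 + Real.log n) / Real.log (1 + ε) := by
        gcongr
        nlinarith
    _ = _ := by ring

/-- The constant in the approximation factor, of which `(2 + log (1 / ε)) / log (1 + ε)` accounts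
for the number of weight classes. -/
noncomputable def lossFactor (ε : ℝ) : ℝ :=
  2880 * ((2 + Real.log (1 / ε)) / Real.log (1 + ε) + 2)

lemma lossFactor_pos (hε : 0 < ε) (hε₁ : ε ≤ 1) : 0 < lossFactor ε := by
  have hlog : 0 < Real.log (1 + ε) := Real.log_pos (by linarith)
  have hinv : 0 ≤ Real.log (1 / ε) := Real.log_nonneg (by rwa [le_div_iff₀ hε, one_mul])
  unfold lossFactor
  positivity

theorem cutW_le_lossFactor_mul (h : WellWeighted adj wt) (hε : 0 < ε) (hε₁ : ε ≤ 1)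
    (hX : ConnOn adj X) :
    cutW adj wt X ≤ lossFactor ε * (1 + Real.log n) ^ 2 * cutW adj wt (wcmc ε adj wt).val := by
  have hn : 0 ≤ Real.log n := Real.log_natCast_nonneg n
  have hβ : 0 ≤ cutW adj wt (wcmc ε adj wt).val := cutW_nonneg h.wt_nonneg _
  have hloss := (lossFactor_pos hε hε₁).le
  rcases (maxWeight_nonneg adj wt).eq_or_lt with hmax | hmax
  · exact (cutW_nonpos (fun u v huv => hmax ▸ le_maxWeight huv) X).trans (by positivity)
  obtain ⟨u, v, huv, -⟩ := exists_eq_maxWeight hmax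
  have hclasses := numClasses_le hε hε₁ (numOnes_pos h huv)
  set B := 1440 * (1 + Real.log n) * cutW adj wt (wcmc ε adj wt).val with hB
  have : 0 ≤ B := by positivity
  calc cutW adj wt X
      ≤ (∑ i ∈ Finset.range (numClasses ε adj + 1), (1 + ε) * (classWeight ε adj wt i *
          cutCard (classGraph ε adj wt i).one X)) + ε * maxWeight adj wt :=
        cutW_le_sum_classes h hε hmax X
    _ ≤ (∑ _i ∈ Finset.range (numClasses ε adj + 1), (1 + ε) * B) + ε * ((1 + ε) * B) := by
        gcongr with i hi
        · exact classWeight_mul_cutCard_le h hε.le (Nat.le_of_lt_succ (Finset.mem_range.1 hi)) hX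
        · exact maxWeight_le h hε hε₁
    _ = (numClasses ε adj + 1 + ε) * (1 + ε) * B := by
        rw [Finset.sum_const, Finset.card_range, nsmul_eq_mul]
        push_cast
        ring
    _ ≤ (numClasses ε adj + 1 + 1) * (1 + 1) * B := by gcongr
    _ ≤ ((2 + Real.log (1 / ε)) / Real.log (1 + ε) + 2) * (1 + Real.log n) * 2 * B := by
        gcongr ?_ * B
        nlinarith
    _ = _ := by
        rw [hB, lossFactor]
        ring

end Approximation

/-! ### Running times -/

namespace Timed

open Polynomial

variable {n : ℕ} {α β : Type} {p q r : ℕ[X]}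

@[simp] lemma op_time (a : α) : (op a).time = 1 := rfl

@[simp] lemma bind_time (x : Timed α) (f : α → Timed β) :
    (x >>= f).time = x.time + (f x.val).time := rfl

lemma op_time_le (a : α) : (op a).time ≤ (1 : ℕ[X]).eval n := by simp

lemma bind_time_le {x : Timed α} {f : α → Timed β} (hx : x.time ≤ p.eval n)
    (hf : (f x.val).time ≤ q.eval n) : (x >>= f).time ≤ (p + q).eval n := by
  rw [eval_add]
  exact Nat.add_le_add hx hf

lemma bind_option_time_le {x : Timed (Option α)} {f : Option α → Timed β}
    (hx : x.time ≤ p.eval n) (hnone : (f none).time ≤ q.eval n)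
    (hsome : ∀ a, (f (some a)).time ≤ r.eval n) : (x >>= f).time ≤ (p + (q + r)).eval n := by
  refine bind_time_le hx ?_
  rw [eval_add]
  cases x.val with
  | none => exact hnone.trans (Nat.le_add_right _ _)
  | some a => exact (hsome a).trans (Nat.le_add_left _ _)

lemma ite_time_le {c : Prop} [Decidable c] {x y : Timed α} (hx : x.time ≤ p.eval n)
    (hy : y.time ≤ q.eval n) : (if c then x else y).time ≤ (p + q).eval n := by
  rw [eval_add]
  split_ifs <;> omega

lemma loopTime_le {f : Fin n → Timed α} (hf : ∀ i, (f i).time ≤ p.eval n) :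
    loopTime f ≤ (X * (p + 1)).eval n := by
  simp only [eval_mul, eval_X, eval_add, eval_one]
  calc loopTime f ≤ ∑ _i : Fin n, (p.eval n + 1) :=
        Finset.sum_le_sum fun i _ => Nat.add_le_add_right (hf i) 1
    _ = n * (p.eval n + 1) := by simp

lemma table_time_le {f : Fin n → Timed α} (hf : ∀ i, (f i).time ≤ p.eval n) :
    (table f).time ≤ (X * (p + 1)).eval n :=
  loopTime_le hf

lemma table₂_time_le {f : Fin n → Fin n → Timed α} (hf : ∀ i j, (f i j).time ≤ p.eval n) :
    (table₂ f).time ≤ (X * (X * (p + 1) + 1)).eval n :=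
  loopTime_le fun i => loopTime_le (hf i)

lemma sumT_time_le [AddCommMonoid α] {f : Fin n → Timed α} (hf : ∀ i, (f i).time ≤ p.eval n) :
    (sumT f).time ≤ (X * (p + 1)).eval n :=
  loopTime_le hf

lemma firstT_time_le {f : Fin n → Timed (Option α)} (hf : ∀ i, (f i).time ≤ p.eval n) :
    (firstT f).time ≤ (X * (p + 1)).eval n :=
  loopTime_le hf

lemma foldT_time_le {f : β → α → Timed β} {b : β} {l : List α} (hl : l.length ≤ r.eval n)
    (hf : ∀ b, ∀ a ∈ l, (f b a).time ≤ p.eval n) :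
    (foldT f b l).time ≤ (r * (p + 1)).eval n := by
  rw [eval_mul, eval_add, eval_one]
  refine le_trans ?_ (Nat.mul_le_mul_right _ hl)
  clear hl
  induction l generalizing b with
  | nil => exact Nat.zero_le _
  | cons a l ih =>
    have hhead := hf b a List.mem_cons_self
    have htail := ih (b := (f b a).val) fun b c hc => hf b c (List.mem_cons_of_mem _ hc)
    rw [foldT, bind_time, bind_time, op_time, List.length_cons, add_one_mul]
    omega

lemma mapT_time_le {f : α → Timed β} {l : List α} (hl : l.length ≤ r.eval n)
    (hf : ∀ a ∈ l, (f a).time ≤ p.eval n) : (mapT f l).time ≤ (r * (p + 1)).eval n := by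
  rw [eval_mul, eval_add, eval_one]
  refine le_trans ?_ (Nat.mul_le_mul_right _ hl)
  clear hl
  induction l with
  | nil => exact Nat.zero_le _
  | cons a l ih =>
    have hhead := hf a List.mem_cons_self
    have htail := ih fun c hc => hf c (List.mem_cons_of_mem _ hc)
    rw [mapT, bind_time, bind_time, op_time, List.length_cons, add_one_mul]
    omega

lemma repeatT_time_le {f : α → Timed α} {k : ℕ} {a : α} (hk : k ≤ r.eval n)
    (hf : ∀ a, (f a).time ≤ p.eval n) : (repeatT f k a).time ≤ (r * (p + 1)).eval n := by
  rw [eval_mul, eval_add, eval_one]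
  refine le_trans ?_ (Nat.mul_le_mul_right _ hk)
  clear hk
  induction k generalizing a with
  | zero => exact Nat.zero_le _
  | succ k ih =>
    have hhead := hf a
    have htail := ih (a := (f a).val)
    rw [repeatT, bind_time, bind_time, op_time, add_one_mul]
    omega

lemma time_le_of_succ {F : ℕ → α → Timed β} (hzero : ∀ a, (F 0 a).time ≤ p.eval n)
    (hsucc : ∀ k < n, ∀ a, ∃ a', (F (k + 1) a).time ≤ (F k a').time + q.eval n) (a : α) :
    (F n a).time ≤ (X * q + p).eval n := by
  suffices h : ∀ k ≤ n, ∀ a, (F k a).time ≤ k * q.eval n + p.eval n by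
    simpa only [eval_add, eval_mul, eval_X] using h n le_rfl a
  intro k hk
  induction k with
  | zero => simpa using hzero
  | succ k ih =>
    intro a
    obtain ⟨a', ha'⟩ := hsucc k hk a
    have hrec := ih (Nat.le_of_succ_le hk) a'
    rw [add_one_mul]
    omega

lemma le_eval_X (n : ℕ) : n ≤ (X : ℕ[X]).eval n := by simp

lemma length_finRange_le (n : ℕ) : (List.finRange n).length ≤ (X : ℕ[X]).eval n := by simp

end Timed

section PolyTime

open Polynomial

lemma exists_emptySet_time_le : ∃ p : ℕ[X], ∀ n : ℕ, (emptySet : Timed (VSet n)).time ≤ p.eval n :=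
  ⟨_, fun _ => table_time_le fun _ => op_time_le _⟩

lemma exists_reach_time_le : ∃ p : ℕ[X], ∀ (n : ℕ) (M : Mat n) (Y : VSet n) (r : Fin n),
    (reach M Y r).time ≤ p.eval n :=
  ⟨_, fun n _ _ _ => bind_time_le (table_time_le fun _ => op_time_le _) <|
    repeatT_time_le (le_eval_X n) fun _ =>
    table_time_le fun _ => bind_time_le (loopTime_le fun _ => op_time_le _) (op_time_le _)⟩

lemma exists_isConn_time_le : ∃ p : ℕ[X], ∀ (n : ℕ) (M : Mat n) (Y : VSet n),
    (isConn M Y).time ≤ p.eval n := by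
  obtain ⟨p, hp⟩ := exists_reach_time_le
  exact ⟨_, fun n _ _ =>
    bind_option_time_le (firstT_time_le fun _ => op_time_le _) (op_time_le _) fun _ =>
      bind_time_le (hp n _ _ _) (loopTime_le fun _ => op_time_le _)⟩

lemma exists_degree_time_le : ∃ p : ℕ[X], ∀ (n : ℕ) (M : Mat n) (v : Fin n),
    (degree M v).time ≤ p.eval n :=
  ⟨_, fun _ _ _ => sumT_time_le fun _ => op_time_le _⟩

lemma exists_cutOnes_time_le : ∃ p : ℕ[X], ∀ (n : ℕ) (g : BGraph n) (Y : VSet n),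
    (cutOnes g Y).time ≤ p.eval n :=
  ⟨_, fun _ _ _ => sumT_time_le fun _ => sumT_time_le fun _ => op_time_le _⟩

lemma exists_chooseBest_time_le (k : ℕ) : ∃ p : ℕ[X], ∀ (n : ℕ) (g : BGraph n) (Ys : List (VSet n)),
    Ys.length = k → (chooseBest g Ys).time ≤ p.eval n := by
  obtain ⟨p, hp⟩ := exists_isConn_time_le
  obtain ⟨q, hq⟩ := exists_cutOnes_time_le
  obtain ⟨r, hr⟩ := exists_emptySet_time_le
  exact ⟨_, fun n g Ys hYs => bind_time_le (hr n) <|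
    foldT_time_le (r := C k) (by simp [hYs]) fun _ _ _ => bind_time_le (hp n _ _) <|
      bind_time_le (hp n _ _) <| bind_time_le (hq n _ _) <| bind_time_le (hq n _ _) (op_time_le _)⟩

lemma exists_findZeroVertex_time_le : ∃ p : ℕ[X], ∀ (n : ℕ) (g : BGraph n),
    (findZeroVertex g).time ≤ p.eval n := by
  obtain ⟨p, hp⟩ := exists_degree_time_le
  exact ⟨_, fun n g => firstT_time_le fun _ => bind_time_le (hp n _ _) (op_time_le _)⟩

lemma exists_eliminate_time_le : ∃ p : ℕ[X], ∀ (n : ℕ) (g : BGraph n) (z : Fin n),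
    (eliminate g z).time ≤ p.eval n :=
  ⟨_, fun _ _ _ => bind_time_le (table_time_le fun _ => op_time_le _) <|
    bind_time_le (table₂_time_le fun _ _ => op_time_le _) <|
    bind_time_le (table₂_time_le fun _ _ => op_time_le _) (op_time_le _)⟩

lemma exists_findThinPath_time_le : ∃ p : ℕ[X], ∀ (n : ℕ) (g : BGraph n),
    (findThinPath g).time ≤ p.eval n := by
  obtain ⟨p, hp⟩ := exists_degree_time_le
  exact ⟨_, fun n g => bind_time_le (table_time_le fun _ => hp n _ _) <|
    firstT_time_le fun _ => firstT_time_le fun _ =>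
    firstT_time_le fun _ => firstT_time_le fun _ => op_time_le _⟩

lemma exists_shrink_time_le : ∃ p : ℕ[X], ∀ (n : ℕ) (g : BGraph n) (z : Quad n),
    (shrink g z).time ≤ p.eval n :=
  ⟨_, fun _ _ _ => bind_time_le (op_time_le _) <|
    bind_time_le (table_time_le fun _ => op_time_le _) <|
    bind_time_le (table₂_time_le fun _ _ => op_time_le _) <|
    bind_time_le (table₂_time_le fun _ _ => op_time_le _) (op_time_le _)⟩

lemma exists_recover_time_le : ∃ p : ℕ[X], ∀ (n : ℕ) (g : BGraph n) (z : Quad n) (S : VSet n),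
    (recover g z S).time ≤ p.eval n := by
  obtain ⟨p, hp⟩ := exists_chooseBest_time_le 4
  exact ⟨_, fun n _ _ _ => bind_time_le (table_time_le fun _ => op_time_le _) <|
    bind_time_le (table_time_le fun _ => op_time_le _) <|
    bind_time_le (table_time_le fun _ => op_time_le _) <|
      bind_time_le (table_time_le fun _ => op_time_le _) (hp n _ _ rfl)⟩

lemma exists_liftTree_time_le : ∃ p : ℕ[X], ∀ (n : ℕ) (z : Quad n) (T : Tree n),
    (liftTree z T).time ≤ p.eval n :=
  ⟨_, fun _ _ _ => bind_time_le (table_time_le fun _ => op_time_le _) <|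
    bind_time_le (table₂_time_le fun _ _ => op_time_le _) (op_time_le _)⟩

lemma exists_spanningTree_time_le : ∃ p : ℕ[X], ∀ (n : ℕ) (g : BGraph n),
    (spanningTree g).time ≤ p.eval n := by
  obtain ⟨p, hp⟩ := exists_isConn_time_le
  exact ⟨_, fun n g => bind_time_le (table₂_time_le fun _ _ => op_time_le _) <|
    bind_time_le
      (foldT_time_le (length_finRange_le n) fun _ _ _ =>
        foldT_time_le (length_finRange_le n) fun _ _ _ =>
          ite_time_le
            (bind_time_le (table₂_time_le fun _ _ => op_time_le _) <|
              bind_time_le (hp n _ _) (op_time_le _))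
            (op_time_le _))
      (op_time_le _)⟩

lemma exists_countDeg2_time_le : ∃ p : ℕ[X], ∀ (n : ℕ) (M : Mat n),
    (countDeg2 M).time ≤ p.eval n := by
  obtain ⟨p, hp⟩ := exists_degree_time_le
  exact ⟨_, fun n _ => sumT_time_le fun _ => bind_time_le (hp n _ _) (op_time_le _)⟩

lemma exists_improve_time_le : ∃ p : ℕ[X], ∀ (n : ℕ) (g : BGraph n) (T : Tree n),
    (improve g T).time ≤ p.eval n := by
  obtain ⟨p, hp⟩ := exists_isConn_time_le
  obtain ⟨q, hq⟩ := exists_countDeg2_time_le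
  exact ⟨_, fun n g T => bind_time_le (hq n _) <|
    bind_option_time_le
      (firstT_time_le fun _ => firstT_time_le fun _ =>
        firstT_time_le fun _ => firstT_time_le fun _ =>
        ite_time_le
          (bind_time_le (table₂_time_le fun _ _ => op_time_le _) <|
            bind_time_le (hp n _ _) <| bind_time_le (hq n _) (op_time_le _))
          (op_time_le _))
      (op_time_le _) fun _ => op_time_le _⟩

lemma exists_leafyTree_time_le : ∃ p : ℕ[X], ∀ (n : ℕ) (g : BGraph n),
    (leafyTree g).time ≤ p.eval n := by
  obtain ⟨p, hp⟩ := exists_spanningTree_time_le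
  obtain ⟨q, hq⟩ := exists_improve_time_le
  exact ⟨_, fun n g => bind_time_le (hp n g) <| repeatT_time_le (le_eval_X n) (hq n g)⟩

lemma exists_leaves_time_le : ∃ p : ℕ[X], ∀ (n : ℕ) (T : Tree n), (leaves T).time ≤ p.eval n := by
  obtain ⟨p, hp⟩ := exists_degree_time_le
  exact ⟨_, fun n _ => table_time_le fun _ => bind_time_le (hp n _ _) (op_time_le _)⟩

lemma exists_deleteSet_time_le : ∃ p : ℕ[X], ∀ (n : ℕ) (g : BGraph n) (L : VSet n),
    (deleteSet g L).time ≤ p.eval n :=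
  ⟨_, fun _ _ _ => bind_time_le (table_time_le fun _ => op_time_le _) <|
    bind_time_le (table₂_time_le fun _ _ => op_time_le _) <|
    bind_time_le (table₂_time_le fun _ _ => op_time_le _) (op_time_le _)⟩

lemma length_peel_val_le {n : ℕ} (k : ℕ) (g : BGraph n) : (peel k g).val.length ≤ k := by
  induction k generalizing g with
  | zero => rfl
  | succ k ih =>
    by_cases hne : ∃ v, g.vert v
    · rcases hpath : (findThinPath g).val with _ | z
      · rw [peel_val_of_eq_none hne hpath, List.length_cons]
        exact Nat.succ_le_succ (ih _)
      · rw [peel_val_of_eq_some hne hpath, List.length_map]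
        exact (ih _).trans (Nat.le_succ k)
    · rw [peel_val_of_empty hne]
      exact Nat.zero_le _

lemma exists_peel_succ_time_le : ∃ p : ℕ[X], ∀ (n k : ℕ) (g : BGraph n), k < n →
    ∃ g' : BGraph n, (peel (k + 1) g).time ≤ (peel k g').time + p.eval n := by
  obtain ⟨a, ha⟩ := exists_findThinPath_time_le
  obtain ⟨b, hb⟩ := exists_shrink_time_le
  obtain ⟨c, hc⟩ := exists_liftTree_time_le
  obtain ⟨d, hd⟩ := exists_leafyTree_time_le
  obtain ⟨e, he⟩ := exists_leaves_time_le
  obtain ⟨f, hf⟩ := exists_deleteSet_time_le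
  refine ⟨X * (1 + 1) + a + b + X * (c + 1) + d + e + f + 1, fun n k g hk => ?_⟩
  have hany : (anyT fun v => op (g.vert v)).time ≤ (X * (1 + 1) : ℕ[X]).eval n :=
    loopTime_le fun _ => op_time_le _
  have hfind := ha n g
  by_cases hne : (anyT fun v => op (g.vert v)).val
  · rcases hpath : (findThinPath g).val with _ | z
    · have hleafy := hd n g
      have hleaves := he n (leafyTree g).val
      have hdelete := hf n g (leaves (leafyTree g).val).val
      refine ⟨(deleteSet g (leaves (leafyTree g).val).val).val, ?_⟩
      simp only [peel, bind_time, hne, if_true, hpath, op_time, eval_add, eval_one]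
      omega
    · have hshrink := hb n g z
      have hmap : (mapT (liftTree z) (peel k (shrink g z).val).val).time ≤
          (X * (c + 1) : ℕ[X]).eval n :=
        mapT_time_le (((length_peel_val_le k _).trans hk.le).trans (le_eval_X n))
          fun T _ => hc n z T
      refine ⟨(shrink g z).val, ?_⟩
      simp only [peel, bind_time, hne, if_true, hpath, eval_add, eval_one]
      omega
  · refine ⟨g, ?_⟩
    simp only [peel, bind_time, hne, Bool.false_eq_true, if_false, op_time, eval_add, eval_one]
    omega

lemma exists_peel_time_le : ∃ p : ℕ[X], ∀ (n : ℕ) (g : BGraph n), (peel n g).time ≤ p.eval n := by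
  obtain ⟨p, hp⟩ := exists_peel_succ_time_le
  exact ⟨_, fun n g => time_le_of_succ (F := peel) (p := 0) (fun _ => Nat.zero_le _)
    (fun k hk g => hp n k g hk) g⟩

lemma exists_splitLeaves_time_le : ∃ p : ℕ[X], ∀ (n : ℕ) (g : BGraph n) (L : VSet n),
    (splitLeaves g L).time ≤ p.eval n := by
  obtain ⟨p, hp⟩ := exists_emptySet_time_le
  exact ⟨_, fun n g L => bind_time_le (hp n) <| bind_time_le (hp n) <|
    foldT_time_le (length_finRange_le n) fun _ _ _ =>
      ite_time_le
        (bind_time_le (sumT_time_le fun _ => op_time_le _) <|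
          bind_time_le (sumT_time_le fun _ => op_time_le _) <|
          ite_time_le (bind_time_le (table_time_le fun _ => op_time_le _) (op_time_le _))
            (bind_time_le (table_time_le fun _ => op_time_le _) (op_time_le _)))
        (op_time_le _)⟩

lemma exists_treeCut_time_le : ∃ p : ℕ[X], ∀ (n : ℕ) (g : BGraph n) (T : Tree n),
    (treeCut g T).time ≤ p.eval n := by
  obtain ⟨p, hp⟩ := exists_leaves_time_le
  obtain ⟨q, hq⟩ := exists_splitLeaves_time_le
  obtain ⟨r, hr⟩ := exists_chooseBest_time_le 2
  exact ⟨_, fun n g T => bind_time_le (hp n T) <| bind_time_le (hq n g _) <|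
    bind_time_le (table_time_le fun _ => op_time_le _) <|
    bind_time_le (table_time_le fun _ => op_time_le _) (hr n g _ rfl)⟩

lemma exists_thickness_time_le : ∃ p : ℕ[X], ∀ (n : ℕ) (g : BGraph n) (T : Tree n),
    (thickness g T).time ≤ p.eval n := by
  obtain ⟨p, hp⟩ := exists_leaves_time_le
  obtain ⟨q, hq⟩ := exists_degree_time_le
  exact ⟨_, fun n g T => bind_time_le (hp n T) <|
    sumT_time_le fun _ => bind_time_le (hq n _ _) (op_time_le _)⟩

lemma exists_thickSolve_time_le : ∃ p : ℕ[X], ∀ (n : ℕ) (g : BGraph n),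
    (thickSolve g).time ≤ p.eval n := by
  obtain ⟨p, hp⟩ := exists_leafyTree_time_le
  obtain ⟨q, hq⟩ := exists_treeCut_time_le
  obtain ⟨r, hr⟩ := exists_peel_time_le
  obtain ⟨s, hs⟩ := exists_thickness_time_le
  have hlog : ∀ (n : ℕ) (g : BGraph n),
      (logT (sumT fun v => op (if g.vert v then 1 else 0 : ℕ)).val).time ≤
        (X + 1 : ℕ[X]).eval n := by
    intro n g
    have hcard : (sumT fun v => op (if g.vert v then 1 else 0 : ℕ)).val = vcard g.vert := by
      simp [vcard]
    rw [hcard]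
    simp only [logT, eval_add, eval_X, eval_one]
    exact Nat.add_le_add_right ((Nat.log_le_self 2 _).trans (vcard_le _)) 1
  exact ⟨_, fun n g => bind_time_le (sumT_time_le fun _ => op_time_le _) <|
    bind_time_le (sumT_time_le fun _ => sumT_time_le fun _ => op_time_le _) <|
    bind_time_le (hlog n g) <|
      bind_time_le (hp n g) <| ite_time_le (hq n g _) <| bind_time_le (hr n g) <|
        bind_time_le (foldT_time_le ((length_peel_val_le n g).trans (le_eval_X n)) fun _ _ _ =>
          bind_time_le (hs n g _) <| bind_time_le (hs n g _) (op_time_le _)) (hq n g _)⟩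

lemma exists_bcmc_succ_time_le : ∃ p : ℕ[X], ∀ (n k : ℕ) (g : BGraph n),
    ∃ g' : BGraph n, (bcmc (k + 1) g).time ≤ (bcmc k g').time + p.eval n := by
  obtain ⟨a, ha⟩ := exists_findZeroVertex_time_le
  obtain ⟨b, hb⟩ := exists_findThinPath_time_le
  obtain ⟨c, hc⟩ := exists_thickSolve_time_le
  obtain ⟨d, hd⟩ := exists_shrink_time_le
  obtain ⟨e, he⟩ := exists_recover_time_le
  obtain ⟨f, hf⟩ := exists_eliminate_time_le
  obtain ⟨h, hh⟩ := exists_isConn_time_le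
  refine ⟨a + b + c + d + e + f + h + (1 + X * (1 + 1)), fun n k g => ?_⟩
  have hzero := ha n g
  have hthin := hb n g
  have hthick := hc n g
  rcases hz : (findZeroVertex g).val with _ | z
  · rcases hpath : (findThinPath g).val with _ | q
    · refine ⟨g, ?_⟩
      simp only [bcmc, bind_time, hz, hpath, eval_add]
      omega
    · have hshrink := hd n g q
      have hrecover := he n g q (bcmc k (shrink g q).val).val
      refine ⟨(shrink g q).val, ?_⟩
      simp only [bcmc, bind_time, hz, hpath, eval_add]
      omega
  · set g' := (eliminate g z).val with hg'
    have heliminate := hf n g z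
    have hconn := hh n g.adj (bcmc k g').val
    have hundo : (if (isConn g.adj (bcmc k g').val).val then op (bcmc k g').val
        else table fun u => op ((bcmc k g').val u || decide (u = z))).time ≤
        (1 + X * (1 + 1) : ℕ[X]).eval n :=
      ite_time_le (op_time_le _) (table_time_le fun _ => op_time_le _)
    refine ⟨g', ?_⟩
    rw [eval_add]
    simp only [bcmc, bind_time, hz, ← hg', eval_add] at hundo ⊢
    omega

lemma exists_bcmc_time_le : ∃ p : ℕ[X], ∀ (n : ℕ) (g : BGraph n), (bcmc n g).time ≤ p.eval n := by
  obtain ⟨p, hp⟩ := exists_emptySet_time_le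
  obtain ⟨q, hq⟩ := exists_bcmc_succ_time_le
  exact ⟨_, fun n g => time_le_of_succ (F := bcmc) (fun _ => hp n) (fun k _ g => hq n k g) g⟩

lemma exists_classSolve_time_le (r : ℕ[X]) : ∃ p : ℕ[X], ∀ (n : ℕ) (ε : ℝ) (adj : Mat n)
    (wt : Fin n → Fin n → ℝ) (w₀ : ℝ) (i : ℕ), i ≤ r.eval n →
      (classSolve ε adj wt w₀ i).time ≤ p.eval n := by
  obtain ⟨p, hp⟩ := exists_bcmc_time_le
  have hpow : ∀ (n : ℕ) (x : ℝ) (i : ℕ), i ≤ r.eval n → (powT x i).time ≤ (r + 1).eval n := by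
    intro n x i hi
    simp only [powT, eval_add, eval_one]
    omega
  exact ⟨_, fun n ε adj wt w₀ i hi => bind_time_le (hpow n _ i hi) <| bind_time_le (op_time_le _) <|
    bind_time_le (op_time_le _) <| bind_time_le (table_time_le fun _ => op_time_le _) <|
      bind_time_le (table₂_time_le fun _ _ => op_time_le _) (hp n _)⟩

lemma exists_cutSum_time_le : ∃ p : ℕ[X], ∀ (n : ℕ) (adj : Mat n)
    (wt : Fin n → Fin n → ℝ) (Y : VSet n), (cutSum adj wt Y).time ≤ p.eval n :=
  ⟨_, fun _ _ _ _ => sumT_time_le fun _ => sumT_time_le fun _ => op_time_le _⟩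

lemma numClasses_le_eval {ε : ℝ} (hε : 0 < ε) : ∃ r : ℕ[X], ∀ (n : ℕ) (adj : Mat n),
    numClasses ε adj ≤ r.eval n := by
  have hL : 0 < Real.log (1 + ε) := Real.log_pos (by linarith)
  refine ⟨C ⌈1 / (ε * Real.log (1 + ε))⌉₊ * X ^ 2, fun n adj => ?_⟩
  simp only [eval_mul, eval_C, eval_pow, eval_X]
  refine Nat.floor_le_of_le ?_
  have hceil := Nat.le_ceil (1 / (ε * Real.log (1 + ε)))
  have hones : (numOnes adj : ℝ) ≤ (n : ℝ) ^ 2 := by exact_mod_cast numOnes_le_sq adj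
  push_cast
  calc Real.logb (1 + ε) (numOnes adj / ε)
      ≤ (numOnes adj / ε) / Real.log (1 + ε) :=
        div_le_div_of_nonneg_right (Real.log_le_self (by positivity)) hL.le
    _ = 1 / (ε * Real.log (1 + ε)) * numOnes adj := by field_simp
    _ ≤ ⌈1 / (ε * Real.log (1 + ε))⌉₊ * (n : ℝ) ^ 2 := by gcongr

lemma exists_wcmc_time_le {ε : ℝ} (hε : 0 < ε) : ∃ p : ℕ[X], ∀ (n : ℕ) (adj : Mat n)
    (wt : Fin n → Fin n → ℝ), (wcmc ε adj wt).time ≤ p.eval n := by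
  obtain ⟨r, hr⟩ := numClasses_le_eval hε
  obtain ⟨p, hp⟩ := exists_classSolve_time_le r
  obtain ⟨q, hq⟩ := exists_cutSum_time_le
  have hfloor : ∀ (n : ℕ) (adj : Mat n), (floorLogT (1 + ε) (numOnes adj / ε)).time ≤
      (r + 1).eval n := by
    intro n adj
    have := hr n adj
    rw [eval_add, eval_one]
    exact Nat.add_le_add_right this 1
  exact ⟨_, fun n adj wt =>
    bind_time_le (sumT_time_le fun _ => sumT_time_le fun _ => op_time_le _) <|
    bind_time_le (loopTime_le fun _ => loopTime_le fun _ => op_time_le _) <|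
    bind_time_le (op_time_le _) <|
    bind_time_le (hfloor n adj) <|
    bind_time_le (hp n ε adj wt _ 0 (Nat.zero_le _)) <|
    bind_time_le (mapT_time_le (r := r) (by rw [List.length_range]; exact hr n adj) fun j hj =>
      hp n ε adj wt _ (j + 1) ((Nat.succ_le_of_lt (List.mem_range.1 hj)).trans (hr n adj))) <|
    foldT_time_le (r := r)
      (by rw [mapT_val, List.length_map, List.length_range]; exact hr n adj) fun _ _ _ =>
        bind_time_le (hq n adj wt _) <| bind_time_le (hq n adj wt _) (op_time_le _)⟩

end PolyTime

/-! ### The approximation guarantee for graphs -/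

section Graph

variable {n : ℕ} {G : SimpleGraph (Fin n)} {w : Sym2 (Fin n) → ℝ} {ε : ℝ} {T : Set (Fin n)}

lemma wellWeighted_of_connected [DecidableRel G.Adj] (hG : G.Connected)
    (hw : ∀ e ∈ G.edgeSet, 0 ≤ w e) :
    WellWeighted (fun u v => decide (G.Adj u v)) fun u v => w s(u, v) where
  symm u v := by simp only [G.adj_comm]
  irrefl v := by simp
  conn := (connOn_iff_induce_connected (S := Set.univ) (by simp) (by simp)).2
    ((SimpleGraph.induceUnivIso G).connected_iff.2 hG)
  wt_symm u v := by rw [Sym2.eq_swap]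
  wt_nonneg u v huv := hw _ (of_decide_eq_true huv)

lemma cutWeight_nonneg (hw : ∀ e ∈ G.edgeSet, 0 ≤ w e) (S : Set (Fin n)) :
    0 ≤ cutWeight G w S := by
  classical
  exact Finset.sum_nonneg fun e he => hw e (Set.mem_toFinset.1 he).1

lemma connected_output_runWCMC (hG : G.Connected) (hw : ∀ e ∈ G.edgeSet, 0 ≤ w e) (ε : ℝ) :
    (G.induce (output (runWCMC ε G w))).Connected := by
  classical
  exact (connOn_iff_induce_connected (fun _ _ => decide_eq_true_iff) fun _ => Iff.rfl).1
    ((wellWeighted_of_connected hG hw).connOn_wcmc ε)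

theorem cutWeight_le_lossFactor_mul (hG : G.Connected) (hw : ∀ e ∈ G.edgeSet, 0 ≤ w e)
    (hε : 0 < ε) (hε₁ : ε ≤ 1) (hT : (G.induce T).Connected) :
    cutWeight G w T ≤
      lossFactor ε * (1 + Real.log n) ^ 2 * cutWeight G w (output (runWCMC ε G w)) := by
  classical
  have hadj : ∀ u v, decide (G.Adj u v) = true ↔ G.Adj u v := fun u v => decide_eq_true_iff
  have hmem : ∀ v, decide (v ∈ T) = true ↔ v ∈ T := fun v => decide_eq_true_iff
  rw [cutWeight_eq_cutW w hadj hmem,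
    cutWeight_eq_cutW (S := output (runWCMC ε G w)) w hadj fun _ => Iff.rfl]
  exact cutW_le_lossFactor_mul (wellWeighted_of_connected hG hw) hε hε₁
    ((connOn_iff_induce_connected hadj hmem).2 hT)

lemma one_add_log_sq_le (hn : 2 ≤ n) : (1 + Real.log n) ^ 2 ≤ 9 * Real.log n ^ 2 := by
  have hlog : Real.log 2 ≤ Real.log n :=
    Real.log_le_log two_pos (by exact_mod_cast hn)
  nlinarith [Real.log_two_gt_d9]

end Graph

end CMC

theorem mainTheorem2 (ε : ℝ) (hε₀ : 0 < ε) (hε₁ : ε ≤ 1) :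
    ∃ c : ℝ, 0 < c ∧ ∃ p : Polynomial ℕ,
      ∀ (n : ℕ) (G : SimpleGraph (Fin n)) (w : Sym2 (Fin n) → ℝ),
        G.Connected → (∀ e ∈ G.edgeSet, 0 ≤ w e) →
          (G.induce (CMC.output (CMC.runWCMC ε G w))).Connected ∧
          (∀ T : Set (Fin n), (G.induce T).Connected →
            c / Real.log n ^ 2 * CMC.cutWeight G w T ≤
              CMC.cutWeight G w (CMC.output (CMC.runWCMC ε G w))) ∧
          (CMC.runWCMC ε G w).time ≤ p.eval n := by
  obtain ⟨p, hp⟩ := CMC.exists_wcmc_time_le hε₀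
  have hloss := CMC.lossFactor_pos hε₀ hε₁
  refine ⟨1 / (9 * CMC.lossFactor ε), by positivity, p, fun n G w hG hw =>
    ⟨CMC.connected_output_runWCMC hG hw ε, fun T hT => ?_, hp n _ _⟩⟩
  have hβ : 0 ≤ CMC.cutWeight G w (CMC.output (CMC.runWCMC ε G w)) := CMC.cutWeight_nonneg hw _
  rcases (Real.log_natCast_nonneg n).eq_or_lt with hlog | hlog
  · simpa [← hlog] using hβ
  have hn : 2 ≤ n := Nat.succ_le_of_lt (by exact_mod_cast (Real.log_pos_iff n.cast_nonneg).1 hlog)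
  rw [div_div, div_mul_eq_mul_div, one_mul, div_le_iff₀ (by positivity)]
  calc CMC.cutWeight G w T
      ≤ CMC.lossFactor ε * (1 + Real.log n) ^ 2 *
          CMC.cutWeight G w (CMC.output (CMC.runWCMC ε G w)) :=
        CMC.cutWeight_le_lossFactor_mul hG hw hε₀ hε₁ hT
    _ ≤ CMC.lossFactor ε * (9 * Real.log n ^ 2) *
          CMC.cutWeight G w (CMC.output (CMC.runWCMC ε G w)) := by
        gcongr
        exact CMC.one_add_log_sq_le hn
    _ = CMC.cutWeight G w (CMC.output (CMC.runWCMC ε G w)) *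
          (9 * CMC.lossFactor ε * Real.log n ^ 2) := by ring
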